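/- Let $\mathcal S$ be a finite collection of $n$ finite sets, each with at most $k$ elements. A packing is a subcollection of $\mathcal S$ whose members are pairwise disjoint. For a packing $\mathcal A$ and a set $v$, let $N_{\mathcal A}(v)$ be the collection of the members of $\mathcal A$ that intersect $v$; the degree of $v\in\mathcal C=\mathcal S\setminus\mathcal A$ is $|N_{\mathcal A}(v)|$. *Local improvement of size at most $p$*: a replacement of $\mathcal Q\subseteq\mathcal A$ by $\mathcal P\subseteq\mathcal C$ with $|\mathcal P|=|\mathcal Q|+1\le p$ such that $(\mathcal A\setminus\mathcal Q)\cup\mathcal P$ is a packing. *Tail change* associated with $(v,u)$, where $v\in\mathcal C$ has degree at least $3$: a swap of $U\subseteq\mathcal A$ with a collection $V\subseteq\mathcal C$ of pairwise disjoint sets, $|U|=|V|$, such that $v\notin V$, $u$ is the unique neighbour of $v$ in $U$, and $\bigcup_{w\in V}N_{\mathcal A}(w)=U$. Its size is $|V|$. Two tail changes $(v,u,U,V)$ and $(v',u',U',V')$ are *consistent* if either $v\ne v'$ and $(\{v\}\cup V)\cap(\{v'\}\cup V')=\emptyset$, or $v=v'$, $u\neq u'$ and $V\cap V'=\emptyset$,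 and moreover $v$ and $v'$ each have at least two neighbours in $\mathcal A\setminus(U\cup U')$. *Canonical improvement with tail changes, with parameters $\ell,\tau$*: there are $I\subseteq\mathcal C$ with $|I|\le\ell$ and a collection of pairwise consistent tail changes, each of size at most $\tau$ and each associated with an edge of some $v\in I$ of degree at least $3$, which together replace $U\subseteq \mathcal A$ by $V\subseteq\mathcal C$, such that $V\cap I=\emptyset$ and every $v\in I$ of degree at least $3$ has exactly two neighbours in $\mathcal A\setminus U$. Consider the multigraph with vertex set $\mathcal A$ in which every $v\in I$ of degree $1$ is a self-loop at its neighbour, every $v\in I$ of degree $2$ is an edge between its two neighbours, and every $v\in I$ of degree at least $3$ is an edge between its two neighbours in $\mathcal A\setminus U$. This multigraph has a subgraph, with vertex set $U'$ and edge set $V'$, of one of the following types: two cycles meeting in a single vertex; two disjoint cycles connected by a path; two cycles with a common arc; a path; a cycle together with a path that starts on it and is otherwise disjoint from it; a cycle (self-loops and pairs of parallel edges count as cycles). Finally, $|V\cup V'|>|U\cup U'|$, and $(\mathcal A\setminus(U\cup U'))\cup(V\cup V')$ is a packing, which replaces $\mathcal A$. *Algorithm LI with parameters $p,\ell,\tau$*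 starts with an arbitrary maximal packing and repeatedly performs a local improvement of size at most $p$ if there is one, and otherwise a canonical improvement with tail changes with parameters $\ell,\tau$; it stops when neither exists. **Theorem.** There are absolute constants $C>0$ and $\varepsilon_0>0$ such that the following holds for all $k\ge2$, all $\varepsilon>0$ and all $\mathcal S$ as above, with $$p=\lceil Ck/\varepsilon\rceil,\qquad \ell=\frac{4}{\min(\varepsilon,\varepsilon_0)}\log_2 n,\qquad \tau=\frac{2(k-1)}{\varepsilon}.$$ Every run of Algorithm LI with these parameters stops, and each of its outputs $\mathcal A$ is a packing with $$|\mathcal B|\le\Bigl(\frac{k+1}{3}+\varepsilon\Bigr)|\mathcal A|\qquad\text{for every packing }\mathcal B .$$ More generally, this inequality holds for every packing $\mathcal A$ that admits neither a local improvement of size at most $p$ nor a canonical improvement with tail changes with parameters $\ell,\tau$. -/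

import Mathlib

namespace SetPacking

section

variable {α : Type*} [DecidableEq α]

/-- `P` is a packing in `S`: a subcollection of pairwise disjoint sets. -/
def IsPacking (S P : Finset (Finset α)) : Prop :=
  P ⊆ S ∧ ∀ s ∈ P, ∀ t ∈ P, s ≠ t → Disjoint s t

/-- An inclusion-maximal packing. -/
def IsMaximalPacking (S P : Finset (Finset α)) : Prop :=
  IsPacking S P ∧ ∀ P', IsPacking S P' → P ⊆ P' → P' = P

/-- The neighbours of the set `v` in the collection `A`, in the conflict graph: the members of
`A` that intersect `v`. -/
def nbrs (A : Finset (Finset α)) (v : Finset α) : Finset (Finset α) :=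
  A.filter fun u => ¬ Disjoint u v

/-- A local improvement of size at most `p` turning `A` into `A'`: some `q + 1 ≤ p` sets outside
`A` replace `q` sets of `A`, and the result is a packing. -/
def LocalImprovement (S : Finset (Finset α)) (p : ℕ) (A A' : Finset (Finset α)) : Prop :=
  ∃ P Q : Finset (Finset α), P ⊆ S \ A ∧ Q ⊆ A ∧ P.card = Q.card + 1 ∧ P.card ≤ p ∧
    A' = (A \ Q) ∪ P ∧ IsPacking S A'

/-- The data of a swap of the sets `out` (called `U` below) against the sets `inn` (called `V`),
attached to the edge `(vertex, root)` of the conflict graph. -/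
structure Swap (α : Type*) where
  vertex : Finset α
  root : Finset α
  out : Finset (Finset α)
  inn : Finset (Finset α)

/-- The swap `T` is a tail change associated with the edge `(v, u) = (T.vertex, T.root)`:
`v ∈ S \ A` has degree at least 3; `U ⊆ A`; `V ⊆ S \ A` consists of disjoint sets; `|U| = |V|`;
`v ∉ V`; `u` is the unique neighbour of `v` in `U`; the neighbours of `V` in `A` are exactly `U`. -/
def IsTailChange (S A : Finset (Finset α)) (T : Swap α) : Prop :=
  T.vertex ∈ S \ A ∧ 3 ≤ (nbrs A T.vertex).card ∧
  T.out ⊆ A ∧ IsPacking (S \ A) T.inn ∧ T.out.card = T.inn.card ∧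
  T.vertex ∉ T.inn ∧
  nbrs T.out T.vertex = {T.root} ∧
  T.inn.biUnion (nbrs A) = T.out

/-- Consistency of two tail changes. -/
def Consistent (A : Finset (Finset α)) (T T' : Swap α) : Prop :=
  ((T.vertex ≠ T'.vertex ∧ Disjoint (insert T.vertex T.inn) (insert T'.vertex T'.inn)) ∨
    (T.vertex = T'.vertex ∧ T.root ≠ T'.root ∧ Disjoint T.inn T'.inn)) ∧
  2 ≤ (nbrs (A \ (T.out ∪ T'.out)) T.vertex).card ∧
  2 ≤ (nbrs (A \ (T.out ∪ T'.out)) T'.vertex).card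

/-- The ends, in the auxiliary multigraph with vertex set `A`, of the edge given by the set `v`:
its neighbours in `A` if there are at most two of them, and otherwise those neighbours that
remain after the sets `U` have been swapped out. -/
def ends (A U : Finset (Finset α)) (v : Finset α) : Finset (Finset α) :=
  if (nbrs A v).card ≤ 2 then nbrs A v else nbrs (A \ U) v

/-- In the auxiliary multigraph with edges from `I`, the edge `e` joins `x` and `y`; it is a
self-loop at `x` if `x = y`. -/
def Joins (A U I : Finset (Finset α)) (e x y : Finset α) : Prop :=
  e ∈ I ∧ ends A U e = {x, y}

end

section Multigraph

variable {β γ : Type*} [DecidableEq β] [DecidableEq γ]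

/-- In the multigraph with incidence `J` (`J e x y`: the edge `e` joins `x` and `y`),
there is a path from `x` to `y` without repeated vertices, with vertex set `W` and edge set `F`. -/
inductive IsPath (J : γ → β → β → Prop) : β → β → Finset β → Finset γ → Prop
  | nil (x : β) : IsPath J x x {x} ∅
  | cons {e : γ} {x y z : β} {W : Finset β} {F : Finset γ} (h : J e x y) (hp : IsPath J y z W F)
      (hx : x ∉ W) : IsPath J x z (insert x W) (insert e F)

/-- There is a cycle through `x` with vertex set `W` and edge set `F`: a path from `x` to some `y`
closed up by a further edge. Self-loops and pairs of parallel edges are cycles. -/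
def IsCycle (J : γ → β → β → Prop) (x : β) (W : Finset β) (F : Finset γ) : Prop :=
  ∃ y F' e, IsPath J x y W F' ∧ e ∉ F' ∧ J e y x ∧ F = insert e F'

/-- The subgraph with vertex set `W` and edge set `F` is of one of the six types. -/
inductive IsCanonicalShape (J : γ → β → β → Prop) : Finset β → Finset γ → Prop
  /-- two cycles that meet in a single vertex -/
  | twoCycles {x : β} {W₁ W₂ : Finset β} {F₁ F₂ : Finset γ}
      (h₁ : IsCycle J x W₁ F₁) (h₂ : IsCycle J x W₂ F₂)
      (hW : W₁ ∩ W₂ = {x}) (hF : Disjoint F₁ F₂) :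
      IsCanonicalShape J (W₁ ∪ W₂) (F₁ ∪ F₂)
  /-- two disjoint cycles connected by a path -/
  | dumbbell {x y : β} {W₁ W₂ W₃ : Finset β} {F₁ F₂ F₃ : Finset γ}
      (h₁ : IsCycle J x W₁ F₁) (h₂ : IsCycle J y W₂ F₂) (h₃ : IsPath J x y W₃ F₃)
      (h₁₂ : Disjoint W₁ W₂) (h₁₃ : W₁ ∩ W₃ = {x}) (h₂₃ : W₂ ∩ W₃ = {y}) :
      IsCanonicalShape J (W₁ ∪ W₂ ∪ W₃) (F₁ ∪ F₂ ∪ F₃)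
  /-- two cycles with a common arc: three internally disjoint paths between two vertices -/
  | theta {x y : β} {W₁ W₂ W₃ : Finset β} {F₁ F₂ F₃ : Finset γ} (hxy : x ≠ y)
      (h₁ : IsPath J x y W₁ F₁) (h₂ : IsPath J x y W₂ F₂) (h₃ : IsPath J x y W₃ F₃)
      (h₁₂ : W₁ ∩ W₂ = {x, y}) (h₁₃ : W₁ ∩ W₃ = {x, y}) (h₂₃ : W₂ ∩ W₃ = {x, y})
      (hF₁₂ : Disjoint F₁ F₂) (hF₁₃ : Disjoint F₁ F₃) (hF₂₃ : Disjoint F₂ F₃) :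
      IsCanonicalShape J (W₁ ∪ W₂ ∪ W₃) (F₁ ∪ F₂ ∪ F₃)
  /-- a path -/
  | path {x y : β} {W : Finset β} {F : Finset γ} (h : IsPath J x y W F) :
      IsCanonicalShape J W F
  /-- a cycle and a path that starts on it and does not meet it again -/
  | lollipop {x y : β} {W₁ W₂ : Finset β} {F₁ F₂ : Finset γ}
      (h₁ : IsCycle J x W₁ F₁) (h₂ : IsPath J x y W₂ F₂) (hW : W₁ ∩ W₂ = {x}) :
      IsCanonicalShape J (W₁ ∪ W₂) (F₁ ∪ F₂)
  /-- a cycle -/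
  | cycle {x : β} {W : Finset β} {F : Finset γ} (h : IsCycle J x W F) :
      IsCanonicalShape J W F

end Multigraph

section

variable {α : Type*} [DecidableEq α]

/-- A canonical improvement with tail changes turning `A` into `A'`. There are a set `I` of at most
`ℓ` members of `S \ A` and a collection `𝒯` of pairwise consistent tail changes, each of size at
most `τ`, of members of `I` of degree at least 3. Together they replace `U ⊆ A` by `V` with
`V ∩ I = ∅`, and bring the degree of each member of `I` of degree at least 3 down to 2. The
auxiliary multigraph on `A` with edges from `I` has a subgraph of one of the six types, with
vertex set `W` and edge set `F`, such that replacing `U ∪ W` by `V ∪ F` is an improvement. -/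
def CanonicalImprovement (S : Finset (Finset α)) (ℓ τ : ℝ) (A A' : Finset (Finset α)) : Prop :=
  ∃ (I : Finset (Finset α)) (𝒯 : Finset (Swap α)) (U V W F : Finset (Finset α)),
    I ⊆ S \ A ∧ (I.card : ℝ) ≤ ℓ ∧
    (∀ T ∈ 𝒯, IsTailChange S A T ∧ T.vertex ∈ I ∧ (T.inn.card : ℝ) ≤ τ) ∧
    (∀ T ∈ 𝒯, ∀ T' ∈ 𝒯, T ≠ T' → Consistent A T T') ∧
    U = 𝒯.biUnion Swap.out ∧ V = 𝒯.biUnion Swap.inn ∧ Disjoint V I ∧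
    (∀ v ∈ I, 3 ≤ (nbrs A v).card → (nbrs (A \ U) v).card = 2) ∧
    W ⊆ A ∧ IsCanonicalShape (Joins A U I) W F ∧
    (U ∪ W).card < (V ∪ F).card ∧
    A' = (A \ (U ∪ W)) ∪ (V ∪ F) ∧ IsPacking S A'

/-- One step of Algorithm LI: a local improvement of size at most `p` if there is one, and
otherwise a canonical improvement with tail changes. -/
def LIStep (S : Finset (Finset α)) (p : ℕ) (ℓ τ : ℝ) (A A' : Finset (Finset α)) : Prop :=
  LocalImprovement S p A A' ∨
    ((∀ A'', ¬ LocalImprovement S p A A'') ∧ CanonicalImprovement S ℓ τ A A')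

/-- `A` is a possible output of Algorithm LI: it is reached by steps of the algorithm from some
maximal packing, and no further step is possible. -/
def LIOutput (S : Finset (Finset α)) (p : ℕ) (ℓ τ : ℝ) (A : Finset (Finset α)) : Prop :=
  (∃ A₀, IsMaximalPacking S A₀ ∧ Relation.ReflTransGen (LIStep S p ℓ τ) A₀ A) ∧
    ∀ A', ¬ LIStep S p ℓ τ A A'

end

end SetPacking

/-! Fix packings A and B, where A admits no improvement, and view the members of `B \ A` as
hyperedges on the vertex set `A \ B`, each being its set of neighbours. Hyperedge sizes and vertex
degrees are at most k. The absence of local improvements says that any p or fewer hyperedges cover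
at least as many vertices as there are hyperedges; this is all that `LocalSystem` records. If every
hyperedge had at least three vertices, double counting incidences would give ratio k/3. The small
hyperedges form a multigraph, and many more edges than vertices in it would yield a small improving
subgraph. Tail changes enlarge this multigraph: a hyperedge acts as an edge if all but two of its
vertices lie in small balanced trees of other hyperedges that it cuts off (`Good`).

The multigraph is extracted from a good collection X that maximizes a `potential` and then a `mass`.
The exchange argument `Optimal.card_N` shows that every hyperedge outside X has at least three
vertices plus one for each small tree it meets, apart from exceptions that are one short and have a
single vertex outside the small trees. Such a hyperedge could otherwise be added to X, or exchanged
for the member y that blocks it (`Blocked`).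

Counting incidences then gives 3|B| ≤ (k+1)|A| + 2σ + errors (`Optimal.card_B_le`, `exists_good`),
where σ is the total surplus of hyperedges over vertices in the components of X that have one. The
exceptions are charged to disjoint connected pieces that are either large or whole components with a
deficit (`exists_disjoint_grown`). Hence a ratio above (k+1)/3 + ε forces σ ≥ ε|A|.

Discarding the trees cut off by the core of X leaves a genuine multigraph with the same surplus
(`Ends.exists_surplus`), so its density exceeds 1 by a constant. Breadth-first search finds in it a
subgraph of logarithmic size with more edges than vertices, and a minimal such subgraph is two
cycles joined in one of three ways (`exists_small_canonicalShape`). With the tails of its edges this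
is a canonical improvement (`exists_canonicalImprovement`), a contradiction. Termination is
immediate, since every step enlarges the packing. -/

namespace SetPacking

/-! ### Hypergraph components, tight sets and balanced trees -/

/-- A bipartite incidence system between `A` and `B`, given by the neighbourhoods `N b ⊆ A` of the
members `b` of `B`, in which every small part of `B` expands. -/
structure LocalSystem (β γ : Type*) [DecidableEq β] [DecidableEq γ] where
  A : Finset β
  B : Finset γ
  N : γ → Finset β
  k : ℕ
  s : ℕ
  p : ℕ
  subset : ∀ b ∈ B, N b ⊆ A
  card_le : ∀ b ∈ B, (N b).card ≤ k
  expand : ∀ V ⊆ B, V.card ≤ p → V.card ≤ (V.biUnion N).card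
  size : 1 + k * s ≤ p

namespace LocalSystem

open Finset

variable {β γ : Type*} [DecidableEq β] [DecidableEq γ] (G : LocalSystem β γ)

theorem nonempty {b : γ} (hb : b ∈ G.B) : (G.N b).Nonempty := by
  have h := G.expand {b} (by simpa using hb) (by have := G.size; simp; omega)
  rw [← card_pos]
  simpa using h

/-- `U` is a union of components of the hypergraph with the hyperedges `N b`, `b ∈ X`. -/
def Closed (X : Finset γ) (U : Finset β) : Prop :=
  ∀ b ∈ X, ∀ x ∈ G.N b, x ∈ U → G.N b ⊆ U

open Classical in
/-- The component of `a` in the hypergraph with hyperedges `N b`, `b ∈ X`. -/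
noncomputable def comp (X : Finset γ) (a : β) : Finset β :=
  (insert a (X.biUnion G.N)).filter fun y => ∀ U, G.Closed X U → a ∈ U → y ∈ U

/-- The hyperedges from `X` that lie in `U`. -/
def ins (X : Finset γ) (U : Finset β) : Finset γ := X.filter fun b => G.N b ⊆ U

variable {G} {X Y : Finset γ} {U : Finset β} {a x y : β} {b : γ}

theorem mem_ins : b ∈ G.ins X U ↔ b ∈ X ∧ G.N b ⊆ U := by simp [ins]

theorem ins_subset : G.ins X U ⊆ X := filter_subset _ _

theorem biUnion_ins_subset : (G.ins X U).biUnion G.N ⊆ U := by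
  intro y hy
  obtain ⟨b, hb, hy⟩ := mem_biUnion.1 hy
  exact (mem_ins.1 hb).2 hy

theorem mem_comp_self : a ∈ G.comp X a := by simp +contextual [comp]

theorem comp_subset (hU : G.Closed X U) (ha : a ∈ U) : G.comp X a ⊆ U := by
  intro y hy
  simp only [comp, mem_filter] at hy
  exact hy.2 U hU ha

theorem closed_comp : G.Closed X (G.comp X a) := by
  intro b hb x hx hxa y hy
  simp only [comp, mem_filter] at hxa ⊢
  refine ⟨mem_insert_of_mem (mem_biUnion.2 ⟨b, hb, hy⟩), fun U hU ha => ?_⟩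
  exact hU b hb x hx (hxa.2 U hU ha) hy

theorem Closed.sdiff (hU : G.Closed X U) {U' : Finset β} (hU' : G.Closed X U') :
    G.Closed X (U \ U') := by
  intro b hb x hx hxa y hy
  rw [mem_sdiff] at hxa ⊢
  exact ⟨hU b hb x hx hxa.1 hy, fun h => hxa.2 (hU' b hb y hy h hx)⟩

theorem Closed.mono (h : X ⊆ Y) (hU : G.Closed Y U) : G.Closed X U :=
  fun b hb => hU b (h hb)

/-- Closed sets are stable under differences. If a were missing from the component of y, then the
component of a minus that of y would be a smaller closed set around a. -/
theorem comp_eq_of_mem (h : y ∈ G.comp X a) : G.comp X y = G.comp X a := by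
  apply subset_antisymm (comp_subset closed_comp h)
  by_contra hn
  have ha : a ∉ G.comp X y := fun ha => hn (comp_subset closed_comp ha)
  have := comp_subset (closed_comp.sdiff (closed_comp (X := X) (a := y)))
    (mem_sdiff.2 ⟨mem_comp_self (X := X) (a := a), ha⟩) h
  exact (mem_sdiff.1 this).2 mem_comp_self

theorem mem_comp_comm : y ∈ G.comp X a ↔ a ∈ G.comp X y :=
  ⟨fun h => comp_eq_of_mem h ▸ mem_comp_self, fun h => comp_eq_of_mem h ▸ mem_comp_self⟩

theorem comp_mono (h : X ⊆ Y) : G.comp X a ⊆ G.comp Y a :=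
  comp_subset (closed_comp.mono h) mem_comp_self

theorem subset_comp_of_mem (hb : b ∈ X) (hx : x ∈ G.N b) (h : x ∈ G.comp X a) :
    G.N b ⊆ G.comp X a := closed_comp b hb x hx h

theorem comp_disjoint (h : G.comp X a ≠ G.comp X y) : Disjoint (G.comp X a) (G.comp X y) := by
  rw [Finset.disjoint_left]
  intro z h1 h2
  exact h ((comp_eq_of_mem h1).symm.trans (comp_eq_of_mem h2))

/-- A component depends only on the hyperedges that meet it. -/
theorem comp_congr (h1 : ∀ b ∈ X, ∀ x ∈ G.N b, x ∈ G.comp X a → b ∈ Y)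
    (h2 : ∀ b ∈ Y, ∀ x ∈ G.N b, x ∈ G.comp X a → b ∈ X) : G.comp Y a = G.comp X a := by
  have h : G.comp Y a ⊆ G.comp X a :=
    comp_subset (fun b hb x hx hxa => closed_comp b (h2 b hb x hx hxa) x hx hxa) mem_comp_self
  refine subset_antisymm h (comp_subset (fun b hb x hx hxa => ?_) mem_comp_self)
  exact closed_comp b (h1 b hb x hx (h hxa)) x hx hxa

theorem comp_erase (h : Disjoint (G.N b) (G.comp X a)) : G.comp (X.erase b) a = G.comp X a := by
  apply comp_congr
  · intro c hc x hx hxa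
    refine mem_erase.2 ⟨?_, hc⟩
    rintro rfl
    exact disjoint_left.1 h hx hxa
  · intro c hc x hx hxa
    exact mem_of_mem_erase hc

theorem comp_erase' (h : Disjoint (G.N b) (G.comp (X.erase b) a)) :
    G.comp X a = G.comp (X.erase b) a := by
  apply comp_congr
  · intro c hc x hx hxa
    exact mem_of_mem_erase hc
  · intro c hc x hx hxa
    refine mem_erase.2 ⟨?_, hc⟩
    rintro rfl
    exact disjoint_left.1 h hx hxa

theorem comp_insert (h : Disjoint (G.N b) (G.comp X a)) : G.comp (insert b X) a = G.comp X a := by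
  apply comp_congr
  · intro c hc x hx hxa
    exact mem_insert_of_mem hc
  · intro c hc x hx hxa
    rcases mem_insert.1 hc with rfl | hc
    · exact absurd hxa (disjoint_left.1 h hx)
    · exact hc

theorem comp_insert' (h : Disjoint (G.N b) (G.comp (insert b X) a)) :
    G.comp X a = G.comp (insert b X) a := by
  apply comp_congr
  · intro c hc x hx hxa
    rcases mem_insert.1 hc with rfl | hc
    · exact absurd hxa (disjoint_left.1 h hx)
    · exact hc
  · intro c hc x hx hxa
    exact mem_insert_of_mem hc

theorem ins_erase_of_disjoint (hX : b ∈ G.B) (h : Disjoint (G.N b) U) :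
    G.ins (X.erase b) U = G.ins X U := by
  ext c
  simp only [mem_ins, mem_erase]
  refine ⟨fun h => ⟨h.1.2, h.2⟩, fun h' => ⟨⟨?_, h'.1⟩, h'.2⟩⟩
  rintro rfl
  obtain ⟨z, hz⟩ := G.nonempty hX
  exact disjoint_left.1 h hz (h'.2 hz)

theorem ins_insert_of_disjoint (hX : b ∈ G.B) (h : Disjoint (G.N b) U) :
    G.ins (insert b X) U = G.ins X U := by
  ext c
  simp only [mem_ins, mem_insert]
  refine ⟨fun h' => ⟨h'.1.resolve_left ?_, h'.2⟩, fun h => ⟨Or.inr h.1, h.2⟩⟩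
  rintro rfl
  obtain ⟨z, hz⟩ := G.nonempty hX
  exact disjoint_left.1 h hz (h'.2 hz)

theorem comp_subset_A (hX : X ⊆ G.B) (ha : a ∈ G.A) : G.comp X a ⊆ G.A :=
  comp_subset (fun b hb _ _ _ => G.subset b (hX hb)) ha

/-- A connected hypergraph has at most as many vertices as a tree with its hyperedges. -/
theorem card_comp_add_card_ins_le (hX : X ⊆ G.B) :
    (G.comp X a).card + (G.ins X (G.comp X a)).card ≤
      ∑ b ∈ G.ins X (G.comp X a), (G.N b).card + 1 := by
  classical
  set I := G.ins X (G.comp X a) with hI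
  -- The connected part is grown from `a`: each new hyperedge shares a vertex with W, so it brings
  -- at most |N b| - 1 new vertices. A largest Z for which the bound holds has a closed W; the
  -- leftover hyperedges only help, being nonempty.
  let P : Finset γ → Prop := fun Z => ∃ W ⊆ G.comp X a, a ∈ W ∧ Z.biUnion G.N ⊆ W ∧
    W.card + Z.card ≤ ∑ b ∈ Z, (G.N b).card + 1
  obtain ⟨Z, hZ, hmax⟩ := exists_max_image (I.powerset.filter P) card
    ⟨∅, by
      simp only [mem_filter, mem_powerset, empty_subset, true_and, P]
      exact ⟨{a}, by simpa using mem_comp_self, by simp, by simp, by simp⟩⟩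
  simp only [mem_filter, mem_powerset] at hZ hmax
  obtain ⟨hZI, W, hWc, haW, hZW, hcard⟩ := hZ
  by_cases hcl : G.Closed X W
  · have hW : W = G.comp X a := subset_antisymm hWc (comp_subset hcl haW)
    rw [← hW]
    have h1 := card_sdiff_add_card_eq_card hZI
    have h2 : ∑ b ∈ I \ Z, (G.N b).card + ∑ b ∈ Z, (G.N b).card = ∑ b ∈ I, (G.N b).card :=
      sum_sdiff hZI
    have h3 : (I \ Z).card ≤ ∑ b ∈ I \ Z, (G.N b).card := by
      rw [card_eq_sum_ones]
      refine sum_le_sum fun b hb => ?_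
      exact card_pos.2 (G.nonempty (hX (ins_subset (mem_sdiff.1 hb).1)))
    omega
  · exfalso
    simp only [Closed, not_forall] at hcl
    obtain ⟨b, hb, x, hx, hxW, hn⟩ := hcl
    have hbZ : b ∉ Z := fun h => hn ((subset_biUnion_of_mem G.N h).trans hZW)
    have hbI : b ∈ I := mem_ins.2 ⟨hb, subset_comp_of_mem hb hx (hWc hxW)⟩
    have := hmax (insert b Z) ⟨insert_subset hbI hZI, W ∪ G.N b,
      union_subset hWc (mem_ins.1 hbI).2, mem_union_left _ haW, by
        rw [biUnion_insert]
        exact union_subset subset_union_right (hZW.trans subset_union_left), by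
        rw [card_insert_of_notMem hbZ, sum_insert hbZ]
        have h1 := card_union_add_card_inter W (G.N b)
        have h2 : 0 < (W ∩ G.N b).card := card_pos.2 ⟨x, mem_inter.2 ⟨hxW, hx⟩⟩
        omega⟩
    rw [card_insert_of_notMem hbZ] at this
    omega

variable (G) in
/-- `U` carries a small balanced tree of hyperedges from `X`. -/
def TokSet (X : Finset γ) (U : Finset β) : Prop :=
  (G.ins X U).card = U.card ∧ U.card ≤ G.s ∧ ∑ b ∈ G.ins X U, (G.N b).card + 1 = 2 * U.card

variable (G) in
/-- The component of `a` is a small balanced tree. -/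
def Tok (X : Finset γ) (a : β) : Prop := G.TokSet X (G.comp X a)

variable (G) in
/-- The component of `a` is a small balanced tree that `b` meets in `a` only. -/
def STok (X : Finset γ) (b : γ) (a : β) : Prop :=
  G.Tok X a ∧ G.N b ∩ G.comp X a = {a}

theorem Tok.congr_mem (h : y ∈ G.comp X a) : G.Tok X y ↔ G.Tok X a := by
  simp only [Tok, comp_eq_of_mem h]

/-- Submodularity: covered vertices minus hyperedges, as a function of the collection, does not
exceed the sum of its values on the two parts minus its value on the intersection, which expansion
makes nonnegative. -/
theorem tight_union_extra (V₁ V₂ : Finset γ) (S : Finset β) (h2 : V₂ ⊆ G.B) (hp : V₂.card ≤ G.p)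
    {c : ℕ} (hV₁ : (V₁.biUnion G.N ∪ S).card ≤ V₁.card + c)
    (hV₂ : (V₂.biUnion G.N).card ≤ V₂.card) :
    ((V₁ ∪ V₂).biUnion G.N ∪ S).card ≤ (V₁ ∪ V₂).card + c := by
  have h := G.expand (V₁ ∩ V₂) (inter_subset_right.trans h2)
    ((card_le_card inter_subset_right).trans hp)
  have h' : (V₁ ∩ V₂).biUnion G.N ⊆ (V₁.biUnion G.N ∪ S) ∩ V₂.biUnion G.N :=
    subset_inter ((biUnion_subset_biUnion_of_subset_left _ inter_subset_left).trans
      subset_union_left) (biUnion_subset_biUnion_of_subset_left _ inter_subset_right)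
  have h'' := card_le_card h'
  have e1 := card_union_add_card_inter V₁ V₂
  have e2 := card_union_add_card_inter (V₁.biUnion G.N ∪ S) (V₂.biUnion G.N)
  rw [union_biUnion, union_right_comm]
  omega

/-- Attaching small balanced sets does not increase the surplus of vertices. -/
theorem tight_biUnion {ι : Type*} [DecidableEq ι] (M : Finset ι) (T : ι → Finset γ) (V : Finset γ)
    (S : Finset β) {c : ℕ} (hT : ∀ i ∈ M, T i ⊆ G.B ∧ (T i).card ≤ G.p ∧
      ((T i).biUnion G.N).card ≤ (T i).card)
    (hV : (V.biUnion G.N ∪ S).card ≤ V.card + c) :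
    ((V ∪ M.biUnion T).biUnion G.N ∪ S).card ≤ (V ∪ M.biUnion T).card + c := by
  induction M using Finset.induction_on with
  | empty => simpa using hV
  | insert i M hi ih =>
    have h := hT i (mem_insert_self _ _)
    rw [biUnion_insert, union_comm (T i), ← union_assoc]
    exact tight_union_extra _ _ _ h.1 h.2.1 (ih fun j hj => hT j (mem_insert_of_mem hj)) h.2.2

theorem s_le_p (hX : b ∈ G.B) : G.s ≤ G.p := by
  have h1 := card_pos.2 (G.nonempty hX)
  have h2 := G.card_le b hX
  have h3 := G.size
  nlinarith

/-- Small balanced sets cover no neighbourhood of a further hyperedge. -/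
theorem not_all_tight (hX : X ⊆ G.B) (hb : b ∈ G.B) (hbX : b ∉ X)
    (h : ∀ a ∈ G.N b, ∃ T ⊆ X, T.card ≤ G.s ∧ (T.biUnion G.N).card ≤ T.card ∧
      a ∈ T.biUnion G.N) : False := by
  choose! T hTX hTs hTt hTa using h
  set V := (G.N b).biUnion T with hV
  have hVX : V ⊆ X := biUnion_subset.2 hTX
  have hVc : V.card ≤ G.k * G.s := by
    refine (card_biUnion_le_card_mul _ _ G.s hTs).trans ?_
    exact Nat.mul_le_mul_right _ (G.card_le b hb)
  have hbV : b ∉ V := fun h => hbX (hVX h)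
  -- The union of one tight set for each vertex of b is tight and already covers b, so b is one
  -- hyperedge too many. This is the origin of the bound 1 + k * s in `size`.
  have h1 := G.expand (insert b V) (insert_subset hb (hVX.trans hX)) (by
    rw [card_insert_of_notMem hbV]; have := G.size; omega)
  have h2 : (insert b V).biUnion G.N = V.biUnion G.N := by
    rw [biUnion_insert]
    refine union_eq_right.2 fun a ha => ?_
    obtain ⟨c, hc, hac⟩ := mem_biUnion.1 (hTa a ha)
    exact mem_biUnion.2 ⟨c, mem_biUnion.2 ⟨a, ha, hc⟩, hac⟩
  have h3 : (V.biUnion G.N).card ≤ V.card := by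
    simpa using tight_biUnion (c := 0) (G.N b) T ∅ ∅ (fun a ha =>
      ⟨(hTX a ha).trans hX, (hTs a ha).trans (s_le_p hb), hTt a ha⟩) (by simp)
  rw [h2, card_insert_of_notMem hbV] at h1
  omega

theorem biUnion_ins_of_card (hX : X ⊆ G.B) (hU : (G.ins X U).card = U.card) (hs : U.card ≤ G.p) :
    (G.ins X U).biUnion G.N = U := by
  refine eq_of_subset_of_card_le biUnion_ins_subset ?_
  rw [← hU]
  exact G.expand _ (ins_subset.trans hX) (hU ▸ hs)

theorem Tok.exists_tight (hB : b ∈ G.B) (hX : X ⊆ G.B) (h : G.Tok X a) :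
    ∃ T ⊆ X, T.card ≤ G.s ∧ (T.biUnion G.N).card ≤ T.card ∧ G.comp X a ⊆ T.biUnion G.N := by
  have h' := biUnion_ins_of_card hX h.1 (h.2.1.trans (s_le_p hB))
  exact ⟨G.ins X (G.comp X a), ins_subset, by rw [h.1]; exact h.2.1, by rw [h', h.1], by rw [h']⟩

/-- A surplus on fewer than p vertices would contain |U| + 1 ≤ p hyperedges covering at most |U|
vertices. -/
theorem card_ins_le (hX : X ⊆ G.B) (h : U.card < G.p) : (G.ins X U).card ≤ U.card := by
  by_contra hn
  obtain ⟨V, hV, hVc⟩ := exists_subset_card_eq (Nat.succ_le_of_lt (not_le.1 hn))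
  have h1 := G.expand V (hV.trans (ins_subset.trans hX)) (by omega)
  have h2 := card_le_card ((biUnion_subset_biUnion_of_subset_left G.N hV).trans biUnion_ins_subset)
  omega

/-- Removing a hyperedge `b` from a component leaves the components of the vertices of `N b`. -/
theorem comp_eq_biUnion (hb : b ∈ X) (hbU : G.N b ⊆ G.comp X a) (hB : b ∈ G.B) :
    G.comp X a = (G.N b).biUnion (G.comp (X.erase b)) := by
  apply subset_antisymm
  · obtain ⟨x, hx⟩ := G.nonempty hB
    rw [← comp_eq_of_mem (hbU hx)]
    refine comp_subset (fun c hc y hy hyU => ?_) (mem_biUnion.2 ⟨x, hx, mem_comp_self⟩)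
    by_cases hcb : c = b
    · subst hcb
      exact fun z hz => mem_biUnion.2 ⟨z, hz, mem_comp_self⟩
    · obtain ⟨z, hz, hyz⟩ := mem_biUnion.1 hyU
      exact (subset_comp_of_mem (mem_erase.2 ⟨hcb, hc⟩) hy hyz).trans
        (subset_biUnion_of_mem (G.comp (X.erase b)) hz)
  · refine biUnion_subset.2 fun x hx => ?_
    rw [← comp_eq_of_mem (hbU hx)]
    exact comp_mono (erase_subset _ _)

/-- Removing a hyperedge from a balanced tree leaves balanced trees and a single tree with one
vertex too many. -/
theorem Tok.erase (hX : X ⊆ G.B) (h : G.Tok X a) (hb : b ∈ X) (hbU : G.N b ⊆ G.comp X a) :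
    ∃ q ∈ G.N b, (∀ c ∈ G.N b, c ≠ q → G.STok (X.erase b) b c) ∧
      (G.ins (X.erase b) (G.comp (X.erase b) q)).card < (G.comp (X.erase b) q).card := by
  have hB := hX hb
  set X' := X.erase b with hX'
  have hX'B : X' ⊆ G.B := (erase_subset _ _).trans hX
  set 𝒟 := (G.N b).image (G.comp X') with h𝒟
  have hpd : ∀ D ∈ 𝒟, ∀ D' ∈ 𝒟, D ≠ D' → Disjoint D D' := by
    intro D hD D' hD' hne
    obtain ⟨c, hc, rfl⟩ := mem_image.1 hD
    obtain ⟨c', hc', rfl⟩ := mem_image.1 hD'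
    exact comp_disjoint hne
  have hU : G.comp X a = 𝒟.biUnion id := by
    rw [comp_eq_biUnion hb hbU hB, h𝒟, image_biUnion]; rfl
  have hbn : b ∉ 𝒟.biUnion (G.ins X') := by
    intro hb'
    obtain ⟨D, _, hb'⟩ := mem_biUnion.1 hb'
    exact notMem_erase b X (ins_subset hb')
  have hI : G.ins X (G.comp X a) = insert b (𝒟.biUnion (G.ins X')) := by
    ext c
    simp only [mem_insert, mem_biUnion]
    constructor
    · intro hc
      by_cases hcb : c = b
      · exact Or.inl hcb
      right
      rw [mem_ins] at hc
      obtain ⟨x, hx⟩ := G.nonempty (hX hc.1)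
      obtain ⟨D, hD, hxD⟩ := mem_biUnion.1 (hU ▸ hc.2 hx)
      refine ⟨D, hD, mem_ins.2 ⟨mem_erase.2 ⟨hcb, hc.1⟩, ?_⟩⟩
      obtain ⟨d, hd, rfl⟩ := mem_image.1 hD
      exact subset_comp_of_mem (mem_erase.2 ⟨hcb, hc.1⟩) hx hxD
    · rintro (rfl | ⟨D, hD, hc⟩)
      · exact mem_ins.2 ⟨hb, hbU⟩
      · rw [mem_ins] at hc ⊢
        refine ⟨mem_of_mem_erase hc.1, hc.2.trans ?_⟩
        rw [hU]
        exact subset_biUnion_of_mem id hD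
  have hIpd : ∀ D ∈ 𝒟, ∀ D' ∈ 𝒟, D ≠ D' → Disjoint (G.ins X' D) (G.ins X' D') := by
    intro D hD D' hD' hne
    rw [Finset.disjoint_left]
    intro c hc hc'
    obtain ⟨x, hx⟩ := G.nonempty (hX'B (ins_subset hc))
    exact Finset.disjoint_left.1 (hpd D hD D' hD' hne) ((mem_ins.1 hc).2 hx) ((mem_ins.1 hc').2 hx)
  have c1 : (G.comp X a).card = ∑ D ∈ 𝒟, D.card := by
    rw [hU]; exact card_biUnion hpd
  have c2 : (G.ins X (G.comp X a)).card = ∑ D ∈ 𝒟, (G.ins X' D).card + 1 := by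
    rw [hI, card_insert_of_notMem hbn, card_biUnion hIpd]
  have c3 : ∑ c ∈ G.ins X (G.comp X a), (G.N c).card =
      (G.N b).card + ∑ D ∈ 𝒟, ∑ c ∈ G.ins X' D, (G.N c).card := by
    rw [hI, sum_insert hbn, sum_biUnion hIpd]
  have c4 : ∀ D ∈ 𝒟, D.card + (G.ins X' D).card ≤ ∑ c ∈ G.ins X' D, (G.N c).card + 1 := by
    intro D hD
    obtain ⟨d, hd, rfl⟩ := mem_image.1 hD
    exact card_comp_add_card_ins_le hX'B
  have hsub : ∀ D ∈ 𝒟, D.card ≤ G.s := by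
    intro D hD
    refine (card_le_card ?_).trans h.2.1
    rw [hU]
    exact subset_biUnion_of_mem id hD
  have c5 : ∀ D ∈ 𝒟, (G.ins X' D).card ≤ D.card := by
    intro D hD
    apply card_ins_le hX'B
    have h1 := hsub D hD
    have h2 := G.size
    have h3 := (card_pos.2 (G.nonempty hB)).trans_le (G.card_le b hB)
    nlinarith
  have c6 := sum_le_sum c4
  rw [sum_add_distrib, sum_add_distrib, ← card_eq_sum_ones] at c6
  obtain ⟨t1, t2, t3⟩ := h
  -- Summing the tree bound over the pieces gives at least |N b| pieces, because the whole is a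
  -- tree. So the vertices of b lie in distinct pieces, and the bound is an equality for each piece.
  have hcard : 𝒟.card = (G.N b).card := by
    have : 𝒟.card ≤ (G.N b).card := card_image_le
    omega
  have hinj : Set.InjOn (G.comp X') (G.N b : Set β) := card_image_iff.1 hcard
  have c7 : ∀ D ∈ 𝒟, D.card + (G.ins X' D).card = ∑ c ∈ G.ins X' D, (G.N c).card + 1 := by
    apply (sum_eq_sum_iff_of_le c4).1
    rw [sum_add_distrib, sum_add_distrib, ← card_eq_sum_ones]
    omega
  -- Removing b leaves one hyperedge fewer than vertices. Since no piece has a surplus (`c5`), a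
  -- single piece carries this deficit and the others are balanced.
  have c8 : ∃ D ∈ 𝒟, (G.ins X' D).card < D.card := by
    apply exists_lt_of_sum_lt
    omega
  obtain ⟨D, hD, hlt⟩ := c8
  obtain ⟨q, hq, rfl⟩ := mem_image.1 hD
  refine ⟨q, hq, fun c hc hcq => ?_, hlt⟩
  have hcD : G.comp X' c ∈ 𝒟 := mem_image_of_mem _ hc
  have hne : G.comp X' c ≠ G.comp X' q := fun h => hcq (hinj hc hq h)
  have hbal : (G.ins X' (G.comp X' c)).card = (G.comp X' c).card := by
    refine le_antisymm (c5 _ hcD) (not_lt.1 fun hlt' => ?_)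
    have e1 := add_sum_erase 𝒟 (fun D => D.card) hD
    have e2 := add_sum_erase 𝒟 (fun D => (G.ins X' D).card) hD
    have hlt2 : ∑ D ∈ 𝒟.erase (G.comp X' q), (G.ins X' D).card <
        ∑ D ∈ 𝒟.erase (G.comp X' q), D.card :=
      sum_lt_sum (fun D hD => c5 D (mem_of_mem_erase hD)) ⟨_, mem_erase.2 ⟨hne, hcD⟩, hlt'⟩
    omega
  refine ⟨⟨hbal, hsub _ hcD, ?_⟩, ?_⟩
  · have := c7 _ hcD
    omega
  · ext z
    simp only [mem_inter, mem_singleton]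
    constructor
    · rintro ⟨hz, hzc⟩
      exact hinj hz hc (comp_eq_of_mem hzc)
    · rintro rfl
      exact ⟨hc, mem_comp_self⟩

end LocalSystem

end SetPacking

/-! ### The exchange argument for optimal collections -/

namespace SetPacking

namespace LocalSystem

open Finset

section Exchange

variable {β γ : Type*} [DecidableEq β] [DecidableEq γ] {G : LocalSystem β γ}
  {X Y : Finset γ} {U : Finset β} {a c x z : β} {b y : γ}

theorem TokSet.insert (hb : b ∈ G.B) (h : Disjoint (G.N b) U) (hU : G.TokSet X U) :
    G.TokSet (insert b X) U := by
  simpa only [TokSet, ins_insert_of_disjoint hb h] using hU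

theorem TokSet.of_insert (hb : b ∈ G.B) (h : Disjoint (G.N b) U)
    (hU : G.TokSet (Insert.insert b X) U) :
    G.TokSet X U := by
  simpa only [TokSet, ins_insert_of_disjoint hb h] using hU

theorem TokSet.erase (hb : b ∈ G.B) (h : Disjoint (G.N b) U) (hU : G.TokSet X U) :
    G.TokSet (X.erase b) U := by
  simpa only [TokSet, ins_erase_of_disjoint hb h] using hU

theorem TokSet.of_erase (hb : b ∈ G.B) (h : Disjoint (G.N b) U) (hU : G.TokSet (X.erase b) U) :
    G.TokSet X U := by
  simpa only [TokSet, ins_erase_of_disjoint hb h] using hU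

theorem STok.insert (hb : b ∈ G.B) (hd : Disjoint (G.N b) (G.comp X a)) (h : G.STok X y a) :
    G.STok (insert b X) y a := by
  have e := comp_insert hd
  refine ⟨?_, by rw [e]; exact h.2⟩
  rw [Tok, e]
  exact TokSet.insert hb hd h.1

theorem STok.of_insert (hb : b ∈ G.B) (hd : Disjoint (G.N b) (G.comp (Insert.insert b X) a))
    (h : G.STok (Insert.insert b X) y a) : G.STok X y a := by
  have e := comp_insert' hd
  refine ⟨?_, by rw [e]; exact h.2⟩
  rw [Tok, e]
  exact TokSet.of_insert hb hd h.1

theorem STok.erase (hb : b ∈ G.B) (hd : Disjoint (G.N b) (G.comp X a)) (h : G.STok X y a) :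
    G.STok (X.erase b) y a := by
  have e := comp_erase hd
  refine ⟨?_, by rw [e]; exact h.2⟩
  rw [Tok, e]
  exact TokSet.erase hb hd h.1

theorem STok.of_erase (hb : b ∈ G.B) (hd : Disjoint (G.N b) (G.comp (X.erase b) a))
    (h : G.STok (X.erase b) y a) : G.STok X y a := by
  have e := comp_erase' hd
  refine ⟨?_, by rw [e]; exact h.2⟩
  rw [Tok, e]
  exact TokSet.of_erase hb hd h.1

theorem STok.mem (h : G.STok X y a) : a ∈ G.N y := by
  have : a ∈ G.N y ∩ G.comp X a := by rw [h.2]; simp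
  exact (mem_inter.1 this).1

theorem STok.eq (h : G.STok X y a) (hx : x ∈ G.N y) (hxa : x ∈ G.comp X a) : x = a := by
  have : x ∈ G.N y ∩ G.comp X a := mem_inter.2 ⟨hx, hxa⟩
  rw [h.2] at this
  simpa using this

variable (G) in
open Classical in
/-- The neighbours of `b` that are not cut off by `b` in a small balanced tree. -/
noncomputable def rest (X : Finset γ) (b : γ) : Finset β :=
  (G.N b).filter fun a => ¬ G.STok (X.erase b) b a

variable (G) in
/-- Every member of `X` has at most two neighbours outside the trees that it cuts off. -/
def Good (X : Finset γ) : Prop := X ⊆ G.B ∧ ∀ b ∈ X, (G.rest X b).card ≤ 2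

variable (G) in
open Classical in
/-- The components that are small balanced trees. -/
noncomputable def tokens (X : Finset γ) : Finset (Finset β) :=
  (G.A.image (G.comp X)).filter (G.TokSet X)

variable (G) in
open Classical in
/-- The components met by `b` that are small balanced trees. -/
noncomputable def toks (X : Finset γ) (b : γ) : Finset (Finset β) :=
  ((G.N b).filter (G.Tok X)).image (G.comp X)

variable (G) in
open Classical in
/-- The number of vertices in small balanced trees. -/
noncomputable def mass (X : Finset γ) : ℕ := (G.A.filter (G.Tok X)).card

variable (G) in
/-- The quantity that an optimal collection maximizes first. -/
noncomputable def potential (X : Finset γ) : ℤ :=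
  ∑ b ∈ X, (3 - ((G.N b).card : ℤ)) - (G.tokens X).card

variable (G) in
/-- A good collection of maximal potential and, among these, of maximal mass. -/
def Optimal (X : Finset γ) : Prop :=
  G.Good X ∧ ∀ Y, G.Good Y → G.potential Y ≤ G.potential X ∧
    (G.potential Y = G.potential X → G.mass Y ≤ G.mass X)

variable (G) in
theorem exists_optimal : ∃ X, G.Optimal X := by
  classical
  obtain ⟨X, hX, hmax⟩ := exists_max_image (G.B.powerset.filter G.Good)
    (fun X => toLex (G.potential X, G.mass X)) ⟨∅, by simp [Good]⟩
  refine ⟨X, (mem_filter.1 hX).2, fun Y hY => ?_⟩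
  have h := hmax Y (mem_filter.2 ⟨mem_powerset.2 hY.1, hY⟩)
  rw [Prod.Lex.toLex_le_toLex] at h
  simp only at h
  rcases h with h | h
  · exact ⟨h.le, fun e => absurd e h.ne⟩
  · exact ⟨h.1.le, fun _ => h.2⟩

theorem mem_rest : a ∈ G.rest X b ↔ a ∈ G.N b ∧ ¬ G.STok (X.erase b) b a := by simp [rest]

theorem rest_subset_N : G.rest X b ⊆ G.N b := fun _ h => (mem_rest.1 h).1

theorem mem_tokens : U ∈ G.tokens X ↔ (∃ a ∈ G.A, G.comp X a = U) ∧ G.TokSet X U := by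
  simp [tokens]

theorem mem_toks : U ∈ G.toks X b ↔ ∃ a ∈ G.N b, G.Tok X a ∧ G.comp X a = U := by
  simp [toks, and_assoc]

theorem toks_subset (hb : b ∈ G.B) : G.toks X b ⊆ G.tokens X := by
  intro U hU
  obtain ⟨a, ha, hT, rfl⟩ := mem_toks.1 hU
  exact mem_tokens.2 ⟨⟨a, G.subset b hb ha, rfl⟩, hT⟩

theorem potential_insert (hbX : b ∉ X) : G.potential (insert b X) =
    G.potential X + (3 - ((G.N b).card : ℤ)) + (G.tokens X).card - (G.tokens (insert b X)).card := by
  rw [potential, potential, sum_insert hbX]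
  ring

theorem potential_erase (hbX : b ∈ X) : G.potential (X.erase b) =
    G.potential X - (3 - ((G.N b).card : ℤ)) + (G.tokens X).card - (G.tokens (X.erase b)).card := by
  rw [potential, potential, ← add_sum_erase X _ hbX]
  ring

theorem mem_tokens_of_insert (hb : b ∈ G.B) (hU : U ∈ G.tokens (insert b X))
    (hd : Disjoint (G.N b) U) : U ∈ G.tokens X \ G.toks X b := by
  obtain ⟨⟨a, ha, rfl⟩, hT⟩ := mem_tokens.1 hU
  refine mem_sdiff.2 ⟨mem_tokens.2 ⟨⟨a, ha, comp_insert' hd⟩, TokSet.of_insert hb hd hT⟩, fun h => ?_⟩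
  obtain ⟨c, hc, -, h⟩ := mem_toks.1 h
  exact disjoint_left.1 hd hc (h ▸ mem_comp_self)

/-- In a small balanced tree, a further hyperedge attached at a single vertex does no harm. -/
theorem card_rest_insert_le_two (hX : X ⊆ G.B) (hb : b ∈ G.B) (hT : G.Tok X a) (hy : y ∈ X)
    (hyb : y ≠ b) (hyU : G.N y ⊆ G.comp X a)
    (h1 : ∀ x ∈ G.N b, ∀ z ∈ G.N b, x ∈ G.comp X a → z ∈ G.comp X a → x = z) :
    (G.rest (insert b X) y).card ≤ 2 := by
  classical
  obtain ⟨q, hq, hS, -⟩ := hT.erase hX hy hyU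
  have hsub : ∀ w ∈ G.N y, G.comp (X.erase y) w ⊆ G.comp X a := by
    intro w hw
    rw [← comp_eq_of_mem (hyU hw)]
    exact comp_mono (erase_subset _ _)
  -- Only two branches at y can fail to be tails: the one with the deficit, and the one in which b
  -- is attached. The second is unique since b meets the tree in at most one vertex.
  have key : G.rest (insert b X) y ⊆
      insert q ((G.N y).filter fun w => w ≠ q ∧ ¬ Disjoint (G.N b) (G.comp (X.erase y) w)) := by
    intro w hw
    rw [mem_rest] at hw
    rw [mem_insert, mem_filter]
    by_cases hwq : w = q
    · exact Or.inl hwq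
    refine Or.inr ⟨hw.1, hwq, fun hd => hw.2 ?_⟩
    rw [erase_insert_of_ne hyb.symm]
    exact (hS w hw.1 hwq).insert hb hd
  refine (card_le_card key).trans ((card_insert_le _ _).trans ?_)
  have : ((G.N y).filter fun w => w ≠ q ∧ ¬ Disjoint (G.N b) (G.comp (X.erase y) w)).card ≤ 1 := by
    rw [card_le_one]
    intro w hw w' hw'
    simp only [mem_filter, not_disjoint_iff] at hw hw'
    obtain ⟨hw, hwq, x, hx, hxw⟩ := hw
    obtain ⟨hw', hwq', x', hx', hxw'⟩ := hw'
    obtain rfl := h1 x hx x' hx' (hsub _ hw hxw) (hsub _ hw' hxw')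
    refine (hS w' hw' hwq').eq hw ?_
    rw [← comp_eq_of_mem hxw', comp_eq_of_mem hxw]
    exact mem_comp_self
  omega

/-- If a hyperedge that can be added to an optimal collection is attached to small trees at single
vertices and has at most two further neighbours, it cannot be added. -/
theorem Optimal.not_good_insert (hX : G.Optimal X) (hb : b ∈ G.B) (hbX : b ∉ X)
    (hcard : (G.N b).card ≤ 2 + (G.toks X b).card)
    (h2 : (∃ a₁ ∈ G.N b, ∃ a₂ ∈ G.N b, a₁ ≠ a₂ ∧ ¬ G.Tok X a₁ ∧ ¬ G.Tok X a₂) ∨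
      (G.N b).card ≤ 1 + (G.toks X b).card) :
    ¬ G.Good (insert b X) := by
  intro hg
  have hp := (hX.2 _ hg).1
  rw [potential_insert hbX] at hp
  have ht := card_sdiff_add_card_eq_card (toks_subset (X := X) hb)
  -- Adding b destroys the trees it meets and creates at most one new tree. By `hcard` the potential
  -- rises unless a new tree appears. In that case, either the slack in `h2` still gives a rise, or
  -- two neighbours outside the trees contradict `Tok.erase`, which allows only one branch that is
  -- not balanced.
  by_cases hmeet : ∃ x ∈ G.N b, G.Tok (insert b X) x
  · obtain ⟨x, hx, hxT⟩ := hmeet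
    have hsub : G.tokens (insert b X) ⊆
        insert (G.comp (insert b X) x) (G.tokens X \ G.toks X b) := by
      intro U hU
      by_cases hd : Disjoint (G.N b) U
      · exact mem_insert_of_mem (mem_tokens_of_insert hb hU hd)
      · obtain ⟨⟨a, ha, rfl⟩, hT⟩ := mem_tokens.1 hU
        obtain ⟨w, hw, hwU⟩ := not_disjoint_iff.1 hd
        have := comp_eq_of_mem (subset_comp_of_mem (mem_insert_self b X) hw hwU hx)
        rw [this]
        exact mem_insert_self _ _
    have hc := (card_le_card hsub).trans (card_insert_le _ _)
    rcases h2 with ⟨a₁, h₁, a₂, h₂, hne, hn₁, hn₂⟩ | h2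
    · have hbX' : insert b X ⊆ G.B := insert_subset hb hX.1.1
      obtain ⟨q, hq, hS, -⟩ := hxT.erase hbX' (mem_insert_self b X)
        (subset_comp_of_mem (mem_insert_self b X) hx mem_comp_self)
      rw [erase_insert hbX] at hS
      by_cases e : a₁ = q
      · exact hn₂ (hS a₂ h₂ (fun e' => hne (e.trans e'.symm))).1
      · exact hn₁ (hS a₁ h₁ e).1
    · omega
  · have hsub : G.tokens (insert b X) ⊆ G.tokens X \ G.toks X b := by
      intro U hU
      refine mem_tokens_of_insert hb hU ?_
      obtain ⟨⟨a, ha, rfl⟩, hT⟩ := mem_tokens.1 hU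
      rw [disjoint_left]
      intro w hw hwU
      exact hmeet ⟨w, hw, (Tok.congr_mem hwU).2 hT⟩
    have hc := card_le_card hsub
    omega

variable (G) in
/-- The hyperedge `b ∉ X` meets small trees of `X` at single vertices, and has two further
neighbours: `a₁`, in a tree that `y` cuts off at `q`, and `a₂`, in no such tree. With `b` added,
`y` no longer has the property required of a good collection, and `y` is extremal with this. -/
structure Blocked (X : Finset γ) (b y : γ) (q a₁ a₂ : β) : Prop where
  good : G.Good X
  mem : b ∈ G.B
  notMem : b ∉ X
  stok : ∀ c ∈ G.N b, G.Tok X c → G.STok X b c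
  mem₁ : a₁ ∈ G.N b
  mem₂ : a₂ ∈ G.N b
  ne : a₁ ≠ a₂
  not₁ : ¬ G.Tok X a₁
  not₂ : ¬ G.Tok X a₂
  cover : ∀ c ∈ G.N b, c = a₁ ∨ c = a₂ ∨ G.Tok X c
  free : ∀ z ∈ X, ∀ c, G.STok (X.erase z) z c → a₂ ∉ G.comp (X.erase z) c
  ymem : y ∈ X
  tail : G.STok (X.erase y) y q
  inTail : a₁ ∈ G.comp (X.erase y) q
  lost : ¬ G.STok (insert b (X.erase y)) y q
  bad : 3 ≤ (G.rest (insert b X) y).card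
  max : ∀ z ∈ X, 3 ≤ (G.rest (insert b X) z).card →
    (G.comp (X.erase z) a₁).card ≤ (G.comp (X.erase y) a₁).card

namespace Blocked

variable {q a₁ a₂ : β}

theorem yB (h : G.Blocked X b y q a₁ a₂) : y ∈ G.B := h.good.1 h.ymem

theorem ne_y (h : G.Blocked X b y q a₁ a₂) : b ≠ y := fun e => h.notMem (e ▸ h.ymem)

theorem eraseB (h : G.Blocked X b y q a₁ a₂) : X.erase y ⊆ G.B := (erase_subset _ _).trans h.good.1

theorem disjoint_tok (h : G.Blocked X b y q a₁ a₂) (hT : G.Tok X c) :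
    Disjoint (G.N y) (G.comp X c) := by
  rw [disjoint_left]
  intro w hw hwc
  have h1 := subset_comp_of_mem h.ymem hw hwc h.tail.mem
  refine h.not₁ ((Tok.congr_mem ?_).2 hT)
  rw [← comp_eq_of_mem h1]
  exact comp_mono (erase_subset _ _) h.inTail

/-- Without y, its tail at q becomes a component, so a₁ now lies in a small tree. That component
contains no other vertex of b: it avoids a₂ by `free`, and the remaining vertices lie in trees that
y does not meet. -/
theorem stok_erase (h : G.Blocked X b y q a₁ a₂) (hc : c ∈ G.N b) (hne : c ≠ a₂) :
    G.STok (X.erase y) b c := by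
  have hTok : ∀ c ∈ G.N b, G.Tok X c → G.STok (X.erase y) b c := fun c hc hT =>
    (h.stok c hc hT).erase h.yB (h.disjoint_tok hT)
  rcases h.cover c hc with rfl | rfl | hT
  · refine ⟨(Tok.congr_mem h.inTail).2 h.tail.1, ?_⟩
    ext w
    simp only [mem_inter, mem_singleton]
    refine ⟨fun ⟨hw, hwc⟩ => ?_, by rintro rfl; exact ⟨hc, mem_comp_self⟩⟩
    rcases h.cover w hw with rfl | rfl | hT
    · rfl
    · rw [comp_eq_of_mem h.inTail] at hwc
      exact absurd hwc (h.free y h.ymem q h.tail)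
    · exact ((hTok w hw hT).eq hc (mem_comp_comm.1 hwc)).symm
  · exact absurd rfl hne
  · exact hTok c hc hT

/-- Otherwise all vertices of b would lie in tight sets of `X.erase y`. -/
theorem not_tok_erase (h : G.Blocked X b y q a₁ a₂) : ¬ G.Tok (X.erase y) a₂ := by
  intro hT
  refine not_all_tight h.eraseB h.mem (fun hb => h.notMem (mem_of_mem_erase hb)) fun c hc => ?_
  have hTc : G.Tok (X.erase y) c := by
    by_cases e : c = a₂
    · exact e ▸ hT
    · exact (h.stok_erase hc e).1
  obtain ⟨T, h1, h2, h3, h4⟩ := hTc.exists_tight h.mem h.eraseB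
  exact ⟨T, h1, h2, h3, h4 mem_comp_self⟩

/-- Among the tails of y, only the one at q can meet b: a₁ lies there, a₂ lies in no tail, and the
small trees of X are not met by y. -/
theorem rest_subset (h : G.Blocked X b y q a₁ a₂) :
    G.rest (insert b X) y ⊆ insert q (G.rest X y) := by
  intro w hw
  rw [mem_rest, erase_insert_of_ne h.ne_y] at hw
  rw [mem_insert, mem_rest]
  by_cases hwq : w = q
  · exact Or.inl hwq
  refine Or.inr ⟨hw.1, fun hS => hw.2 (hS.insert h.mem ?_)⟩
  rw [disjoint_left]
  intro c hc hcw
  rcases h.cover c hc with rfl | rfl | hT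
  · refine hwq (h.tail.eq hw.1 ?_)
    rw [← comp_eq_of_mem h.inTail]
    exact mem_comp_comm.1 hcw
  · exact h.free y h.ymem w hS hcw
  · exact disjoint_left.1 (h.disjoint_tok hT) hw.1
      (comp_mono (erase_subset _ _) (mem_comp_comm.1 hcw))

theorem card_rest (h : G.Blocked X b y q a₁ a₂) : (G.rest X y).card = 2 := by
  have h1 := (card_le_card h.rest_subset).trans (card_insert_le _ _)
  have h2 := h.bad
  have h3 := h.good.2 y h.ymem
  omega

/-- A tree cut off by some other `z` that does not contain `a₁` stays in place. -/
theorem stok_of_notMem (h : G.Blocked X b y q a₁ a₂) {z : γ} (hz : z ∈ X) (hzy : z ≠ y)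
    (hzT : ∀ x ∈ G.N z, ¬ G.Tok (X.erase y) x) (hS : G.STok (X.erase z) z a)
    (ha : a₁ ∉ G.comp (X.erase z) a) : G.STok ((insert b (X.erase y)).erase z) z a := by
  have hbz : b ≠ z := fun e => h.notMem (e ▸ hz)
  have hyK : Disjoint (G.N z) (G.comp (X.erase y) q) := by
    rw [disjoint_left]
    intro x hx hxq
    exact hzT x hx ((Tok.congr_mem hxq).2 h.tail.1)
  have hd1 : Disjoint (G.N y) (G.comp (X.erase z) a) := by
    rw [disjoint_left]
    intro x hx hxa
    have hq := subset_comp_of_mem (mem_erase.2 ⟨hzy.symm, h.ymem⟩) hx hxa h.tail.mem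
    apply ha
    rw [← comp_eq_of_mem hq]
    have : G.comp ((X.erase y).erase z) q ⊆ G.comp (X.erase z) q :=
      comp_mono (erase_subset_erase _ (erase_subset _ _))
    apply this
    rw [comp_erase hyK]
    exact h.inTail
  have hd2 : Disjoint (G.N b) (G.comp (X.erase z) a) := by
    rw [disjoint_left]
    intro x hx hxa
    rcases h.cover x hx with rfl | rfl | hT
    · exact ha hxa
    · exact h.free z hz a hS hxa
    · have haX : a ∈ G.comp X x := comp_mono (erase_subset _ _) (mem_comp_comm.1 hxa)
      have e := comp_erase (h.disjoint_tok hT)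
      have hT' := TokSet.erase h.yB (h.disjoint_tok hT) hT
      rw [← e] at hT' haX
      exact hzT a hS.mem ((Tok.congr_mem haX).2 hT')
  rw [erase_insert_of_ne hbz, erase_right_comm]
  have h1 := hS.erase h.yB hd1
  refine h1.insert h.mem ?_
  rw [comp_erase hd1]
  exact hd2

/-- The tail of z through a₁ contains the tail of y and y itself, so it is strictly larger, and
maximality of y implies that adding b does not spoil z. Hence this tail is a balanced tree both with
and without b. Deleting y from both trees leaves the same unbalanced branch, which is not the one at
q, so the branch at q stays balanced after adding b. This contradicts `lost`. -/
theorem tail_false (h : G.Blocked X b y q a₁ a₂) {z : γ} (hz : z ∈ X) (hzy : z ≠ y)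
    (hzT : ∀ x ∈ G.N z, ¬ G.Tok (X.erase y) x) (hS : G.STok (X.erase z) z a)
    (ha : a₁ ∈ G.comp (X.erase z) a) (hrest : 2 ≤ (G.rest X z).card) : False := by
  have hbz : b ≠ z := fun e => h.notMem (e ▸ hz)
  have hzB := h.good.1 hz
  have hXz : X.erase z ⊆ G.B := (erase_subset _ _).trans h.good.1
  have hyz : y ∈ X.erase z := mem_erase.2 ⟨hzy.symm, h.ymem⟩
  set K := G.comp (X.erase y) q with hK
  have hzK : Disjoint (G.N z) K := by
    rw [disjoint_left]
    intro x hx hxq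
    exact hzT x hx ((Tok.congr_mem hxq).2 h.tail.1)
  have haK : a ∉ K := disjoint_left.1 hzK hS.mem
  -- the tree at `q` stays the same without `z`
  have hKz : G.comp ((X.erase z).erase y) q = K := by
    rw [erase_right_comm, comp_erase hzK]
  have hKz1 : ∀ x ∈ K, G.comp ((X.erase z).erase y) x = K := by
    intro x hx
    rw [← hKz] at hx ⊢
    exact comp_eq_of_mem hx
  have hKsub : K ⊆ G.comp (X.erase z) a := by
    rw [← comp_eq_of_mem ha, ← hKz1 a₁ h.inTail]
    exact comp_mono (erase_subset _ _)
  have hqK : q ∈ K := mem_comp_self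
  have hyU : G.N y ⊆ G.comp (X.erase z) a := subset_comp_of_mem hyz h.tail.mem (hKsub hqK)
  -- `z` is not bad
  have hcard3 : 3 ≤ (G.N y).card := h.bad.trans (card_le_card rest_subset_N)
  have hlt : K.card < (G.comp (X.erase z) a).card := by
    apply card_lt_card
    refine (ssubset_iff_of_subset hKsub).2 ?_
    obtain ⟨w, hw, hwq⟩ := exists_mem_ne (by omega : 1 < (G.N y).card) q
    exact ⟨w, hyU hw, fun hwK => hwq (h.tail.eq hw hwK)⟩
  have hnb : (G.rest (insert b X) z).card ≤ 2 := by
    by_contra hn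
    have := h.max z hz (by omega)
    rw [comp_eq_of_mem ha, comp_eq_of_mem h.inTail, ← hK] at this
    omega
  have hbK : ∀ x ∈ G.N b, x ∈ G.comp (X.erase z) a → x = a₁ := by
    intro x hx hxa
    rcases h.cover x hx with e | rfl | hT
    · exact e
    · exact absurd hxa (h.free z hz a hS)
    · have haX : a ∈ G.comp X x := comp_mono (erase_subset _ _) (mem_comp_comm.1 hxa)
      have e := comp_erase (h.disjoint_tok hT)
      have hT' := TokSet.erase h.yB (h.disjoint_tok hT) hT
      rw [← e] at hT' haX
      exact absurd ((Tok.congr_mem haX).2 hT') (hzT a hS.mem)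
  have hsub : G.rest X z ⊆ G.rest (insert b X) z := by
    intro w hw
    rw [mem_rest] at hw ⊢
    refine ⟨hw.1, fun hS' => ?_⟩
    rw [erase_insert_of_ne hbz] at hS'
    by_cases hd : Disjoint (G.N b) (G.comp (insert b (X.erase z)) w)
    · exact hw.2 (hS'.of_insert h.mem hd)
    · obtain ⟨x, hx, hxw⟩ := not_disjoint_iff.1 hd
      have h1 := subset_comp_of_mem (mem_insert_self b _) hx hxw h.mem₁
      have h2 : a ∈ G.comp (insert b (X.erase z)) w := by
        rw [← comp_eq_of_mem h1]
        exact comp_mono (subset_insert _ _) (mem_comp_comm.1 ha)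
      exact hw.2 (hS'.eq hS.mem h2 ▸ hS)
  -- By `hsub` no old member of `rest` leaves it, and there are already two of them; losing the tail
  -- at `a` would make z bad.
  have hS2 : G.STok (insert b (X.erase z)) z a := by
    by_contra hn
    have : insert a (G.rest X z) ⊆ G.rest (insert b X) z := by
      refine insert_subset (mem_rest.2 ⟨hS.mem, ?_⟩) hsub
      rwa [erase_insert_of_ne hbz]
    have h1 := card_le_card this
    rw [card_insert_of_notMem (fun hm => (mem_rest.1 hm).2 hS)] at h1
    omega
  have hXbz : insert b (X.erase z) ⊆ G.B := insert_subset h.mem hXz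
  obtain ⟨q₁, hq₁, hS₁, hlt₁⟩ := hS.1.erase hXz hyz hyU
  have hKT : G.TokSet ((X.erase z).erase y) K := by
    rw [erase_right_comm]
    exact TokSet.erase hzB hzK h.tail.1
  have hqq₁ : q ≠ q₁ := by
    rintro rfl
    rw [hKz, hKT.1] at hlt₁
    exact lt_irrefl _ hlt₁
  have hTsub : G.comp (X.erase z) a ⊆ G.comp (insert b (X.erase z)) a :=
    comp_mono (subset_insert _ _)
  obtain ⟨q₂, hq₂, hS₂, -⟩ := hS2.1.erase hXbz (mem_insert_of_mem hyz) (hyU.trans hTsub)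
  rw [erase_insert_of_ne h.ne_y] at hS₂
  -- members of `comp (X - z) a` outside `K` are not attached to `b`
  have hfree : ∀ w ∈ G.comp (X.erase z) a, w ∉ K →
      Disjoint (G.N b) (G.comp ((X.erase z).erase y) w) := by
    intro w hw hwK
    rw [disjoint_left]
    intro x hx hxw
    have h1 : x ∈ G.comp (X.erase z) a := by
      rw [← comp_eq_of_mem hw]
      exact comp_mono (erase_subset _ _) hxw
    obtain rfl := hbK x hx h1
    apply hwK
    rw [← hKz1 x h.inTail]
    exact mem_comp_comm.1 hxw
  -- If q₁ were not the unbalanced branch after adding b, it would be balanced there. But b does not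
  -- meet it, so it would have been balanced before.
  have hq₁₂ : q₁ = q₂ := by
    by_contra hne
    have hq₁K : q₁ ∉ K := fun hm => hqq₁ (h.tail.eq hq₁ hm).symm
    have hd := hfree q₁ (hyU hq₁) hq₁K
    have h1 := (hS₂ q₁ hq₁ hne).1
    rw [Tok, comp_insert hd] at h1
    have h2 := (TokSet.of_insert h.mem hd h1).1
    omega
  have hSq := hS₂ q h.tail.mem (hq₁₂ ▸ hqq₁)
  have haD : a ∉ G.comp (insert b ((X.erase z).erase y)) q := by
    intro haD
    have hd := hfree a mem_comp_self haK
    have e : q ∈ G.comp ((X.erase z).erase y) a := by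
      rw [← comp_insert hd]
      exact mem_comp_comm.1 haD
    exact haK (hKz ▸ mem_comp_comm.1 e)
  have hzD : Disjoint (G.N z) (G.comp (insert b ((X.erase z).erase y)) q) := by
    rw [disjoint_left]
    intro w hw hwD
    have h1 : w ∈ G.comp (insert b (X.erase z)) a := by
      have h2 : q ∈ G.comp (insert b (X.erase z)) a := hTsub (hKsub hqK)
      rw [← comp_eq_of_mem h2]
      exact comp_mono (insert_subset_insert _ (erase_subset _ _)) hwD
    exact haD (hS2.eq hw h1 ▸ hwD)
  apply h.lost
  have e : insert b ((X.erase z).erase y) = (insert b (X.erase y)).erase z := by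
    rw [erase_insert_of_ne hbz, erase_right_comm]
  rw [e] at hzD hSq
  exact hSq.of_erase hzB hzD

/-- The new member b has only a₂ left outside its tails. Another z may lose its tail through a₁, but
then it had room for one more end by `tail_false`; its other tails survive. Members lying in small
trees of `X.erase y` are covered by `card_rest_insert_le_two`. -/
theorem good_swap (h : G.Blocked X b y q a₁ a₂) : G.Good (insert b (X.erase y)) := by
  classical
  refine ⟨insert_subset h.mem h.eraseB, fun z hz => ?_⟩
  rcases mem_insert.1 hz with rfl | hz
  · have : G.rest (insert z (X.erase y)) z ⊆ {a₂} := by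
      intro c hc
      rw [mem_rest, erase_insert (fun hm => h.notMem (mem_of_mem_erase hm))] at hc
      by_contra hne
      exact hc.2 (h.stok_erase hc.1 (by simpa using hne))
    exact (card_le_card this).trans (by simp)
  · obtain ⟨hzy, hzX⟩ := mem_erase.1 hz
    have hbz : b ≠ z := fun e => h.notMem (e ▸ hzX)
    by_cases hT : ∃ x ∈ G.N z, G.Tok (X.erase y) x
    · obtain ⟨x, hx, hT⟩ := hT
      refine card_rest_insert_le_two h.eraseB h.mem hT hz hbz.symm
        (subset_comp_of_mem hz hx mem_comp_self) fun c hc d hd hcx hdx => ?_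
      have hne : c ≠ a₂ := by
        rintro rfl
        exact h.not_tok_erase ((Tok.congr_mem hcx).2 hT)
      refine ((h.stok_erase hc hne).eq hd ?_).symm
      rw [comp_eq_of_mem hcx]
      exact hdx
    · push Not at hT
      by_cases ha : ∃ a, G.STok (X.erase z) z a ∧ a₁ ∈ G.comp (X.erase z) a
      · obtain ⟨a, hS, ha⟩ := ha
        have hr : (G.rest X z).card ≤ 1 := by
          by_contra hn
          exact h.tail_false hzX hzy hT hS ha (by omega)
        have : G.rest (insert b (X.erase y)) z ⊆ insert a (G.rest X z) := by
          intro w hw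
          rw [mem_rest] at hw
          rw [mem_insert, mem_rest]
          by_cases hwa : w = a
          · exact Or.inl hwa
          refine Or.inr ⟨hw.1, fun hSw => hw.2 (h.stok_of_notMem hzX hzy hT hSw fun hm => ?_)⟩
          refine hwa (hS.eq hw.1 ?_)
          rw [← comp_eq_of_mem ha]
          exact mem_comp_comm.1 hm
        exact (card_le_card this).trans ((card_insert_le _ _).trans (by omega))
      · push Not at ha
        have : G.rest (insert b (X.erase y)) z ⊆ G.rest X z := by
          intro w hw
          rw [mem_rest] at hw ⊢
          exact ⟨hw.1, fun hSw => hw.2 (h.stok_of_notMem hzX hzy hT hSw (ha w hSw))⟩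
        exact (card_le_card this).trans (h.good.2 z hzX)

theorem not_all_tok (h : G.Blocked X b y q a₁ a₂) : ¬ ∀ c ∈ G.N y, G.Tok (X.erase y) c := by
  intro hall
  refine not_all_tight h.eraseB h.yB (notMem_erase y X) fun c hc => ?_
  obtain ⟨T, h1, h2, h3, h4⟩ := (hall c hc).exists_tight h.mem h.eraseB
  exact ⟨T, h1, h2, h3, h4 mem_comp_self⟩

/-- A new tree not met by b is either an old tree or was separated by deleting y. In the latter case
y meets it in one tail vertex, since otherwise the two vertices of y outside its tails would both
lie in it, putting every vertex of y in small trees of `X.erase y`. -/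
theorem tokens_swap (h : G.Blocked X b y q a₁ a₂) {U : Finset β}
    (hU : U ∈ G.tokens (insert b (X.erase y))) :
    U = G.comp (insert b (X.erase y)) a₁ ∨ U ∈ G.tokens X \ G.toks X b ∨
      ∃ c ∈ (G.N y \ G.rest X y).erase q, G.comp (X.erase y) c = U := by
  by_cases hd : Disjoint (G.N b) U
  · right
    have hU' := mem_sdiff.1 (mem_tokens_of_insert h.mem hU hd)
    obtain ⟨⟨a, ha, rfl⟩, hT⟩ := mem_tokens.1 hU'.1
    by_cases hdy : Disjoint (G.N y) (G.comp (X.erase y) a)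
    · left
      refine mem_sdiff.2 ⟨mem_tokens.2 ⟨⟨a, ha, comp_erase' hdy⟩, TokSet.of_erase h.yB hdy hT⟩, ?_⟩
      intro hm
      obtain ⟨c, hc, -, e⟩ := mem_toks.1 hm
      exact disjoint_left.1 hd hc (e ▸ mem_comp_self)
    · right
      obtain ⟨w, hw, hwa⟩ := not_disjoint_iff.1 hdy
      have hTw : G.Tok (X.erase y) w := (Tok.congr_mem hwa).2 hT
      refine ⟨w, mem_erase.2 ⟨?_, mem_sdiff.2 ⟨hw, fun hwr => ?_⟩⟩, comp_eq_of_mem hwa⟩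
      · rintro rfl
        refine disjoint_left.1 hd h.mem₁ ?_
        rw [← comp_eq_of_mem hwa]
        exact h.inTail
      · have hne : ∃ w' ∈ G.N y, w' ∈ G.comp (X.erase y) w ∧ w' ≠ w := by
          by_contra hn
          push Not at hn
          refine (mem_rest.1 hwr).2 ⟨hTw, ?_⟩
          ext v
          simp only [mem_inter, mem_singleton]
          exact ⟨fun hv => hn v hv.1 hv.2, by rintro rfl; exact ⟨hw, mem_comp_self⟩⟩
        obtain ⟨w', hw', hwc, hne⟩ := hne
        have hTw' : G.Tok (X.erase y) w' := (Tok.congr_mem hwc).2 hTw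
        have hw'r : w' ∈ G.rest X y := by
          refine mem_rest.2 ⟨hw', fun hS => hne ?_⟩
          exact (hS.eq hw (mem_comp_comm.1 hwc)).symm
        have hpair : ({w, w'} : Finset β) = G.rest X y := by
          apply eq_of_subset_of_card_le
          · intro v hv
            rcases mem_insert.1 hv with rfl | hv
            · exact hwr
            · exact mem_singleton.1 hv ▸ hw'r
          · rw [h.card_rest, card_pair hne.symm]
        refine h.not_all_tok fun c hc => ?_
        by_cases hcr : c ∈ G.rest X y
        · rw [← hpair] at hcr
          rcases mem_insert.1 hcr with rfl | hcr
          · exact hTw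
          · exact mem_singleton.1 hcr ▸ hTw'
        · rw [mem_rest] at hcr
          push Not at hcr
          exact (hcr hc).1
  · left
    obtain ⟨⟨a, ha, rfl⟩, hT⟩ := mem_tokens.1 hU
    obtain ⟨w, hw, hwU⟩ := not_disjoint_iff.1 hd
    exact (comp_eq_of_mem (subset_comp_of_mem (mem_insert_self b _) hw hwU h.mem₁)).symm

/-- Exchanging y for b raises the potential by at least one, unless the component of a₁ becomes a
small tree. Even then the potential does not drop, while the mass grows: a₁ is newly counted and
every vertex counted before remains in a small tree. -/
theorem not_optimal (h : G.Blocked X b y q a₁ a₂) (hcard : (G.N b).card ≤ 2 + (G.toks X b).card) :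
    ¬ G.Optimal X := by
  classical
  intro hopt
  obtain ⟨hpot, hmass⟩ := hopt.2 _ h.good_swap
  have hbX' : b ∉ X.erase y := fun hm => h.notMem (mem_of_mem_erase hm)
  have e : G.potential (insert b (X.erase y)) = G.potential X - (G.N b).card + (G.N y).card +
      (G.tokens X).card - (G.tokens (insert b (X.erase y))).card := by
    rw [potential_insert hbX', potential_erase h.ymem]
    ring
  -- The 3 counts q and the two vertices of y outside its tails.
  have hcy : ((G.N y \ G.rest X y).erase q).card + 3 = (G.N y).card := by
    have h1 : q ∈ G.N y \ G.rest X y :=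
      mem_sdiff.2 ⟨h.tail.mem, fun hm => (mem_rest.1 hm).2 h.tail⟩
    have h2 := card_sdiff_add_card_eq_card (rest_subset_N : G.rest X y ⊆ G.N y)
    have h3 := card_erase_add_one h1
    have h4 := h.card_rest
    omega
  have ht := card_sdiff_add_card_eq_card (toks_subset (X := X) h.mem)
  by_cases hT : G.Tok (insert b (X.erase y)) a₁
  · have hsub : G.tokens (insert b (X.erase y)) ⊆ insert (G.comp (insert b (X.erase y)) a₁)
        ((G.tokens X \ G.toks X b) ∪
          ((G.N y \ G.rest X y).erase q).image (G.comp (X.erase y))) := by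
      intro U hU
      rcases h.tokens_swap hU with h1 | h1 | ⟨c, hc, rfl⟩
      · exact h1 ▸ mem_insert_self _ _
      · exact mem_insert_of_mem (mem_union_left _ h1)
      · exact mem_insert_of_mem (mem_union_right _ (mem_image_of_mem _ hc))
    have hc := (card_le_card hsub).trans ((card_insert_le _ _).trans
      (Nat.add_le_add_right ((card_union_le _ _).trans (Nat.add_le_add_left card_image_le _)) 1))
    have hm := hmass (by omega)
    refine absurd hm (not_le.2 (card_lt_card ?_))
    refine (ssubset_iff_of_subset ?_).2 ⟨a₁, mem_filter.2 ⟨G.subset b h.mem h.mem₁, hT⟩,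
      fun hm => h.not₁ (mem_filter.1 hm).2⟩
    intro a ha
    obtain ⟨haA, haT⟩ := mem_filter.1 ha
    refine mem_filter.2 ⟨haA, ?_⟩
    have hdy := h.disjoint_tok haT
    by_cases hd : Disjoint (G.N b) (G.comp X a)
    · have h1 := comp_erase hdy
      rw [← h1] at hd
      rw [Tok, comp_insert hd]
      refine TokSet.insert h.mem hd ?_
      rw [h1]
      exact TokSet.erase h.yB hdy haT
    · obtain ⟨c, hc, hca⟩ := not_disjoint_iff.1 hd
      rw [← comp_erase hdy] at hca
      refine (Tok.congr_mem ?_).1 hT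
      have h2 := comp_mono (subset_insert b (X.erase y)) hca
      exact subset_comp_of_mem (mem_insert_self _ _) hc h2 h.mem₁
  · have hsub : G.tokens (insert b (X.erase y)) ⊆ (G.tokens X \ G.toks X b) ∪
          ((G.N y \ G.rest X y).erase q).image (G.comp (X.erase y)) := by
      intro U hU
      rcases h.tokens_swap hU with h1 | h1 | ⟨c, hc, rfl⟩
      · subst h1
        exact absurd (mem_tokens.1 hU).2 hT
      · exact mem_union_left _ h1
      · exact mem_union_right _ (mem_image_of_mem _ hc)
    have hc := (card_le_card hsub).trans
      ((card_union_le _ _).trans (Nat.add_le_add_left card_image_le _))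
    omega

end Blocked

/-- The hyperedges outside an optimal collection are large: those that are too small by one have
exactly one neighbour outside the small trees. -/
theorem Optimal.card_N (hX : G.Optimal X) (hb : b ∈ G.B) (hbX : b ∉ X) :
    3 + (G.toks X b).card ≤ (G.N b).card ∨
      ((G.N b).card = 2 + (G.toks X b).card ∧ ∃ α, ∀ c ∈ G.N b, c = α ∨ G.Tok X c) := by
  classical
  rw [or_iff_not_imp_left, not_le]
  intro hlt
  by_contra hΛ
  have hXB := hX.1.1
  set Tb := (G.N b).filter (G.Tok X) with hTb
  set Fb := (G.N b).filter (fun c => ¬ G.Tok X c) with hFb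
  have hsum : Tb.card + Fb.card = (G.N b).card := card_filter_add_card_filter_not _
  have htok : (G.toks X b).card ≤ Tb.card := card_image_le
  have hFne : Fb.Nonempty := by
    by_contra hne
    rw [not_nonempty_iff_eq_empty, filter_eq_empty_iff] at hne
    refine not_all_tight hXB hb hbX fun c hc => ?_
    obtain ⟨T, h1, h2, h3, h4⟩ := (not_not.1 (hne hc)).exists_tight hb hXB
    exact ⟨T, h1, h2, h3, h4 mem_comp_self⟩
  have hFpos := card_pos.2 hFne
  have hF1 : Fb.card = 1 → (G.N b).card ≤ 1 + (G.toks X b).card := by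
    intro h1
    by_contra hn
    refine hΛ ⟨by omega, ?_⟩
    obtain ⟨α, hα⟩ := card_eq_one.1 h1
    refine ⟨α, fun c hc => or_iff_not_imp_right.2 fun hT => ?_⟩
    have : c ∈ Fb := mem_filter.2 ⟨hc, hT⟩
    rw [hα] at this
    simpa using this
  -- No small tree is met twice by b. Two or more vertices outside the trees leave no slack for it,
  -- and with only one such vertex the excluded exceptional case supplies the missing unit.
  have hcardT : (G.toks X b).card = Tb.card := by
    by_cases h1 : Fb.card = 1
    · have := hF1 h1
      omega
    · omega
  have hinj : Set.InjOn (G.comp X) (Tb : Set β) := card_image_iff.1 hcardT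
  have hstok : ∀ c ∈ G.N b, G.Tok X c → G.STok X b c := by
    intro c hc hT
    refine ⟨hT, ?_⟩
    ext w
    simp only [mem_inter, mem_singleton]
    refine ⟨fun ⟨hw, hwc⟩ => ?_, by rintro rfl; exact ⟨hc, mem_comp_self⟩⟩
    exact hinj (mem_filter.2 ⟨hw, (Tok.congr_mem hwc).2 hT⟩) (mem_filter.2 ⟨hc, hT⟩)
      (comp_eq_of_mem hwc)
  have hng : ¬ G.Good (insert b X) := by
    refine hX.not_good_insert hb hbX (by omega) ?_
    by_cases h1 : Fb.card = 1
    · exact Or.inr (hF1 h1)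
    · left
      obtain ⟨a₁, h₁, a₂, h₂, hne⟩ := one_lt_card.1 (by omega : 1 < Fb.card)
      rw [hFb, mem_filter] at h₁ h₂
      exact ⟨a₁, h₁.1, a₂, h₂.1, hne, h₁.2, h₂.2⟩
  -- a neighbour in no tree cut off by a member of `X`
  have hfree : ∃ a₂ ∈ Fb, ∀ z ∈ X, ∀ c, G.STok (X.erase z) z c → a₂ ∉ G.comp (X.erase z) c := by
    by_contra hn
    push Not at hn
    refine not_all_tight hXB hb hbX fun c hc => ?_
    by_cases hT : G.Tok X c
    · obtain ⟨T, h1, h2, h3, h4⟩ := hT.exists_tight hb hXB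
      exact ⟨T, h1, h2, h3, h4 mem_comp_self⟩
    · obtain ⟨z, hz, d, hS, hd⟩ := hn c (mem_filter.2 ⟨hc, hT⟩)
      obtain ⟨T, h1, h2, h3, h4⟩ := hS.1.exists_tight hb ((erase_subset _ _).trans hXB)
      exact ⟨T, h1.trans (erase_subset _ _), h2, h3, h4 hd⟩
  -- A member z that turns bad has lost a tail that meets b. A vertex of b outside the small trees
  -- must lie in that tail: otherwise z would sit in a small tree, where attaching b is harmless.
  have hbad : ∀ z ∈ X, 3 ≤ (G.rest (insert b X) z).card → ∃ q, G.STok (X.erase z) z q ∧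
      ¬ G.STok (insert b (X.erase z)) z q ∧ ∃ a₁ ∈ Fb, a₁ ∈ G.comp (X.erase z) q := by
    intro z hz h3
    have hbz : b ≠ z := fun e => hbX (e ▸ hz)
    obtain ⟨q, hq, hqn⟩ := exists_mem_notMem_of_card_lt_card
      (lt_of_le_of_lt (hX.1.2 z hz) h3 : (G.rest X z).card < (G.rest (insert b X) z).card)
    rw [mem_rest, erase_insert_of_ne hbz] at hq
    rw [mem_rest] at hqn
    push Not at hqn
    have hS := hqn hq.1
    refine ⟨q, hS, hq.2, ?_⟩
    by_contra hn
    push Not at hn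
    refine hq.2 (hS.insert hb ?_)
    rw [disjoint_left]
    intro x hx hxq
    by_cases hT : G.Tok X x
    · have hqx : q ∈ G.comp X x := comp_mono (erase_subset _ _) (mem_comp_comm.1 hxq)
      have := card_rest_insert_le_two hXB hb hT hz hbz.symm (subset_comp_of_mem hz hq.1 hqx)
        (fun c hc d hd hcx hdx => ((hstok x hx hT).eq hc hcx).trans ((hstok x hx hT).eq hd hdx).symm)
      omega
    · exact hn x (mem_filter.2 ⟨hx, hT⟩) hxq
  obtain ⟨a₂, ha₂, hfree⟩ := hfree
  have hex : (X.filter fun z => 3 ≤ (G.rest (insert b X) z).card).Nonempty := by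
    by_contra hne
    rw [not_nonempty_iff_eq_empty, filter_eq_empty_iff] at hne
    refine hng ⟨insert_subset hb hXB, fun z hz => ?_⟩
    rcases mem_insert.1 hz with rfl | hz
    · have : G.rest (insert z X) z ⊆ Fb := by
        intro c hc
        rw [mem_rest, erase_insert hbX] at hc
        exact mem_filter.2 ⟨hc.1, fun hT => hc.2 (hstok c hc.1 hT)⟩
      have := card_le_card this
      omega
    · have := hne hz
      omega
  obtain ⟨z₀, hz₀⟩ := hex
  rw [mem_filter] at hz₀
  obtain ⟨q₀, hS₀, -, a₁, ha₁, hin₀⟩ := hbad z₀ hz₀.1 hz₀.2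
  have hne : a₁ ≠ a₂ := by
    rintro rfl
    exact hfree z₀ hz₀.1 q₀ hS₀ hin₀
  have hpair : Fb = {a₁, a₂} := by
    refine (eq_of_subset_of_card_le ?_ ?_).symm
    · intro v hv
      rcases mem_insert.1 hv with rfl | hv
      · exact ha₁
      · exact mem_singleton.1 hv ▸ ha₂
    · rw [card_pair hne]
      omega
  -- Among the bad members, the one with the largest tail around a₁ is exchanged; `tail_false` needs
  -- this choice.
  obtain ⟨y, hy, hmax⟩ := exists_max_image (X.filter fun z => 3 ≤ (G.rest (insert b X) z).card)
    (fun z => (G.comp (X.erase z) a₁).card) ⟨z₀, mem_filter.2 hz₀⟩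
  rw [mem_filter] at hy
  obtain ⟨q, hS, hl, a₃, ha₃, hin⟩ := hbad y hy.1 hy.2
  have ha₃₁ : a₃ = a₁ := by
    rw [hpair] at ha₃
    rcases mem_insert.1 ha₃ with e | e
    · exact e
    · rw [mem_singleton] at e
      exact absurd (e ▸ hin) (hfree y hy.1 q hS)
  subst ha₃₁
  have hblk : G.Blocked X b y q a₃ a₂ :=
    { good := hX.1, mem := hb, notMem := hbX, stok := hstok
      mem₁ := (mem_filter.1 ha₁).1, mem₂ := (mem_filter.1 ha₂).1, ne := hne
      not₁ := (mem_filter.1 ha₁).2, not₂ := (mem_filter.1 ha₂).2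
      cover := fun c hc => by
        by_cases hT : G.Tok X c
        · exact Or.inr (Or.inr hT)
        · have : c ∈ Fb := mem_filter.2 ⟨hc, hT⟩
          rw [hpair] at this
          simp only [mem_insert, mem_singleton] at this
          tauto
      free := hfree, ymem := hy.1, tail := hS, inTail := hin, lost := hl, bad := hy.2
      max := fun z hz h3 => hmax z (mem_filter.2 ⟨hz, h3⟩) }
  exact hblk.not_optimal (by omega) hX

end Exchange

end LocalSystem

end SetPacking

/-! ### Growing connected pieces around the exceptional hyperedges -/

namespace SetPacking

namespace LocalSystem

open Finset

section Growth

variable {β γ : Type*} [DecidableEq β] [DecidableEq γ] {G : LocalSystem β γ}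
  {X H : Finset γ} {U W : Finset β} {a x : β} {b : γ}

theorem Tok.tight (hX : X ⊆ G.B) (hp : G.s ≤ G.p) (h : G.Tok X a) :
    G.ins X (G.comp X a) ⊆ G.B ∧ (G.ins X (G.comp X a)).card ≤ G.p ∧
      ((G.ins X (G.comp X a)).biUnion G.N).card ≤ (G.ins X (G.comp X a)).card := by
  refine ⟨ins_subset.trans hX, by rw [h.1]; exact h.2.1.trans hp, ?_⟩
  rw [h.1]
  exact card_le_card biUnion_ins_subset

/-- A connected part of `X` with at most `|H| + |L| - 1` vertices cannot contain all neighbours of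
the members of `L` outside small balanced trees. -/
theorem not_attached (hX : X ⊆ G.B) {L : Finset γ} (hL : L ⊆ G.B) (hLX : Disjoint L X)
    (hHX : H ⊆ X) (hHW : H.biUnion G.N ⊆ W)
    (hatt : ∀ l ∈ L, ∀ c ∈ G.N l, c ∈ W ∨ G.Tok X c)
    (hcard : W.card < H.card + L.card) (hp : H.card + L.card * (1 + G.k * G.s) ≤ G.p) : False := by
  classical
  have hL0 : L.Nonempty := by
    by_contra hne
    rw [not_nonempty_iff_eq_empty] at hne
    subst hne
    have h1 := G.expand H (hHX.trans hX) (by simpa using hp)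
    have h2 := card_le_card hHW
    simp at hcard
    omega
  obtain ⟨l₀, hl₀⟩ := hL0
  have hsp := s_le_p (hL hl₀)
  set C := (L.biUnion G.N).filter (G.Tok X) with hC
  set M := C.biUnion (fun c => G.ins X (G.comp X c)) with hM
  have hLpos : 0 < L.card := card_pos.2 ⟨l₀, hl₀⟩
  -- The small trees meeting L are tight, so absorbing them keeps the surplus of vertices at most
  -- |L| - 1. Adding the |L| members of L, which cover nothing new, then violates expansion.
  have htight := tight_biUnion (G := G) (c := L.card - 1) C (fun c => G.ins X (G.comp X c)) H W
    (fun c hc => (mem_filter.1 hc).2.tight hX hsp) (by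
      rw [union_eq_right.2 hHW]
      omega)
  rw [← hM] at htight
  have hMX : M ⊆ X := biUnion_subset.2 fun c _ => ins_subset
  have hCc : C.card ≤ L.card * G.k :=
    (card_filter_le _ _).trans (card_biUnion_le_card_mul _ _ _ fun l hl => G.card_le l (hL hl))
  have hMc : M.card ≤ L.card * (G.k * G.s) := by
    refine (card_biUnion_le_card_mul _ _ G.s fun c hc => ?_).trans ?_
    · rw [(mem_filter.1 hc).2.1]
      exact (mem_filter.1 hc).2.2.1
    · rw [← mul_assoc]
      exact Nat.mul_le_mul_right _ hCc
  have hdis : Disjoint L (H ∪ M) := hLX.mono_right (union_subset hHX hMX)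
  have hVc := card_union_of_disjoint hdis
  have hHM := card_union_le H M
  have h1 := G.expand (L ∪ (H ∪ M)) (union_subset hL ((union_subset hHX hMX).trans hX)) (by
    rw [mul_add, mul_one] at hp
    omega)
  have h2 : (L ∪ (H ∪ M)).biUnion G.N ⊆ (H ∪ M).biUnion G.N ∪ W := by
    rw [union_biUnion]
    refine union_subset (biUnion_subset.2 fun l hl c hc => ?_) subset_union_left
    rcases hatt l hl c hc with h | h
    · exact mem_union_right _ h
    · refine mem_union_left _ (mem_biUnion.2 ?_)
      have hcC : c ∈ C := mem_filter.2 ⟨mem_biUnion.2 ⟨l, hl, hc⟩, h⟩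
      have hc' : c ∈ (G.ins X (G.comp X c)).biUnion G.N := by
        rw [biUnion_ins_of_card hX h.1 (h.2.1.trans hsp)]
        exact mem_comp_self
      obtain ⟨d, hd, hcd⟩ := mem_biUnion.1 hc'
      exact ⟨d, mem_union_right _ (mem_biUnion.2 ⟨c, hcC, hd⟩), hcd⟩
  have h3 := card_le_card h2
  omega

variable (G) in
/-- The vertex `a` lies in no small balanced tree cut off by a member of `X`. -/
def Free (X : Finset γ) (a : β) : Prop :=
  ∀ z ∈ X, ∀ c, G.STok (X.erase z) z c → a ∉ G.comp (X.erase z) c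

variable (G) in
/-- `H` is a connected part of `X` that contains the vertex `a` and has at most one vertex more
than it has hyperedges; its vertex set is `W`. -/
structure Grown (X : Finset γ) (a : β) (H : Finset γ) (W : Finset β) : Prop where
  subset : H ⊆ X
  biUnion_subset : H.biUnion G.N ⊆ W
  mem : a ∈ W
  conn : W ⊆ G.comp H a
  card_le : W.card ≤ H.card + 1

theorem comp_ins : G.comp (G.ins X (G.comp X a)) a = G.comp X a :=
  comp_congr (fun _ hb _ hx hxa => mem_ins.2 ⟨hb, subset_comp_of_mem hb hx hxa⟩)
    (fun _ hb _ _ _ => ins_subset hb)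

/-- H is connected and avoids b, so if W met a tail cut off by b, the whole piece with its vertex
`a` would lie inside that tail. -/
theorem Grown.disjoint_tail (h : G.Grown X a H W) (hf : G.Free X a) (hbX : b ∈ X) (hbH : b ∉ H)
    {c : β} (hc : G.STok (X.erase b) b c) : Disjoint W (G.comp (X.erase b) c) := by
  rw [disjoint_left]
  intro w hw hwc
  apply hf b hbX c hc
  rw [← comp_eq_of_mem hwc]
  have h1 : H ⊆ X.erase b := fun z hz => mem_erase.2 ⟨fun e => hbH (e ▸ hz), h.subset hz⟩
  exact comp_mono h1 (mem_comp_comm.1 (h.conn hw))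

/-- The piece absorbs b together with all tails of b. The tails are tight, and of the at most two
remaining vertices of b one is already in W. So b brings at most one uncovered vertex and one
hyperedge, and the surplus of vertices stays at most one. -/
theorem Grown.step (hX : G.Good X) (hf : G.Free X a) (h : G.Grown X a H W) (hbX : b ∈ X)
    (hbH : b ∉ H) (hx : x ∈ G.N b) (hxW : x ∈ W) :
    ∃ H' W', G.Grown X a H' W' ∧ H.card < H'.card ∧ H'.card ≤ H.card + (1 + G.k * G.s) ∧
      ∀ l ∈ H', l ∈ H ∨ l = b ∨ ∃ c, G.STok (X.erase b) b c ∧ G.N l ⊆ G.comp (X.erase b) c := by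
  classical
  have hbB := hX.1 hbX
  have hsp := s_le_p hbB
  have hXb : X.erase b ⊆ G.B := (erase_subset _ _).trans hX.1
  set S := G.N b \ G.rest X b with hS
  have hStok : ∀ c ∈ S, G.STok (X.erase b) b c := by
    intro c hc
    rw [hS, mem_sdiff, mem_rest] at hc
    by_contra hn
    exact hc.2 ⟨hc.1, hn⟩
  set M := S.biUnion (fun c => G.ins (X.erase b) (G.comp (X.erase b) c)) with hM
  have hMX : M ⊆ X.erase b := Finset.biUnion_subset.2 fun c _ => ins_subset
  have htight := tight_biUnion (G := G) (c := 1) S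
    (fun c => G.ins (X.erase b) (G.comp (X.erase b) c)) H W
    (fun c hc => (hStok c hc).1.tight hXb hsp) (by
      rw [union_eq_right.2 h.biUnion_subset]
      exact h.card_le)
  rw [← hM] at htight
  have hMc : M.card ≤ G.k * G.s := by
    refine (card_biUnion_le_card_mul _ _ G.s fun c hc => ?_).trans ?_
    · rw [(hStok c hc).1.1]
      exact (hStok c hc).1.2.1
    · exact Nat.mul_le_mul_right _ ((card_le_card sdiff_subset).trans (G.card_le b hbB))
  have hbHM : b ∉ H ∪ M := by
    rw [mem_union, not_or]
    exact ⟨hbH, fun hm => notMem_erase b X (hMX hm)⟩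
  have hSM : S ⊆ M.biUnion G.N := by
    intro c hc
    have hT := (hStok c hc).1
    have : c ∈ (G.ins (X.erase b) (G.comp (X.erase b) c)).biUnion G.N := by
      rw [biUnion_ins_of_card hXb hT.1 (hT.2.1.trans hsp)]
      exact mem_comp_self
    exact biUnion_subset_biUnion_of_subset_left _
      (subset_biUnion_of_mem (fun c => G.ins (X.erase b) (G.comp (X.erase b) c)) hc) this
  have hxr : x ∈ G.rest X b := by
    refine mem_rest.2 ⟨hx, fun hSx => ?_⟩
    exact disjoint_left.1 (h.disjoint_tail hf hbX hbH hSx) hxW mem_comp_self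
  have hNb : G.N b ⊆ ((H ∪ M).biUnion G.N ∪ W) ∪ (G.rest X b).erase x := by
    intro c hc
    by_cases hcr : c ∈ G.rest X b
    · by_cases hcx : c = x
      · exact mem_union_left _ (mem_union_right _ (hcx ▸ hxW))
      · exact mem_union_right _ (mem_erase.2 ⟨hcx, hcr⟩)
    · refine mem_union_left _ (mem_union_left _ ?_)
      rw [union_biUnion]
      exact mem_union_right _ (hSM (mem_sdiff.2 ⟨hc, hcr⟩))
  set W' := ((H ∪ M).biUnion G.N ∪ W) ∪ G.N b with hW'
  have hbH' : b ∈ insert b (H ∪ M) := mem_insert_self _ _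
  have hHH' : H ⊆ insert b (H ∪ M) := subset_union_left.trans (subset_insert _ _)
  have hWc : W ⊆ G.comp (insert b (H ∪ M)) a := h.conn.trans (comp_mono hHH')
  have hNc : G.N b ⊆ G.comp (insert b (H ∪ M)) a := subset_comp_of_mem hbH' hx (hWc hxW)
  refine ⟨insert b (H ∪ M), W', ⟨?_, ?_, ?_, ?_, ?_⟩, ?_, ?_, ?_⟩
  · exact insert_subset hbX (union_subset h.subset (hMX.trans (erase_subset _ _)))
  · rw [biUnion_insert]
    exact union_subset subset_union_right (subset_union_left.trans subset_union_left)
  · exact mem_union_left _ (mem_union_right _ h.mem)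
  · refine union_subset (union_subset ?_ hWc) hNc
    rw [union_biUnion]
    refine union_subset (h.biUnion_subset.trans hWc) ?_
    refine Finset.biUnion_subset.2 fun l hl => ?_
    obtain ⟨c, hc, hlc⟩ := mem_biUnion.1 hl
    refine (mem_ins.1 hlc).2.trans ?_
    rw [← comp_ins, ← comp_eq_of_mem (hNc (mem_sdiff.1 hc).1)]
    refine comp_mono ?_
    exact ((subset_biUnion_of_mem (fun c => G.ins (X.erase b) (G.comp (X.erase b) c)) hc).trans
      subset_union_right).trans (subset_insert _ _)
  · rw [card_insert_of_notMem hbHM]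
    have h1 : W' ⊆ ((H ∪ M).biUnion G.N ∪ W) ∪ (G.rest X b).erase x :=
      union_subset subset_union_left hNb
    have h2 := (card_le_card h1).trans (card_union_le _ _)
    have h3 := hX.2 b hbX
    rw [card_erase_of_mem hxr] at h2
    omega
  · rw [card_insert_of_notMem hbHM]
    have := card_le_card (subset_union_left : H ⊆ H ∪ M)
    omega
  · rw [card_insert_of_notMem hbHM]
    have := card_union_le H M
    omega
  · intro l hl
    rcases mem_insert.1 hl with h1 | h1
    · exact Or.inr (Or.inl h1)
    rcases mem_union.1 h1 with h1 | h1
    · exact Or.inl h1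
    · obtain ⟨c, hc, hlc⟩ := mem_biUnion.1 h1
      exact Or.inr (Or.inr ⟨c, hStok c hc, (mem_ins.1 hlc).2⟩)

/-- Disjoint connected parts of `X` around the attachment vertices `α l`, each of which is large or
a whole component. -/
theorem exists_disjoint_grown (hX : G.Good X) {L : Finset γ} (hL : L ⊆ G.B) (hLX : Disjoint L X)
    {α : γ → β} (hα : ∀ l ∈ L, ∀ c ∈ G.N l, c = α l ∨ G.Tok X c) (hfree : ∀ l ∈ L, G.Free X (α l))
    {w : ℕ} (hp : 2 * w + 2 + 4 * (1 + G.k * G.s) ≤ G.p) :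
    ∃ W : γ → Finset β, (∀ l ∈ L, ∀ l' ∈ L, l ≠ l' → Disjoint (W l) (W l')) ∧
      ∀ l ∈ L, α l ∈ W l ∧ W l ⊆ G.comp X (α l) ∧
        (w ≤ (W l).card ∨ (W l = G.comp X (α l) ∧ (G.ins X (W l)).card < (W l).card)) := by
  classical
  -- Two attachment vertices cannot share a piece: with |W| ≤ |H| + 1, the two outside hyperedges
  -- would contradict `not_attached`.
  have hpair : ∀ l ∈ L, ∀ l' ∈ L, l ≠ l' → ∀ H ⊆ X, ∀ W : Finset β, H.biUnion G.N ⊆ W →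
      α l ∈ W → α l' ∈ W → W.card ≤ H.card + 1 → H.card + 2 * (1 + G.k * G.s) ≤ G.p → False := by
    intro l hl l' hl' hne H hH W hW h1 h2 hc hp'
    refine not_attached (L := {l, l'}) hX.1 ?_ ?_ hH hW ?_ ?_ ?_
    · intro z hz
      rcases mem_insert.1 hz with rfl | hz
      · exact hL hl
      · exact mem_singleton.1 hz ▸ hL hl'
    · refine hLX.mono_left fun z hz => ?_
      rcases mem_insert.1 hz with rfl | hz
      · exact hl
      · exact mem_singleton.1 hz ▸ hl'
    · intro z hz c hc
      rcases mem_insert.1 hz with rfl | hz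
      · exact (hα z hl c hc).imp_left (fun e => by rw [e]; exact h1)
      · rw [mem_singleton] at hz
        subst hz
        exact (hα z hl' c hc).imp_left (fun e => by rw [e]; exact h2)
    · rw [card_pair hne]
      omega
    · rw [card_pair hne]
      omega
  -- A piece with fewer than w hyperedges can take one full growth step without passing this cap.
  -- The cap also bounds the total size, so that a disjoint family of maximal total size exists.
  let m := w + (1 + G.k * G.s)
  let Valid : (γ → Finset γ) → (γ → Finset β) → Prop := fun H W =>
    (∀ l ∈ L, G.Grown X (α l) (H l) (W l) ∧ (H l).card ≤ m) ∧
      ∀ l ∈ L, ∀ l' ∈ L, l ≠ l' → Disjoint (W l) (W l')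
  let P : ℕ → Prop := fun n => ∃ H W, Valid H W ∧ ∑ l ∈ L, (H l).card = n
  have hP0 : P 0 := by
    refine ⟨fun _ => ∅, fun l => {α l}, ⟨fun l hl => ⟨⟨by simp, by simp, by simp, ?_, by simp⟩,
      by simp⟩, fun l hl l' hl' hne => ?_⟩, by simp⟩
    · simpa using mem_comp_self
    · rw [disjoint_singleton]
      intro e
      exact hpair l hl l' hl' hne ∅ (by simp) {α l} (by simp) (by simp) (by simp [e]) (by simp)
        (by simp; omega)
  have hPb : ∀ n, P n → n ≤ L.card * m := by
    rintro n ⟨H, W, hV, rfl⟩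
    rw [← smul_eq_mul]
    exact sum_le_card_nsmul _ _ _ fun l hl => (hV.1 l hl).2
  have hspec := Nat.findGreatest_spec (P := P) (Nat.zero_le (L.card * m)) hP0
  obtain ⟨H, W, hV, hsum⟩ := hspec
  have hmax : ∀ n, P n → n ≤ ∑ l ∈ L, (H l).card := fun n hn =>
    hsum ▸ Nat.le_findGreatest (hPb n hn) hn
  refine ⟨W, hV.2, fun l hl => ?_⟩
  obtain ⟨hg, hm⟩ := hV.1 l hl
  refine ⟨hg.mem, hg.conn.trans (comp_mono hg.subset), ?_⟩
  by_cases hw : w ≤ (H l).card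
  · left
    have h1 := G.expand (H l) (hg.subset.trans hX.1) (by simp only [m] at hm; omega)
    exact hw.trans (h1.trans (card_le_card hg.biUnion_subset))
  right
  by_cases hex : ∃ b ∈ X, b ∉ H l ∧ ∃ x ∈ G.N b, x ∈ W l
  · exfalso
    obtain ⟨b, hbX, hbH, x, hx, hxW⟩ := hex
    obtain ⟨H', W', hg', hlt, hle, hmem⟩ := hg.step hX (hfree l hl) hbX hbH hx hxW
    -- If the enlarged piece stays disjoint from the others, the family was not maximal. If it meets
    -- another piece, the union has at most one vertex more than hyperedges and contains two
    -- attachment vertices, against `hpair`.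
    by_cases hdis : ∀ l' ∈ L, l' ≠ l → Disjoint W' (W l')
    · have hV' : Valid (Function.update H l H') (Function.update W l W') := by
        refine ⟨fun l' hl' => ?_, fun l₁ h₁ l₂ h₂ hne => ?_⟩
        · by_cases e : l' = l
          · subst e
            simp only [Function.update_self]
            exact ⟨hg', by simp only [m]; omega⟩
          · simp only [Function.update_of_ne e]
            exact hV.1 l' hl'
        · by_cases e₁ : l₁ = l
          · have e₂ : l₂ ≠ l := fun e => hne (e₁.trans e.symm)
            rw [e₁, Function.update_self, Function.update_of_ne e₂]
            exact hdis l₂ h₂ e₂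
          · by_cases e₂ : l₂ = l
            · rw [e₂, Function.update_self, Function.update_of_ne e₁]
              exact (hdis l₁ h₁ e₁).symm
            · rw [Function.update_of_ne e₁, Function.update_of_ne e₂]
              exact hV.2 l₁ h₁ l₂ h₂ hne
      have h1 := hmax _ ⟨_, _, hV', rfl⟩
      refine absurd h1 (not_le.2 (sum_lt_sum (fun l' _ => ?_) ⟨l, hl, ?_⟩))
      · by_cases e : l' = l
        · subst e
          rw [Function.update_self]
          exact hlt.le
        · rw [Function.update_of_ne e]
      · rw [Function.update_self]
        exact hlt
    · push Not at hdis
      obtain ⟨l', hl', hne, hnd⟩ := hdis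
      obtain ⟨z, hz, hz'⟩ := not_disjoint_iff.1 hnd
      have hg₂ := (hV.1 l' hl').1
      have hbH₂ : b ∉ H l' := by
        intro hb
        exact disjoint_left.1 (hV.2 l hl l' hl' hne.symm) hxW
          (hg₂.biUnion_subset (mem_biUnion.2 ⟨b, hb, hx⟩))
      have hHd : Disjoint H' (H l') := by
        rw [disjoint_left]
        intro t ht ht'
        obtain ⟨v, hv⟩ := G.nonempty (hX.1 (hg'.subset ht))
        have hvW : v ∈ W l' := hg₂.biUnion_subset (mem_biUnion.2 ⟨t, ht', hv⟩)
        rcases hmem t ht with h1 | rfl | ⟨c, hc, h1⟩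
        · exact disjoint_left.1 (hV.2 l hl l' hl' hne.symm)
            (hg.biUnion_subset (mem_biUnion.2 ⟨t, h1, hv⟩)) hvW
        · exact hbH₂ ht'
        · exact disjoint_left.1 (hg₂.disjoint_tail (hfree l' hl') hbX hbH₂ hc) hvW (h1 hv)
      have hUc := card_union_of_disjoint hHd
      have hWc := card_union_add_card_inter W' (W l')
      have hWi : 0 < (W' ∩ W l').card := card_pos.2 ⟨z, mem_inter.2 ⟨hz, hz'⟩⟩
      have h1 := hg'.card_le
      have h2 := hg₂.card_le
      have h3 := (hV.1 l' hl').2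
      simp only [m] at h3
      refine hpair l hl l' hl' hne.symm (H' ∪ H l') (union_subset hg'.subset hg₂.subset)
        (W' ∪ W l') ?_ (mem_union_left _ hg'.mem) (mem_union_right _ hg₂.mem) (by omega) (by omega)
      rw [union_biUnion]
      exact union_subset_union hg'.biUnion_subset hg₂.biUnion_subset
  · push Not at hex
    have hcl : G.Closed X (W l) := by
      intro b hb x hx hxW
      have hbH : b ∈ H l := by
        by_contra hn
        exact hex b hb hn x hx hxW
      exact (subset_biUnion_of_mem G.N hbH).trans hg.biUnion_subset
    have hWe : W l = G.comp X (α l) :=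
      subset_antisymm (hg.conn.trans (comp_mono hg.subset)) (comp_subset hcl hg.mem)
    refine ⟨hWe, ?_⟩
    have hins : G.ins X (W l) ⊆ H l := by
      intro b hb
      rw [mem_ins] at hb
      by_contra hn
      obtain ⟨x, hx⟩ := G.nonempty (hX.1 hb.1)
      exact hex b hb.1 hn x hx (hb.2 hx)
    refine (card_le_card hins).trans_lt ?_
    by_contra hn
    refine not_attached (L := {l}) hX.1 (by simpa using hL hl)
      (hLX.mono_left (by simpa using hl)) hg.subset hg.biUnion_subset ?_ ?_ ?_
    · intro z hz c hc
      rw [mem_singleton] at hz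
      subst hz
      exact (hα z hl c hc).imp_left (fun e => by rw [e]; exact hg.mem)
    · simp; omega
    · simp; omega

end Growth

end LocalSystem

end SetPacking

/-! ### Counting incidences by components -/

namespace SetPacking

namespace LocalSystem

open Finset

section Counting

variable {β γ : Type*} [DecidableEq β] [DecidableEq γ] {G : LocalSystem β γ}
  {X : Finset γ} {U : Finset β} {a : β} {b : γ}

variable (G) in
/-- The components of the hypergraph with hyperedges from `X`. -/
noncomputable def comps (X : Finset γ) : Finset (Finset β) := G.A.image (G.comp X)

variable (G) in
/-- The components with more hyperedges than vertices. -/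
noncomputable def pos (X : Finset γ) : Finset (Finset β) :=
  (G.comps X).filter fun U => U.card < (G.ins X U).card

theorem mem_comps : U ∈ G.comps X ↔ ∃ a ∈ G.A, G.comp X a = U := by simp [comps]

theorem comps_disjoint {V : Finset β} (hU : U ∈ G.comps X) (hV : V ∈ G.comps X) (h : U ≠ V) :
    Disjoint U V := by
  obtain ⟨a, -, rfl⟩ := mem_comps.1 hU
  obtain ⟨b, -, rfl⟩ := mem_comps.1 hV
  exact comp_disjoint h

theorem subset_A_of_mem_comps (hX : X ⊆ G.B) (hU : U ∈ G.comps X) : U ⊆ G.A := by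
  obtain ⟨a, ha, rfl⟩ := mem_comps.1 hU
  exact comp_subset_A hX ha

theorem ins_disjoint {V : Finset β} (hX : X ⊆ G.B) (h : Disjoint U V) :
    Disjoint (G.ins X U) (G.ins X V) := by
  rw [disjoint_left]
  intro c hc hc'
  obtain ⟨x, hx⟩ := G.nonempty (hX (ins_subset hc))
  exact disjoint_left.1 h ((mem_ins.1 hc).2 hx) ((mem_ins.1 hc').2 hx)

theorem sum_card_biUnion_comps (hX : X ⊆ G.B) {𝒰 : Finset (Finset β)} (h𝒰 : 𝒰 ⊆ G.comps X)
    {M : Type*} [AddCommMonoid M] (f : γ → M) :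
    ∑ b ∈ 𝒰.biUnion (G.ins X), f b = ∑ U ∈ 𝒰, ∑ b ∈ G.ins X U, f b :=
  sum_biUnion fun _ hU _ hV hne => ins_disjoint hX (comps_disjoint (h𝒰 hU) (h𝒰 hV) hne)

theorem card_biUnion_comps {𝒰 : Finset (Finset β)} (h𝒰 : 𝒰 ⊆ G.comps X) :
    (𝒰.biUnion id).card = ∑ U ∈ 𝒰, U.card :=
  card_biUnion fun _ hU _ hV hne => comps_disjoint (h𝒰 hU) (h𝒰 hV) hne

theorem biUnion_comps (hX : X ⊆ G.B) : (G.comps X).biUnion id = G.A := by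
  apply subset_antisymm
  · exact biUnion_subset.2 fun U hU => subset_A_of_mem_comps hX hU
  · intro a ha
    exact mem_biUnion.2 ⟨_, mem_comps.2 ⟨a, ha, rfl⟩, mem_comp_self⟩

theorem biUnion_ins_comps (hX : X ⊆ G.B) : (G.comps X).biUnion (G.ins X) = X := by
  apply subset_antisymm
  · exact biUnion_subset.2 fun U _ => ins_subset
  · intro b hb
    obtain ⟨x, hx⟩ := G.nonempty (hX hb)
    exact mem_biUnion.2 ⟨_, mem_comps.2 ⟨x, G.subset b (hX hb) hx, rfl⟩,
      mem_ins.2 ⟨hb, subset_comp_of_mem hb hx mem_comp_self⟩⟩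

theorem card_mul_le_of_disjoint {ι : Type*} {A : Finset β} (L : Finset ι)
    (W : ι → Finset β) (hW : ∀ l ∈ L, W l ⊆ A)
    (hd : ∀ l ∈ L, ∀ l' ∈ L, l ≠ l' → Disjoint (W l) (W l')) {w : ℕ}
    (hw : ∀ l ∈ L, w ≤ (W l).card) : L.card * w ≤ A.card := by
  rw [← smul_eq_mul]
  calc L.card • w ≤ ∑ l ∈ L, (W l).card := card_nsmul_le_sum _ _ _ hw
    _ = (L.biUnion W).card := (card_biUnion hd).symm
    _ ≤ A.card := card_le_card (biUnion_subset.2 hW)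

variable (G) in
/-- The surplus of a component in the count of hyperedges against their sizes. -/
noncomputable def weight (X : Finset γ) (U : Finset β) : ℤ :=
  3 * (G.ins X U).card - ∑ b ∈ G.ins X U, ((G.N b).card : ℤ) - U.card

/-- Connectedness gives a total size of at least |U| + |ins| - 1, with equality for trees. In
particular a small balanced tree has weight exactly 1 and a component with a deficit has weight at
most -1. -/
theorem weight_le (hX : X ⊆ G.B) (hU : U ∈ G.comps X) :
    G.weight X U ≤ 2 * ((G.ins X U).card - U.card) + 1 := by
  obtain ⟨a, -, rfl⟩ := mem_comps.1 hU
  have := card_comp_add_card_ins_le (G := G) (a := a) hX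
  rw [weight]
  zify at this
  linarith

theorem sum_degree_le {A' : Finset β} (hA' : A' ⊆ G.A)
    (hdeg : ∀ a ∈ G.A, (G.B.filter fun b => a ∈ G.N b).card ≤ G.k) :
    ∑ b ∈ G.B, (G.N b ∩ A').card ≤ A'.card * G.k := by
  classical
  have h1 : ∑ b ∈ G.B, (G.N b ∩ A').card = ∑ a ∈ A', (G.B.filter fun b => a ∈ G.N b).card := by
    have := sum_card_bipartiteAbove_eq_sum_card_bipartiteBelow (s := A') (t := G.B)
      (fun a b => a ∈ G.N b)
    simp only [bipartiteAbove, bipartiteBelow] at this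
    rw [this]
    refine sum_congr rfl fun b _ => ?_
    rw [inter_comm, ← filter_mem_eq_inter]
  rw [h1, ← smul_eq_mul]
  exact sum_le_card_nsmul _ _ _ fun a ha => hdeg a (hA' ha)

open Classical in
/-- Counting hyperedges by the components of an optimal collection. -/
theorem Optimal.card_B_le (hX : G.Optimal X) (hk : 2 ≤ G.k)
    (hdeg : ∀ a ∈ G.A, (G.B.filter fun b => a ∈ G.N b).card ≤ G.k) :
    3 * (G.B.card : ℤ) ≤ (G.k + 1) * G.A.card +
      ∑ U ∈ (G.comps X).filter (fun U => ¬ G.TokSet X U), G.weight X U +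
      ((G.B \ X).filter fun b => (G.N b).card < 3 + (G.toks X b).card).card := by
  have hXB := hX.1.1
  set Λ := (G.B \ X).filter fun b => (G.N b).card < 3 + (G.toks X b).card with hΛ
  -- Small trees that meet no hyperedge outside X are set aside: nothing would pay for their weight
  -- 1. They have as many hyperedges as vertices, which is within the bound since k + 1 ≥ 3.
  set Iso := (G.tokens X).filter fun U => ∀ b ∈ G.B \ X, Disjoint (G.N b) U with hIso
  have htokc : G.tokens X ⊆ G.comps X := filter_subset _ _
  have hIsoc : Iso ⊆ G.comps X := (filter_subset _ _).trans htokc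
  set 𝒰 := G.comps X \ Iso with h𝒰
  have h𝒰c : 𝒰 ⊆ G.comps X := sdiff_subset
  set A' := 𝒰.biUnion id with hA'
  have hA'A : A' ⊆ G.A := biUnion_subset.2 fun U hU => subset_A_of_mem_comps hXB (h𝒰c hU)
  -- vertex and hyperedge counts
  have cA : (G.A.card : ℤ) = ∑ U ∈ 𝒰, (U.card : ℤ) + ∑ U ∈ Iso, (U.card : ℤ) := by
    rw [sum_sdiff hIsoc, ← biUnion_comps hXB, card_biUnion_comps Subset.rfl]
    push_cast
    rfl
  have cX : (X.card : ℤ) = ∑ U ∈ 𝒰, ((G.ins X U).card : ℤ) + ∑ U ∈ Iso, ((G.ins X U).card : ℤ) := by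
    rw [sum_sdiff hIsoc]
    conv_lhs => rw [← biUnion_ins_comps hXB]
    rw [card_eq_sum_ones, sum_card_biUnion_comps hXB Subset.rfl]
    push_cast
    simp
  have cB : (G.B.card : ℤ) = (G.B \ X).card + X.card := by
    rw [← card_sdiff_add_card_eq_card hXB]
    push_cast
    rfl
  -- edges
  have hdisI : ∀ b ∈ G.B \ X, G.N b ⊆ A' := by
    intro b hb c hc
    have hbB := (mem_sdiff.1 hb).1
    have hcC : G.comp X c ∈ G.comps X := mem_comps.2 ⟨c, G.subset b hbB hc, rfl⟩
    refine mem_biUnion.2 ⟨_, mem_sdiff.2 ⟨hcC, fun h => ?_⟩, mem_comp_self⟩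
    exact disjoint_left.1 ((mem_filter.1 h).2 b hb) hc mem_comp_self
  have hE : ∑ b ∈ G.B \ X, (G.N b).card + ∑ U ∈ 𝒰, ∑ b ∈ G.ins X U, (G.N b).card ≤
      A'.card * G.k := by
    refine le_trans ?_ (sum_degree_le hA'A hdeg)
    rw [← sum_sdiff hXB, ← sum_card_biUnion_comps hXB h𝒰c]
    refine add_le_add (sum_le_sum fun b hb => ?_) ?_
    · rw [inter_eq_left.2 (hdisI b hb)]
    · have hsub : 𝒰.biUnion (G.ins X) ⊆ X := biUnion_subset.2 fun U _ => ins_subset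
      refine le_trans (sum_le_sum fun b hb => ?_) (sum_le_sum_of_subset hsub)
      obtain ⟨U, hU, hb⟩ := mem_biUnion.1 hb
      rw [inter_eq_left.2]
      exact (mem_ins.1 hb).2.trans (subset_biUnion_of_mem id hU)
  rw [card_biUnion_comps h𝒰c] at hE
  zify at hE
  -- the hyperedges outside `X`
  have hout : ∑ b ∈ G.B \ X, (3 - ((G.N b).card : ℤ)) ≤
      Λ.card - ∑ b ∈ G.B \ X, ((G.toks X b).card : ℤ) := by
    rw [hΛ, card_filter, Nat.cast_sum, ← sum_sub_distrib]
    refine sum_le_sum fun b hb => ?_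
    rw [mem_sdiff] at hb
    rcases hX.card_N hb.1 hb.2 with h | ⟨h, -⟩
    · rw [if_neg (by omega)]
      push_cast
      omega
    · rw [if_pos (by omega)]
      push_cast
      omega
  -- Each remaining small tree is met from outside X, so the extra vertices guaranteed by
  -- `Optimal.card_N` pay for its weight.
  have htoks : ((G.tokens X \ Iso).card : ℤ) ≤ ∑ b ∈ G.B \ X, ((G.toks X b).card : ℤ) := by
    have hsub : G.tokens X \ Iso ⊆ (G.B \ X).biUnion (G.toks X) := by
      intro U hU
      obtain ⟨hUt, hUI⟩ := mem_sdiff.1 hU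
      have : ¬ ∀ b ∈ G.B \ X, Disjoint (G.N b) U := fun h => hUI (mem_filter.2 ⟨hUt, h⟩)
      push Not at this
      obtain ⟨b, hb, hnd⟩ := this
      obtain ⟨c, hc, hcU⟩ := not_disjoint_iff.1 hnd
      obtain ⟨⟨a, ha, rfl⟩, hT⟩ := mem_tokens.1 hUt
      exact mem_biUnion.2 ⟨b, hb, mem_toks.2 ⟨c, hc, (Tok.congr_mem hcU).2 hT, comp_eq_of_mem hcU⟩⟩
    exact_mod_cast (card_le_card hsub).trans card_biUnion_le
  -- the weights of the trees
  have hw : ∑ U ∈ 𝒰, G.weight X U =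
      ∑ U ∈ (G.comps X).filter (fun U => ¬ G.TokSet X U), G.weight X U + (G.tokens X \ Iso).card := by
    have e1 : 𝒰.filter (G.TokSet X) = G.tokens X \ Iso := by
      ext U
      simp only [h𝒰, tokens, comps, mem_filter, mem_sdiff]
      tauto
    have e2 : 𝒰.filter (fun U => ¬ G.TokSet X U) =
        (G.comps X).filter (fun U => ¬ G.TokSet X U) := by
      ext U
      simp only [h𝒰, hIso, tokens, mem_filter, mem_sdiff]
      tauto
    rw [← sum_filter_add_sum_filter_not 𝒰 (G.TokSet X), e1, e2, add_comm]
    congr 1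
    rw [card_eq_sum_ones, Nat.cast_sum]
    refine sum_congr rfl fun U hU => ?_
    obtain ⟨h1, -, h3⟩ := (mem_tokens.1 (mem_sdiff.1 hU).1).2
    rw [weight]
    zify at h1 h3
    push_cast
    linarith
  have hIsow : ∑ U ∈ Iso, (3 * ((G.ins X U).card : ℤ) - (G.k + 1) * U.card) ≤ 0 := by
    refine sum_nonpos fun U hU => ?_
    have h1 := (mem_tokens.1 (mem_filter.1 hU).1).2.1
    rw [h1]
    have : (2 : ℤ) ≤ G.k := by exact_mod_cast hk
    nlinarith [(Nat.cast_nonneg U.card : (0 : ℤ) ≤ U.card)]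
  rw [sum_sub_distrib, ← mul_sum, ← mul_sum] at hIsow
  have hwe : ∑ U ∈ 𝒰, G.weight X U = 3 * ∑ U ∈ 𝒰, ((G.ins X U).card : ℤ) -
      ∑ U ∈ 𝒰, ∑ b ∈ G.ins X U, ((G.N b).card : ℤ) - ∑ U ∈ 𝒰, (U.card : ℤ) := by
    simp only [weight, sum_sub_distrib, ← mul_sum]
  have hout' : ∑ b ∈ G.B \ X, (3 - ((G.N b).card : ℤ)) =
      3 * (G.B \ X).card - ∑ b ∈ G.B \ X, ((G.N b).card : ℤ) := by
    rw [sum_sub_distrib]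
    simp [mul_comm]
  rw [cB, cA, cX]
  linarith

open Classical in
/-- There is a good collection in which the components with more hyperedges than vertices have a
large total surplus. -/
theorem exists_good (hk : 2 ≤ G.k)
    (hdeg : ∀ a ∈ G.A, (G.B.filter fun b => a ∈ G.N b).card ≤ G.k)
    {w : ℕ} (hp : 2 * w + 2 + 4 * (1 + G.k * G.s) ≤ G.p) :
    ∃ X, G.Good X ∧ ∃ n₁ n₂ n₃ : ℕ, n₁ * w ≤ G.A.card ∧ n₂ * (G.s + 1) ≤ G.A.card ∧
      n₃ * G.p ≤ G.A.card ∧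
      3 * (G.B.card : ℤ) ≤ (G.k + 1) * G.A.card +
        2 * ∑ U ∈ G.pos X, (((G.ins X U).card : ℤ) - U.card) + n₁ + n₂ + n₃ := by
  obtain ⟨X, hX⟩ := G.exists_optimal
  have hXB := hX.1.1
  -- The function `α` chosen below needs an inhabited vertex type.
  rcases isEmpty_or_nonempty β with hβ | hβ
  · have hB : G.B = ∅ := eq_empty_of_forall_notMem fun b hb =>
      (G.nonempty hb).elim fun a _ => hβ.elim a
    refine ⟨X, hX.1, 0, 0, 0, by simp, by simp, by simp, ?_⟩
    have : 0 ≤ ∑ U ∈ G.pos X, (((G.ins X U).card : ℤ) - U.card) := sum_nonneg fun U hU => by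
      have := (mem_filter.1 hU).2
      omega
    rw [hB, card_empty]
    push_cast
    positivity
  have hmain := hX.card_B_le hk hdeg
  set Λ := (G.B \ X).filter fun b => (G.N b).card < 3 + (G.toks X b).card with hΛ
  have hΛB : Λ ⊆ G.B := (filter_subset _ _).trans sdiff_subset
  have hΛX : Disjoint Λ X := sdiff_disjoint.mono_left (filter_subset _ _)
  have hα : ∀ l ∈ Λ, ∃ α, ∀ c ∈ G.N l, c = α ∨ G.Tok X c := by
    intro l hl
    obtain ⟨hl, hlt⟩ := mem_filter.1 hl
    rw [mem_sdiff] at hl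
    rcases hX.card_N hl.1 hl.2 with h | ⟨-, h⟩
    · omega
    · exact h
  choose! α hα using hα
  have htight : ∀ l ∈ Λ, ∀ T ⊆ X, T.card ≤ G.s → (T.biUnion G.N).card ≤ T.card →
      α l ∉ T.biUnion G.N := by
    intro l hl T hTX hTs hTt hTα
    refine not_all_tight hXB (hΛB hl) (disjoint_left.1 hΛX hl) fun c hc => ?_
    rcases hα l hl c hc with rfl | hT
    · exact ⟨T, hTX, hTs, hTt, hTα⟩
    · obtain ⟨T, h1, h2, h3, h4⟩ := hT.exists_tight (hΛB hl) hXB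
      exact ⟨T, h1, h2, h3, h4 mem_comp_self⟩
  have hfree : ∀ l ∈ Λ, G.Free X (α l) := by
    intro l hl z hz c hS hc
    obtain ⟨T, h1, h2, h3, h4⟩ := hS.1.exists_tight (hΛB hl) ((erase_subset _ _).trans hXB)
    exact htight l hl T (h1.trans (erase_subset _ _)) h2 h3 (h4 hc)
  have hnTok : ∀ l ∈ Λ, ¬ G.Tok X (α l) := by
    intro l hl hT
    obtain ⟨T, h1, h2, h3, h4⟩ := hT.exists_tight (hΛB hl) hXB
    exact htight l hl T h1 h2 h3 (h4 mem_comp_self)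
  have hαA : ∀ l ∈ Λ, α l ∈ G.A := by
    intro l hl
    by_contra hn
    refine not_all_tight hXB (hΛB hl) (disjoint_left.1 hΛX hl) fun c hc => ?_
    rcases hα l hl c hc with rfl | hT
    · exact absurd (G.subset l (hΛB hl) hc) hn
    · obtain ⟨T, h1, h2, h3, h4⟩ := hT.exists_tight (hΛB hl) hXB
      exact ⟨T, h1, h2, h3, h4 mem_comp_self⟩
  obtain ⟨W, hWd, hW⟩ := exists_disjoint_grown hX.1 hΛB hΛX hα hfree hp
  set wide := Λ.filter fun l => w ≤ (W l).card with hwide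
  set closed := Λ.filter fun l => ¬ w ≤ (W l).card with hclosed
  have hΛc : Λ.card = wide.card + closed.card := (card_filter_add_card_filter_not _).symm
  set 𝒩 := (G.comps X).filter (fun U => ¬ G.TokSet X U) with h𝒩
  set bal := 𝒩.filter (fun U => (G.ins X U).card = U.card ∧ G.s < U.card) with hbal
  have hcomp : ∀ l ∈ Λ, G.comp X (α l) ∈ 𝒩 := fun l hl =>
    mem_filter.2 ⟨mem_comps.2 ⟨_, hαA l hl, rfl⟩, hnTok l hl⟩
  have hclW : ∀ l ∈ closed, W l = G.comp X (α l) ∧ (G.ins X (W l)).card < (W l).card := by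
    intro l hl
    obtain ⟨hl, hlw⟩ := mem_filter.1 hl
    exact (hW l hl).2.2.resolve_left hlw
  set neg := closed.image (fun l => G.comp X (α l)) with hneg
  have hnegc : neg.card = closed.card := by
    refine card_image_of_injOn fun l hl l' hl' e => ?_
    by_contra hne
    have h1 := hWd l (mem_filter.1 hl).1 l' (mem_filter.1 hl').1 hne
    have h2 := (hW l (mem_filter.1 hl).1).1
    rw [(hclW l hl).1, (hclW l' hl').1, ← show G.comp X (α l) = G.comp X (α l') from e] at h1
    exact disjoint_left.1 h1 mem_comp_self mem_comp_self
  have hposc : G.pos X ⊆ G.comps X := filter_subset _ _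
  refine ⟨X, hX.1, wide.card, bal.card, (G.pos X).card, ?_, ?_, ?_, ?_⟩
  · refine card_mul_le_of_disjoint wide W (fun l hl => ?_) (fun l hl l' hl' => ?_)
      (fun l hl => (mem_filter.1 hl).2)
    · have hl := (mem_filter.1 hl).1
      exact (hW l hl).2.1.trans (comp_subset_A hXB (hαA l hl))
    · exact hWd l (mem_filter.1 hl).1 l' (mem_filter.1 hl').1
  · have hbc : bal ⊆ G.comps X := (filter_subset _ _).trans (filter_subset _ _)
    exact card_mul_le_of_disjoint bal id (fun U hU => subset_A_of_mem_comps hXB (hbc hU))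
      -- A surplus is possible only on at least p vertices.
      (fun U hU V hV => comps_disjoint (hbc hU) (hbc hV)) (fun U hU => (mem_filter.1 hU).2.2)
  · refine card_mul_le_of_disjoint (G.pos X) id (fun U hU => subset_A_of_mem_comps hXB (hposc hU))
      (fun U hU V hV => comps_disjoint (hposc hU) (hposc hV)) (fun U hU => ?_)
    by_contra hn
    have := card_ins_le (G := G) hXB (not_le.1 hn)
    have h2 := (mem_filter.1 hU).2
    simp only [id] at this
    omega
  · have hsum : ∑ U ∈ 𝒩, G.weight X U ≤ ∑ U ∈ 𝒩,
        ((if U ∈ G.pos X then 2 * (((G.ins X U).card : ℤ) - U.card) + 1 else 0) +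
          (if U ∈ bal then 1 else 0) - (if U ∈ neg then 1 else 0)) := by
      refine sum_le_sum fun U hU => ?_
      obtain ⟨hUc, hUT⟩ := mem_filter.1 hU
      have hwU := weight_le hXB hUc
      -- A deficit makes the weight at most -1, which pays for the exceptional hyperedge whose piece
      -- is this component. A balanced component has positive weight only if it is a tree, and then
      -- it has more than s vertices since it is not a small tree. A surplus is charged in full.
      rcases lt_trichotomy (G.ins X U).card U.card with h | h | h
      · rw [if_neg (fun hm => by have := (mem_filter.1 hm).2; omega),
          if_neg (fun hm => by have := (mem_filter.1 hm).2.1; omega)]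
        split_ifs <;> omega
      · have hnn : U ∉ neg := by
          intro hm
          obtain ⟨l, hl, rfl⟩ := mem_image.1 hm
          have := (hclW l hl).2
          rw [(hclW l hl).1] at this
          omega
        rw [if_neg (fun hm => by have := (mem_filter.1 hm).2; omega), if_neg hnn]
        by_cases hs : G.s < U.card
        · rw [if_pos (mem_filter.2 ⟨hU, h, hs⟩)]
          omega
        · rw [if_neg (fun hm => hs (mem_filter.1 hm).2.2)]
          have hne : ∑ b ∈ G.ins X U, (G.N b).card + 1 ≠ 2 * U.card := fun e =>
            hUT ⟨h, not_lt.1 hs, e⟩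
          have hconn : U.card + (G.ins X U).card ≤ ∑ b ∈ G.ins X U, (G.N b).card + 1 := by
            obtain ⟨a, -, rfl⟩ := mem_comps.1 hUc
            exact card_comp_add_card_ins_le hXB
          have : 2 * U.card ≤ ∑ b ∈ G.ins X U, (G.N b).card := by omega
          rw [weight]
          zify at this h
          linarith
      · have hnn : U ∉ neg := by
          intro hm
          obtain ⟨l, hl, rfl⟩ := mem_image.1 hm
          have := (hclW l hl).2
          rw [(hclW l hl).1] at this
          omega
        rw [if_pos (show U ∈ G.pos X from mem_filter.2 ⟨hUc, h⟩),
          if_neg (fun hm => by have := (mem_filter.1 hm).2.1; omega), if_neg hnn]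
        omega
    have hpos𝒩 : G.pos X ⊆ 𝒩 := by
      intro U hU
      refine mem_filter.2 ⟨hposc hU, fun hT => ?_⟩
      have := (mem_filter.1 hU).2
      have := hT.1
      omega
    have hneg𝒩 : neg ⊆ 𝒩 := by
      intro U hU
      obtain ⟨l, hl, rfl⟩ := mem_image.1 hU
      exact hcomp l (mem_filter.1 hl).1
    rw [sum_sub_distrib, sum_add_distrib, sum_ite_mem, sum_ite_mem, sum_ite_mem,
      inter_eq_right.2 hpos𝒩, inter_eq_right.2 hneg𝒩,
      inter_eq_right.2 (filter_subset _ _ : bal ⊆ 𝒩), sum_add_distrib, ← mul_sum] at hsum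
    simp only [sum_const, nsmul_eq_mul, mul_one] at hsum
    rw [hnegc] at hsum
    have : (Λ.card : ℤ) = wide.card + closed.card := by exact_mod_cast hΛc
    linarith

end Counting

end LocalSystem

end SetPacking

/-! ### The core multigraph and its surplus -/

namespace SetPacking

namespace LocalSystem

open Finset

section Core

variable {β γ : Type*} [DecidableEq β] [DecidableEq γ] {G : LocalSystem β γ}
  {X : Finset γ} {F : γ → Finset β} {U : Finset β} {a a' : β} {b b' : γ}

variable (G) in
/-- `F` selects the ends of the members of `X`: two neighbours (or all, if there are fewer), such
that the other neighbours are cut off in small balanced trees. -/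
structure Ends (X : Finset γ) (F : γ → Finset β) : Prop where
  good : G.Good X
  subset : ∀ b ∈ X, F b ⊆ G.N b
  card : ∀ b ∈ X, (F b).card = min 2 (G.N b).card
  rest : ∀ b ∈ X, G.rest X b ⊆ F b

theorem Good.exists_ends (hX : G.Good X) : ∃ F, G.Ends X F := by
  have h : ∀ b, ∃ F : Finset β, b ∈ X → F ⊆ G.N b ∧ F.card = min 2 (G.N b).card ∧
      G.rest X b ⊆ F := by
    intro b
    by_cases hb : b ∈ X
    · obtain ⟨F, h1, h2, h3⟩ := exists_subsuperset_card_eq (rest_subset_N (G := G) (X := X) (b := b))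
        (le_min (hX.2 b hb) (card_le_card rest_subset_N)) (min_le_right 2 _)
      exact ⟨F, fun _ => ⟨h2, h3, h1⟩⟩
    · exact ⟨∅, fun h => absurd h hb⟩
  choose F hF using h
  exact ⟨F, hX, fun b hb => (hF b hb).1, fun b hb => (hF b hb).2.1, fun b hb => (hF b hb).2.2⟩

theorem Ends.stok (h : G.Ends X F) (hb : b ∈ X) (ha : a ∈ G.N b \ F b) :
    G.STok (X.erase b) b a := by
  by_contra hn
  rw [mem_sdiff] at ha
  exact ha.2 (h.rest b hb (mem_rest.2 ⟨ha.1, hn⟩))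

theorem Ends.three_le (h : G.Ends X F) (hb : b ∈ X) (ha : a ∈ G.N b \ F b) :
    3 ≤ (G.N b).card := by
  rw [mem_sdiff] at ha
  have h1 := card_lt_card ((h.subset b hb).ssubset_of_not_subset fun h => ha.2 (h ha.1))
  have h2 := h.card b hb
  omega

variable (G) in
/-- No tree cut off by another member of `X` meets `b`. -/
def Core (X : Finset γ) (F : γ → Finset β) (b : γ) : Prop :=
  ∀ c ∈ X, c ≠ b → ∀ a ∈ G.N c \ F c, Disjoint (G.N b) (G.comp (X.erase c) a)

theorem Ends.notMem_tail (h : G.Ends X F) (hb : b ∈ X) (hc : G.Core X F b) {x : β} (hx : x ∈ F b)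
    (hb' : b' ∈ X) (ha : a ∈ G.N b' \ F b') : x ∉ G.comp (X.erase b') a := by
  intro hxa
  have hxN := h.subset b hb hx
  by_cases hbb : b' = b
  · subst hbb
    have := (h.stok hb' ha).eq hxN hxa
    subst this
    exact (mem_sdiff.1 ha).2 hx
  · exact disjoint_left.1 (hc b' hb' hbb a ha) hxN hxa

/-- Two tails of one member are different branches. For different core members, neither meets the
tail of the other; a common vertex would put one tail inside the other, together with its root,
which belongs to its owner. -/
theorem Ends.disjoint_tails (h : G.Ends X F) (hb : b ∈ X) (hc : G.Core X F b)
    (ha : a ∈ G.N b \ F b) (hb' : b' ∈ X) (hc' : G.Core X F b') (ha' : a' ∈ G.N b' \ F b')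
    (hne : b = b' → a ≠ a') : Disjoint (G.comp (X.erase b) a) (G.comp (X.erase b') a') := by
  by_cases hbb : b = b'
  · subst hbb
    refine comp_disjoint fun e => hne rfl ?_
    exact (h.stok hb ha').eq (mem_sdiff.1 ha).1 (e ▸ mem_comp_self)
  · rw [Finset.disjoint_left]
    intro z hz hz'
    have h1 := hc' b hb hbb a ha
    have h2 := hc b' hb' (Ne.symm hbb) a' ha'
    have h3 : G.comp (X.erase b') a' ⊆ G.comp (X.erase b) a := by
      rw [← comp_eq_of_mem hz'] at h2 ⊢
      rw [← comp_erase h2]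
      refine comp_subset (closed_comp.mono ?_) hz
      rw [erase_right_comm]
      exact erase_subset _ _
    exact disjoint_left.1 h1 (mem_sdiff.1 ha').1 (h3 mem_comp_self)

/-- Every hyperedge of a large component that is not in the core lies in a tree that is cut off by
a member of the core. -/
theorem Ends.exists_core (h : G.Ends X F) {y : γ} (hy : y ∈ X) (hyc : ¬ G.Core X F y)
    {x : β} (hxy : x ∈ G.N y) (hU : 2 * G.s < (G.comp X x).card) :
    ∃ b ∈ X, G.Core X F b ∧ ∃ a ∈ G.N b \ F b,
      y ∈ G.ins (X.erase b) (G.comp (X.erase b) a) := by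
  classical
  set Q := (X.sigma fun b => (G.N b \ F b)).filter
    (fun q => y ∈ G.ins (X.erase q.1) (G.comp (X.erase q.1) q.2)) with hQ
  have hne : Q.Nonempty := by
    simp only [Core, not_forall] at hyc
    obtain ⟨c, hc, hcy, a, ha, hd⟩ := hyc
    obtain ⟨z, hz, hz'⟩ := not_disjoint_iff.1 hd
    have hyc : y ∈ X.erase c := mem_erase.2 ⟨Ne.symm hcy, hy⟩
    exact ⟨⟨c, a⟩, mem_filter.2 ⟨mem_sigma.2 ⟨hc, ha⟩, mem_ins.2
      ⟨hyc, subset_comp_of_mem hyc hz hz'⟩⟩⟩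
  -- The owner of a largest tail containing y belongs to the core. Suppose a tail of another c meets
  -- b. Either it strictly contains the tail of b, against maximality, or each owner lies in the
  -- tail of the other. Then the two tails together are closed under X and hold the whole component,
  -- which is too large for that.
  obtain ⟨⟨b, a⟩, hba, hmax⟩ := exists_max_image Q
    (fun q => (G.comp (X.erase q.1) q.2).card) hne
  obtain ⟨hba, hyK⟩ := mem_filter.1 hba
  obtain ⟨hb, ha⟩ := mem_sigma.1 hba
  simp only at hb ha hyK hmax
  refine ⟨b, hb, ?_, a, ha, hyK⟩
  intro c hc hcb a₂ ha₂
  by_contra hd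
  obtain ⟨z, hz, hz'⟩ := not_disjoint_iff.1 hd
  have hbK : G.N b ⊆ G.comp (X.erase c) a₂ :=
    subset_comp_of_mem (mem_erase.2 ⟨Ne.symm hcb, hb⟩) hz hz'
  have hyN := (mem_ins.1 hyK).2
  by_cases hcK : Disjoint (G.N c) (G.comp (X.erase b) a)
  · have hsub : G.comp (X.erase b) a ⊆ G.comp (X.erase c) a₂ := by
      rw [← comp_erase hcK]
      refine comp_subset (closed_comp.mono ?_) (hbK (mem_sdiff.1 ha).1)
      rw [erase_right_comm]
      exact erase_subset _ _
    have hlt : (G.comp (X.erase b) a).card < (G.comp (X.erase c) a₂).card := by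
      refine card_lt_card (hsub.ssubset_of_not_subset fun hs => ?_)
      have h1 := (h.stok hb ha).2
      rw [inter_eq_left.2 (hbK.trans hs)] at h1
      have h2 := h.three_le hb ha
      rw [h1] at h2
      simp at h2
    have hyc : y ≠ c := by
      rintro rfl
      exact disjoint_left.1 hcK hxy (hyN hxy)
    have := hmax ⟨c, a₂⟩ (mem_filter.2 ⟨mem_sigma.2 ⟨hc, ha₂⟩, mem_ins.2
      ⟨mem_erase.2 ⟨hyc, hy⟩, hyN.trans hsub⟩⟩)
    simp only at this
    omega
  · obtain ⟨t, ht, ht'⟩ := not_disjoint_iff.1 hcK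
    have hcK' : G.N c ⊆ G.comp (X.erase b) a :=
      subset_comp_of_mem (mem_erase.2 ⟨hcb, hc⟩) ht ht'
    have hcl : G.Closed X (G.comp (X.erase b) a ∪ G.comp (X.erase c) a₂) := by
      intro d hd u hu hu'
      by_cases hdb : d = b
      · subst hdb
        exact hbK.trans subset_union_right
      by_cases hdc : d = c
      · subst hdc
        exact hcK'.trans subset_union_left
      rcases mem_union.1 hu' with hu' | hu'
      · exact (subset_comp_of_mem (mem_erase.2 ⟨hdb, hd⟩) hu hu').trans subset_union_left
      · exact (subset_comp_of_mem (mem_erase.2 ⟨hdc, hd⟩) hu hu').trans subset_union_right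
    have h1 := card_le_card (comp_subset hcl (mem_union_left _ (hyN hxy)))
    have h2 := card_union_le (G.comp (X.erase b) a) (G.comp (X.erase c) a₂)
    have h3 := (h.stok hb ha).1.2.1
    have h4 := (h.stok hc ha₂).1.2.1
    omega

/-- The members of the core in the components with a surplus of hyperedges, and their ends, have
the same surplus. -/
theorem Ends.exists_surplus (h : G.Ends X F) (hp : 2 * G.s < G.p) :
    ∃ E ⊆ X, ∃ V ⊆ G.A, (∀ b ∈ E, G.Core X F b ∧ F b ⊆ V) ∧
      (V.card : ℤ) + ∑ U ∈ G.pos X, (((G.ins X U).card : ℤ) - U.card) ≤ E.card := by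
  classical
  have hXB := h.good.1
  set P := G.pos X with hP
  have hPc : P ⊆ G.comps X := filter_subset _ _
  set XP := P.biUnion (G.ins X) with hXP
  set AP := P.biUnion id with hAP
  have hXPX : XP ⊆ X := biUnion_subset.2 fun U _ => ins_subset
  have hAPA : AP ⊆ G.A := biUnion_subset.2 fun U hU => subset_A_of_mem_comps hXB (hPc hU)
  -- A component with a surplus has at least p > 2s vertices, as `exists_core` requires.
  have hlarge : ∀ U ∈ P, 2 * G.s < U.card := by
    intro U hU
    by_contra hn
    have h1 := card_ins_le (G := G) (U := U) hXB (by omega)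
    have h2 := (mem_filter.1 hU).2
    omega
  set E := XP.filter (G.Core X F) with hE
  set Q := E.sigma (fun b => (G.N b \ F b)) with hQ
  set T : (Σ _ : γ, β) → Finset β := fun q => G.comp (X.erase q.1) q.2 with hT
  set TT := Q.biUnion T with hTT
  have hEX : E ⊆ X := (filter_subset _ _).trans hXPX
  have hQ' : ∀ q ∈ Q, q.1 ∈ X ∧ G.Core X F q.1 ∧ q.2 ∈ G.N q.1 \ F q.1 := by
    intro q hq
    obtain ⟨h1, h2⟩ := mem_sigma.1 hq
    exact ⟨hEX h1, (mem_filter.1 h1).2, h2⟩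
  have hTd : ∀ q ∈ Q, ∀ q' ∈ Q, q ≠ q' → Disjoint (T q) (T q') := by
    intro q hq q' hq' hne
    obtain ⟨h1, h2, h3⟩ := hQ' q hq
    obtain ⟨h1', h2', h3'⟩ := hQ' q' hq'
    exact h.disjoint_tails h1 h2 h3 h1' h2' h3' fun e e' =>
      hne (Sigma.ext e (heq_of_eq e'))
  have hTAP : TT ⊆ AP := by
    refine biUnion_subset.2 fun q hq => ?_
    obtain ⟨h1, h2, h3⟩ := hQ' q hq
    have h4 := (mem_filter.1 (mem_sigma.1 hq).1).1
    obtain ⟨U, hU, hbU⟩ := mem_biUnion.1 h4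
    obtain ⟨a, ha, rfl⟩ := mem_comps.1 (hPc hU)
    refine subset_trans ?_ (subset_biUnion_of_mem id hU)
    have h5 := (mem_ins.1 hbU).2 (mem_sdiff.1 h3).1
    simp only [id, ← comp_eq_of_mem h5]
    exact comp_mono (erase_subset _ _)
  have hcover : XP \ E ⊆ Q.biUnion fun q => G.ins (X.erase q.1) (T q) := by
    intro y hy
    obtain ⟨hyX, hyE⟩ := mem_sdiff.1 hy
    have hyc : ¬ G.Core X F y := fun hc => hyE (mem_filter.2 ⟨hyX, hc⟩)
    obtain ⟨U, hU, hyU⟩ := mem_biUnion.1 hyX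
    obtain ⟨a, ha, rfl⟩ := mem_comps.1 (hPc hU)
    obtain ⟨x, hx⟩ := G.nonempty (hXB (hXPX hyX))
    have hxa := (mem_ins.1 hyU).2 hx
    obtain ⟨b, hb, hbc, c, hc, hyb⟩ := h.exists_core (hXPX hyX) hyc hx (by
      rw [comp_eq_of_mem hxa]
      exact hlarge _ hU)
    refine mem_biUnion.2 ⟨⟨b, c⟩, mem_sigma.2 ⟨mem_filter.2 ⟨mem_biUnion.2 ⟨_, hU, ?_⟩, hbc⟩, hc⟩,
      hyb⟩
    have h1 : x ∈ G.comp X c := comp_mono (erase_subset b X) ((mem_ins.1 hyb).2 hx)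
    refine mem_ins.2 ⟨hb, subset_comp_of_mem hb (mem_sdiff.1 hc).1 ?_⟩
    rw [← comp_eq_of_mem hxa, comp_eq_of_mem h1]
    exact mem_comp_self
  -- Every hyperedge outside the core lies in a tail of a core member, and tails are balanced and
  -- disjoint. So at most |TT| hyperedges and exactly |TT| vertices are removed, and the surplus
  -- does not decrease.
  refine ⟨E, hEX, AP \ TT, sdiff_subset.trans hAPA, fun b hb => ⟨(mem_filter.1 hb).2, ?_⟩, ?_⟩
  · intro x hx
    have hbX := hEX hb
    refine mem_sdiff.2 ⟨?_, fun hxT => ?_⟩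
    · obtain ⟨U, hU, hbU⟩ := mem_biUnion.1 (mem_filter.1 hb).1
      exact mem_biUnion.2 ⟨U, hU, (mem_ins.1 hbU).2 (h.subset b hbX hx)⟩
    · obtain ⟨q, hq, hxq⟩ := mem_biUnion.1 hxT
      obtain ⟨h1, -, h3⟩ := hQ' q hq
      exact h.notMem_tail hbX (mem_filter.1 hb).2 hx h1 h3 hxq
  · have e1 : XP.card = ∑ U ∈ P, (G.ins X U).card := by
      simp only [card_eq_sum_ones]
      exact sum_card_biUnion_comps hXB hPc fun _ => 1
    have e2 : AP.card = ∑ U ∈ P, U.card := card_biUnion_comps hPc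
    have e3 : TT.card = ∑ q ∈ Q, (T q).card := card_biUnion hTd
    have e4 : (XP \ E).card ≤ TT.card := by
      rw [e3]
      refine (card_le_card hcover).trans (card_biUnion_le.trans (sum_le_sum fun q hq => ?_))
      obtain ⟨h1, -, h3⟩ := hQ' q hq
      exact (h.stok h1 h3).1.1.le
    have e5 : (XP \ E).card + E.card = XP.card :=
      card_sdiff_add_card_eq_card (filter_subset _ _)
    have e6 := card_sdiff_add_card_eq_card hTAP
    rw [sum_sub_distrib, ← Nat.cast_sum, ← Nat.cast_sum, ← e1, ← e2]
    omega

end Core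

end LocalSystem

end SetPacking

/-! ### Paths, cycles and minimal subgraphs with more edges than vertices -/

namespace SetPacking

open Finset

section Paths

variable {β γ : Type*} [DecidableEq β]

/-- In the multigraph in which the edge `e` has the set of ends `d e`, the edge `e` joins `x` and
`y`. -/
def Links (d : γ → Finset β) (e : γ) (x y : β) : Prop := d e = {x, y}

variable {d : γ → Finset β} {x y z : β} {W W₁ W₂ : Finset β} {F F₁ F₂ : Finset γ} {e : γ}

theorem Links.symm (h : Links d e x y) : Links d e y x := h.trans (pair_comm x y)

variable [DecidableEq γ]

section

variable {J J' : γ → β → β → Prop}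

theorem IsPath.left_mem (h : IsPath J x y W F) : x ∈ W := by
  cases h <;> simp

theorem IsPath.right_mem (h : IsPath J x y W F) : y ∈ W := by
  induction h with
  | nil => simp
  | cons _ _ _ ih => exact mem_insert_of_mem ih

theorem IsPath.mono (h : IsPath J x y W F) (hJ : ∀ e ∈ F, ∀ u v, J e u v → J' e u v) :
    IsPath J' x y W F := by
  induction h with
  | nil => exact .nil _
  | cons h _ hx ih =>
    exact .cons (hJ _ (mem_insert_self _ _) _ _ h) (ih fun e he => hJ e (mem_insert_of_mem he)) hx

theorem IsCycle.mono (h : IsCycle J x W F) (hJ : ∀ e ∈ F, ∀ u v, J e u v → J' e u v) :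
    IsCycle J' x W F := by
  obtain ⟨y, F', e, h1, h2, h3, rfl⟩ := h
  exact ⟨y, F', e, h1.mono fun e he => hJ e (mem_insert_of_mem he), h2,
    hJ _ (mem_insert_self _ _) _ _ h3, rfl⟩

theorem IsCanonicalShape.mono (h : IsCanonicalShape J W F)
    (hJ : ∀ e ∈ F, ∀ u v, J e u v → J' e u v) : IsCanonicalShape J' W F := by
  cases h with
  | twoCycles h₁ h₂ hW hF =>
    exact .twoCycles (h₁.mono fun e he => hJ e (by simp [he]))
      (h₂.mono fun e he => hJ e (by simp [he])) hW hF
  | dumbbell h₁ h₂ h₃ h₁₂ h₁₃ h₂₃ =>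
    exact .dumbbell (h₁.mono fun e he => hJ e (by simp [he]))
      (h₂.mono fun e he => hJ e (by simp [he])) (h₃.mono fun e he => hJ e (by simp [he])) h₁₂ h₁₃ h₂₃
  | theta hxy h₁ h₂ h₃ h₁₂ h₁₃ h₂₃ hF₁₂ hF₁₃ hF₂₃ =>
    exact .theta hxy (h₁.mono fun e he => hJ e (by simp [he]))
      (h₂.mono fun e he => hJ e (by simp [he])) (h₃.mono fun e he => hJ e (by simp [he]))
      h₁₂ h₁₃ h₂₃ hF₁₂ hF₁₃ hF₂₃
  | path h => exact .path (h.mono hJ)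
  | lollipop h₁ h₂ hW =>
    exact .lollipop (h₁.mono fun e he => hJ e (by simp [he]))
      (h₂.mono fun e he => hJ e (by simp [he])) hW
  | cycle h => exact .cycle (h.mono hJ)

theorem IsPath.trans (h₁ : IsPath J x y W₁ F₁) (h₂ : IsPath J y z W₂ F₂) (h : W₁ ∩ W₂ = {y}) :
    IsPath J x z (W₁ ∪ W₂) (F₁ ∪ F₂) := by
  induction h₁ with
  | nil x =>
    rw [union_eq_right.2 (by simpa using h₂.left_mem), empty_union]
    exact h₂
  | @cons e x u y W F hJ hp hx ih =>
    have hy := hp.right_mem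
    have hyx : y ≠ x := fun e => hx (e ▸ hy)
    have hx2 : x ∉ W₂ := by
      intro hx2
      have := mem_inter.2 ⟨mem_insert_self x W, hx2⟩
      rw [h, mem_singleton] at this
      exact hyx this.symm
    rw [insert_union, insert_union]
    rw [insert_inter_of_notMem hx2] at h
    exact .cons hJ (ih h₂ h) (by simp [hx, hx2])

end

theorem IsPath.symm (h : IsPath (Links d) x y W F) : IsPath (Links d) y x W F := by
  induction h with
  | nil => exact .nil _
  | @cons e x u y W F hJ hp hx ih =>
    have hu := hp.left_mem
    have hux : u ≠ x := fun e => hx (e ▸ hu)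
    have h1 : IsPath (Links d) u x (insert u {x}) (insert e ∅) :=
      .cons hJ.symm (.nil x) (by simpa using hux)
    have h2 := ih.trans h1 (by
      ext v
      simp only [mem_inter, mem_insert, mem_singleton]
      constructor
      · rintro ⟨hv, rfl | rfl⟩
        · rfl
        · exact absurd hv hx
      · rintro rfl
        exact ⟨hu, Or.inl rfl⟩)
    convert h2 using 1
    · ext v
      simp only [mem_insert, mem_union, mem_singleton]
      constructor
      · tauto
      · rintro (h | rfl | h)
        · exact Or.inr h
        · exact Or.inr hu
        · exact Or.inl h
    · rw [union_comm]
      rfl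

theorem IsPath.subset (h : IsPath (Links d) x y W F) (he : e ∈ F) : d e ⊆ W := by
  induction h with
  | nil => simp at he
  | @cons e' x u y W F hJ hp hx ih =>
    rcases mem_insert.1 he with rfl | he
    · rw [show d e = {x, u} from hJ]
      exact insert_subset_insert _ (singleton_subset_iff.2 hp.left_mem)
    · exact (ih he).trans (subset_insert _ _)

theorem IsPath.notMem_of_notMem (h : IsPath (Links d) x y W F) (hx : z ∉ W) (hz : z ∈ d e) :
    e ∉ F := fun he => hx (h.subset he hz)

theorem IsPath.card (h : IsPath (Links d) x y W F) : F.card + 1 = W.card := by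
  induction h with
  | nil => simp
  | @cons e x u y W F hJ hp hx ih =>
    have : e ∉ F := hp.notMem_of_notMem hx (by rw [show d e = {x, u} from hJ]; simp)
    rw [card_insert_of_notMem hx, card_insert_of_notMem this, ih]

theorem IsPath.card_ends (h : IsPath (Links d) x y W F) (he : e ∈ F) : (d e).card = 2 := by
  induction h with
  | nil => simp at he
  | @cons e' x u y W F hJ hp hx ih =>
    rcases mem_insert.1 he with rfl | he
    · rw [show d e = {x, u} from hJ]
      exact card_pair fun h => hx (h ▸ hp.left_mem)
    · exact ih he

/-- Edge-disjointness of paths that share at most one vertex. -/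
theorem IsPath.disjoint {F' : Finset γ} (h : IsPath (Links d) x y W F) {W' : Finset β}
    (h' : ∀ e ∈ F', d e ⊆ W') (hW : (W ∩ W').card ≤ 1) : Disjoint F F' := by
  rw [disjoint_left]
  intro e he he'
  have h1 := card_le_card (subset_inter (h.subset he) (h' e he'))
  have h2 := h.card_ends he
  omega

theorem IsPath.card_filter_left (h : IsPath (Links d) x y W F) :
    (F.filter fun e => x ∈ d e).card ≤ 1 := by
  cases h with
  | nil => simp
  | @cons e _ u _ W F hJ hp hx =>
    rw [filter_insert, filter_eq_empty_iff.2 fun e he hxe => hx (hp.subset he hxe)]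
    split_ifs <;> simp

theorem IsPath.split (h : IsPath (Links d) x y W F) (hz : z ∈ W) :
    ∃ W₁ F₁ W₂ F₂, IsPath (Links d) x z W₁ F₁ ∧ IsPath (Links d) z y W₂ F₂ ∧ W₁ ∩ W₂ = {z} ∧
      W₁ ∪ W₂ = W ∧ F₁ ∪ F₂ = F := by
  induction h with
  | nil x =>
    obtain rfl := mem_singleton.1 hz
    exact ⟨_, _, _, _, .nil z, .nil z, by simp, by simp, by simp⟩
  | @cons e x u y W F hJ hp hx ih =>
    by_cases hzx : z = x
    · subst hzx
      exact ⟨_, _, _, _, .nil z, .cons hJ hp hx, by ext; simp +contextual, by simp, by simp⟩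
    · obtain ⟨W₁, F₁, W₂, F₂, h1, h2, h3, rfl, rfl⟩ := ih (mem_of_mem_insert_of_ne hz hzx)
      rw [mem_union, not_or] at hx
      refine ⟨_, _, _, _, .cons hJ h1 hx.1, h2, ?_, ?_, ?_⟩
      · rw [insert_inter_of_notMem hx.2, h3]
      · rw [insert_union]
      · rw [insert_union]

theorem IsPath.snoc (h : IsPath (Links d) x y W F) (hJ : Links d e y z) (hz : z ∉ W) :
    IsPath (Links d) x z (insert z W) (insert e F) :=
  (IsPath.cons hJ.symm h.symm hz).symm

theorem IsCycle.subset (h : IsCycle (Links d) x W F) (he : e ∈ F) : d e ⊆ W := by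
  obtain ⟨y, F', e', h1, h2, h3, rfl⟩ := h
  rcases mem_insert.1 he with rfl | he
  · rw [show d e = {y, x} from h3]
    exact insert_subset h1.right_mem (singleton_subset_iff.2 h1.left_mem)
  · exact h1.subset he

theorem IsCycle.card (h : IsCycle (Links d) x W F) : F.card = W.card := by
  obtain ⟨y, F', e', h1, h2, h3, rfl⟩ := h
  rw [card_insert_of_notMem h2, h1.card]

theorem IsCycle.mem (h : IsCycle (Links d) x W F) : x ∈ W := by
  obtain ⟨y, F', e', h1, h2, h3, rfl⟩ := h
  exact h1.left_mem

/-- The path is cut at z; its second part, the closing edge and all but the first edge of the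
reversed first part form a path from z, and that first edge closes it up. -/
theorem IsCycle.reroot (h : IsCycle (Links d) x W F) (hz : z ∈ W) : IsCycle (Links d) z W F := by
  obtain ⟨y, F', e, h1, h2, h3, rfl⟩ := h
  obtain ⟨W₁, F₁, W₂, F₂, p1, p2, hW, rfl, rfl⟩ := h1.split hz
  have p1' := p1.symm
  cases p1' with
  | nil =>
    refine ⟨y, F₂, e, ?_, by simpa using h2, h3, by simp⟩
    rwa [union_eq_right.2 (by simpa using p2.left_mem)]
  | @cons e' _ u _ W' F'' hJ hp hzW =>
    have hd : Disjoint W₂ W' := by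
      rw [disjoint_left]
      intro v h1 h2
      have : v ∈ insert z W' ∩ W₂ := mem_inter.2 ⟨mem_insert_of_mem h2, h1⟩
      rw [hW, mem_singleton] at this
      exact hzW (this ▸ h2)
    have q : IsPath (Links d) y u (insert y W') (insert e F'') :=
      .cons h3 hp.symm (disjoint_left.1 hd p2.right_mem)
    have hq : W₂ ∩ insert y W' = {y} := by
      rw [inter_insert_of_mem p2.right_mem, disjoint_iff_inter_eq_empty.1 hd, insert_empty]
    have hWe : insert z W' ∪ W₂ = W₂ ∪ insert y W' := by
      ext v
      have h4 : v = z → v ∈ W₂ := fun h => h ▸ p2.left_mem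
      have h5 : v = y → v ∈ W₂ := fun h => h ▸ p2.right_mem
      simp only [mem_insert, mem_union]
      tauto
    refine ⟨u, _, e', hWe ▸ p2.trans q hq, ?_, hJ.symm, ?_⟩
    · have hzd : z ∈ d e' := by rw [show d e' = {z, u} from hJ]; simp
      have hud : u ∈ d e' := by rw [show d e' = {z, u} from hJ]; simp
      simp only [mem_union, mem_insert, not_or] at h2 ⊢
      refine ⟨p2.notMem_of_notMem (disjoint_right.1 hd hp.left_mem) hud, ?_,
        hp.notMem_of_notMem hzW hzd⟩
      exact fun h => h2.1.1 h.symm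
    · ext f
      simp only [mem_insert, mem_union]
      tauto

theorem IsPath.subset_biUnion (h : IsPath (Links d) x y W F) : W ⊆ insert y (F.biUnion d) := by
  induction h with
  | nil => simp
  | @cons e x u y W F hJ hp hx ih =>
    rw [biUnion_insert]
    refine insert_subset ?_ (ih.trans (insert_subset_insert _ subset_union_right))
    refine mem_insert_of_mem (mem_union_left _ ?_)
    rw [show d e = {x, u} from hJ]
    exact mem_insert_self _ _

theorem IsCycle.subset_biUnion (h : IsCycle (Links d) x W F) : W ⊆ F.biUnion d := by
  intro v hv
  obtain ⟨y, F', e, -, -, h3, rfl⟩ := h.reroot hv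
  refine mem_biUnion.2 ⟨e, mem_insert_self _ _, ?_⟩
  rw [show d e = {y, v} from h3]
  simp

theorem IsCycle.split (h : IsCycle (Links d) x W F) (hz : z ∈ W) (hzx : z ≠ x) :
    ∃ W₁ F₁ W₂ F₂, IsPath (Links d) x z W₁ F₁ ∧ IsPath (Links d) x z W₂ F₂ ∧ W₁ ∩ W₂ = {x, z} ∧
      W₁ ∪ W₂ = W ∧ F₁ ∪ F₂ = F ∧ Disjoint F₁ F₂ := by
  obtain ⟨y, F', e, h1, h2, h3, rfl⟩ := h
  obtain ⟨W₁, F₁, W₂, F₂, p1, p2, hW, rfl, rfl⟩ := h1.split hz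
  have hx1 := p1.left_mem
  have hx2 : x ∉ W₂ := by
    intro hx2
    have := mem_inter.2 ⟨hx1, hx2⟩
    rw [hW, mem_singleton] at this
    exact hzx this.symm
  rw [mem_union, not_or] at h2
  refine ⟨W₁, F₁, _, _, p1, .cons h3.symm p2.symm hx2, ?_, ?_, ?_, ?_⟩
  · rw [inter_insert_of_mem hx1, hW]
  · rw [union_insert, insert_eq_self.2 (mem_union_left _ hx1)]
  · rw [union_insert]
  · rw [disjoint_insert_right]
    exact ⟨h2.1, p1.disjoint (fun e he => p2.subset he) (by rw [hW]; simp)⟩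

/-- A cycle with a path attached to it, closed up by a further edge. -/
theorem IsCycle.canonicalShape {WC WP : Finset β} {FC FP : Finset γ}
    (hC : IsCycle (Links d) x WC FC) (hP : IsPath (Links d) x y WP FP) (hW : WC ∩ WP = {x})
    (he : e ∉ FC ∪ FP) (hJ : Links d e y z) (hz : z ∈ WC ∪ WP) :
    IsCanonicalShape (Links d) (WC ∪ WP) (insert e (FC ∪ FP)) := by
  rw [mem_union, not_or] at he
  have hFd : Disjoint FP FC := hP.disjoint (fun e he => hC.subset he) (by
    rw [inter_comm, hW, card_singleton])
  -- The other end z of the closing edge decides the shape: two cycles at x if z = x, two cycles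
  -- joined by a path if z is elsewhere on the attached path, and a theta if z is elsewhere on the
  -- cycle.
  by_cases hzx : z = x
  · subst hzx
    rw [← union_insert]
    refine .twoCycles hC ⟨y, FP, e, hP, he.2, hJ, rfl⟩ hW ?_
    rw [disjoint_insert_right]
    exact ⟨he.1, hFd.symm⟩
  by_cases hzP : z ∈ WP
  · obtain ⟨W₁, F₁, W₂, F₂, p1, p2, h3, rfl, rfl⟩ := hP.split hzP
    rw [mem_union, not_or] at he
    have hx1 := p1.left_mem
    have hx2 : x ∉ W₂ := by
      intro hx2
      have := mem_inter.2 ⟨hx1, hx2⟩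
      rw [h3, mem_singleton] at this
      exact hzx this.symm
    have key : ∀ v ∈ WC, v ∈ W₁ ∪ W₂ → v = x := by
      intro v h1 h2
      have := mem_inter.2 ⟨h1, h2⟩
      rwa [hW, mem_singleton] at this
    have := IsCanonicalShape.dumbbell hC ⟨y, F₂, e, p2, he.2.2, hJ, rfl⟩ p1 ?_ ?_ ?_
    · convert this using 1
      · rw [union_comm W₁, union_assoc]
      · ext f
        simp only [mem_insert, mem_union]
        tauto
    · rw [disjoint_left]
      intro v h1 h2
      exact hx2 (key v h1 (mem_union_right _ h2) ▸ h2)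
    · ext v
      simp only [mem_inter, mem_singleton]
      constructor
      · exact fun h => key v h.1 (mem_union_left _ h.2)
      · rintro rfl
        exact ⟨hC.mem, hx1⟩
    · rw [inter_comm, h3]
  · have hzC : z ∈ WC := (mem_union.1 hz).resolve_right hzP
    obtain ⟨W₁, F₁, W₂, F₂, p1, p2, h3, rfl, rfl, h6⟩ := hC.split hzC hzx
    have p3 := hP.snoc hJ hzP
    rw [mem_union, not_or] at he
    have key : ∀ v ∈ W₁ ∪ W₂, v ∈ WP → v = x := by
      intro v h1 h2
      have := mem_inter.2 ⟨h1, h2⟩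
      rwa [hW, mem_singleton] at this
    have hi : ∀ W' ⊆ W₁ ∪ W₂, x ∈ W' → z ∈ W' → W' ∩ insert z WP = {x, z} := by
      intro W' hW' hx' hz'
      ext v
      simp only [mem_inter, mem_insert, mem_singleton]
      constructor
      · rintro ⟨h1, h2 | h2⟩
        · exact Or.inr h2
        · exact Or.inl (key v (hW' h1) h2)
      · rintro (rfl | rfl)
        · exact ⟨hx', Or.inr hP.left_mem⟩
        · exact ⟨hz', Or.inl rfl⟩
    rw [disjoint_union_right] at hFd
    have := IsCanonicalShape.theta (Ne.symm hzx) p1 p2 p3 h3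
      (hi W₁ subset_union_left p1.left_mem p1.right_mem)
      (hi W₂ subset_union_right p2.left_mem p2.right_mem) h6
      (disjoint_insert_right.2 ⟨he.1.1, hFd.1.symm⟩)
      (disjoint_insert_right.2 ⟨he.1.2, hFd.2.symm⟩)
    convert this using 1
    · rw [union_insert, insert_eq_self.2]
      exact mem_union_left _ hzC
    · rw [union_insert]

/-- A path that starts in `x`, avoids `Z` otherwise, and cannot be extended. -/
theorem exists_longest_path (d : γ → Finset β) (E : Finset γ) (Z : Finset β) (x : β)
    (hd : ∀ e ∈ E, (d e).card ≤ 2) :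
    ∃ y W F, IsPath (Links d) x y W F ∧ F ⊆ E ∧ (∀ v ∈ Z, v ∈ W → v = x) ∧
      ∀ e ∈ E, y ∈ d e → ∃ z ∈ Z ∪ W, Links d e y z := by
  classical
  let P : Finset γ → Prop := fun F => ∃ y W, IsPath (Links d) x y W F ∧ ∀ v ∈ Z, v ∈ W → v = x
  obtain ⟨F, hF, hmax⟩ := exists_max_image (E.powerset.filter P) card
    ⟨∅, by
      simp only [mem_filter, mem_powerset, empty_subset, true_and]
      exact ⟨x, _, .nil x, by simp⟩⟩
  simp only [mem_filter, mem_powerset] at hF hmax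
  obtain ⟨hFE, y, W, hp, hZ⟩ := hF
  refine ⟨y, W, F, hp, hFE, hZ, fun e he hy => ?_⟩
  have hz : ∃ z, Links d e y z := by
    have h1 := card_erase_of_mem hy
    have h2 := hd e he
    rcases Nat.eq_zero_or_pos ((d e).erase y).card with h | h
    · refine ⟨y, ?_⟩
      rw [Links, pair_eq_singleton, ← insert_erase hy, card_eq_zero.1 h, insert_empty]
    · obtain ⟨z, hz⟩ := card_eq_one.1 (show ((d e).erase y).card = 1 by omega)
      exact ⟨z, by rw [Links, ← insert_erase hy, hz]⟩
  obtain ⟨z, hz⟩ := hz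
  refine ⟨z, ?_, hz⟩
  by_contra hn
  rw [mem_union, not_or] at hn
  have hp' := hp.snoc hz hn.2
  have h1 := hmax (insert e F) ⟨insert_subset he hFE, z, _, hp', fun v hv hv' => by
    rcases mem_insert.1 hv' with rfl | hv'
    · exact absurd hv hn.1
    · exact hZ v hv hv'⟩
  have h2 := hp.card
  have h3 := hp'.card
  rw [card_insert_of_notMem hn.2] at h3
  omega

/-- A multigraph with more edges than vertices contains a subgraph of one of the canonical types
with more edges than vertices. -/
theorem exists_canonicalShape (d : γ → Finset β) (E : Finset γ)
    (hd : ∀ e ∈ E, (d e).Nonempty ∧ (d e).card ≤ 2) (hE : (E.biUnion d).card < E.card) :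
    ∃ W F, F ⊆ E ∧ W ⊆ F.biUnion d ∧ IsCanonicalShape (Links d) W F ∧ W.card < F.card := by
  classical
  induction E using Finset.strongInduction with
  | H E ih =>
  by_cases hmin : ∃ E', E' ⊂ E ∧ (E'.biUnion d).card < E'.card
  · obtain ⟨E', h1, h2⟩ := hmin
    obtain ⟨W, F, h3, h4⟩ := ih E' h1 (fun e he => hd e (h1.1 he)) h2
    exact ⟨W, F, h3.trans h1.1, h4⟩
  -- The edge set may be taken minimal with more edges than vertices. Then no vertex is met by a
  -- single edge (`hdeg`), since deleting that edge would also delete the vertex.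
  have hmin' : ∀ E' ⊂ E, E'.card ≤ (E'.biUnion d).card := fun E' h => by
    by_contra hn
    exact hmin ⟨E', h, not_le.1 hn⟩
  have hdeg : ∀ y ∈ E.biUnion d, ∀ F : Finset γ, (F.filter fun e => y ∈ d e).card ≤ 1 →
      ∃ e ∈ E, e ∉ F ∧ y ∈ d e := by
    intro y hy F hF
    by_contra! hn
    obtain ⟨e, he, hye⟩ := mem_biUnion.1 hy
    have heF : e ∈ F := by
      by_contra h
      exact hn e he h hye
    have h1 := hmin' (E.erase e) (erase_ssubset he)
    rw [card_erase_of_mem he] at h1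
    have h2 : (E.erase e).biUnion d ⊆ (E.biUnion d).erase y := by
      intro v hv
      obtain ⟨f, hf, hv⟩ := mem_biUnion.1 hv
      obtain ⟨hfe, hf⟩ := mem_erase.1 hf
      refine mem_erase.2 ⟨?_, mem_biUnion.2 ⟨f, hf, hv⟩⟩
      rintro rfl
      have hfF : f ∈ F := by
        by_contra h
        exact hn f hf h hv
      exact hfe (card_le_one.1 hF f (mem_filter.2 ⟨hfF, hv⟩) e (mem_filter.2 ⟨heF, hye⟩))
    have h3 := card_le_card h2
    rw [card_erase_of_mem hy] at h3
    have h4 := card_pos.2 ⟨y, hy⟩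
    omega
  obtain ⟨e₀, he₀⟩ := card_pos.1 (Nat.zero_lt_of_lt hE)
  obtain ⟨x₀, hx₀⟩ := (hd e₀ he₀).1
  have hcyc : ∃ x W F, IsCycle (Links d) x W F ∧ F ⊆ E := by
    obtain ⟨y, W, F, hp, hFE, -, hend⟩ := exists_longest_path d E ∅ x₀ fun e he => (hd e he).2
    have hy : y ∈ E.biUnion d := by
      have hp' := hp.symm
      cases hp' with
      | nil => exact mem_biUnion.2 ⟨e₀, he₀, hx₀⟩
      | @cons e _ u _ W F hJ hp hx =>
        exact mem_biUnion.2 ⟨e, hFE (mem_insert_self _ _), by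
          rw [show d e = {y, u} from hJ]; simp⟩
    obtain ⟨e, he, heF, hye⟩ := hdeg y hy F hp.symm.card_filter_left
    obtain ⟨z, hz, hJ⟩ := hend e he hye
    rw [empty_union] at hz
    obtain ⟨W₁, F₁, W₂, F₂, p1, p2, h3, rfl, rfl⟩ := hp.split hz
    rw [mem_union, not_or] at heF
    exact ⟨z, W₂, _, ⟨y, F₂, e, p2, heF.2, hJ, rfl⟩,
      insert_subset he (subset_union_right.trans hFE)⟩
  obtain ⟨x₁, WC, FC, hC₁, hFC⟩ := hcyc
  have hWC : WC ⊆ E.biUnion d :=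
    hC₁.subset_biUnion.trans (biUnion_subset_biUnion_of_subset_left _ hFC)
  -- A cycle has as many edges as vertices, so if it were a component on its own, deleting it would
  -- preserve the surplus, against minimality.
  have hatt : ∃ e ∈ E, e ∉ FC ∧ ∃ x ∈ WC, x ∈ d e := by
    by_contra! hn
    have hne : FC.Nonempty := by
      rw [← card_pos, hC₁.card]
      exact card_pos.2 ⟨_, hC₁.mem⟩
    have h1 := hmin' (E \ FC) (sdiff_ssubset hFC hne)
    have h2 : (E \ FC).biUnion d ⊆ E.biUnion d \ WC := by
      intro v hv
      obtain ⟨f, hf, hv⟩ := mem_biUnion.1 hv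
      obtain ⟨hf, hfC⟩ := mem_sdiff.1 hf
      exact mem_sdiff.2 ⟨mem_biUnion.2 ⟨f, hf, hv⟩, fun h => hn f hf hfC v h hv⟩
    have h3 := card_le_card h2
    have h4 := card_sdiff_add_card_eq_card hWC
    have h5 := card_sdiff_add_card_eq_card hFC
    have h6 := hC₁.card
    omega
  obtain ⟨e₁, he₁, he₁C, x, hxC, hx₁⟩ := hatt
  have hC := hC₁.reroot hxC
  obtain ⟨y, WP, FP, hP, hFP, hdis, hend⟩ :=
    exists_longest_path d E WC x fun e he => (hd e he).2
  have hW : WC ∩ WP = {x} := by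
    ext v
    simp only [mem_inter, mem_singleton]
    constructor
    · exact fun h => hdis v h.1 h.2
    · rintro rfl
      exact ⟨hxC, hP.left_mem⟩
  -- The path leaving the cycle cannot be extended, and its last vertex has an edge not yet used.
  -- The other end of this edge is therefore on the cycle or the path, which completes the shape.
  have hnew : ∃ e ∈ E, e ∉ FC ∪ FP ∧ y ∈ d e := by
    have hP' := hP.symm
    cases hP' with
    | nil => exact ⟨e₁, he₁, by simpa using he₁C, hx₁⟩
    | @cons e _ u _ W F hJ hp hy =>
      have hyd : y ∈ d e := by rw [show d e = {y, u} from hJ]; simp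
      obtain ⟨f, hf, hfP, hyf⟩ := hdeg y (mem_biUnion.2 ⟨e, hFP (mem_insert_self _ _), hyd⟩) _
        hP.symm.card_filter_left
      refine ⟨f, hf, ?_, hyf⟩
      rw [mem_union, not_or]
      refine ⟨fun hfC => ?_, hfP⟩
      have h1 := hdis y (hC.subset hfC hyf) (mem_insert_self _ _)
      exact hy (h1 ▸ hp.right_mem)
  obtain ⟨e, he, heF, hye⟩ := hnew
  obtain ⟨z, hz, hJ⟩ := hend e he hye
  have hcard : (WC ∪ WP).card < (insert e (FC ∪ FP)).card := by
    have hFd : Disjoint FP FC := hP.disjoint (fun e he => hC.subset he) (by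
      rw [inter_comm, hW, card_singleton])
    rw [card_insert_of_notMem heF, card_union_of_disjoint hFd.symm]
    have h1 := card_union_add_card_inter WC WP
    rw [hW, card_singleton] at h1
    have h2 := hC.card
    have h3 := hP.card
    omega
  refine ⟨WC ∪ WP, insert e (FC ∪ FP), insert_subset he (union_subset hFC hFP), ?_,
    hC.canonicalShape hP hW heF hJ hz, hcard⟩
  have h1 : WC ⊆ (insert e (FC ∪ FP)).biUnion d := hC.subset_biUnion.trans
    (biUnion_subset_biUnion_of_subset_left _ (subset_union_left.trans (subset_insert _ _)))
  refine union_subset h1 (hP.symm.subset_biUnion.trans (insert_subset (h1 hxC)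
    (biUnion_subset_biUnion_of_subset_left _ (subset_union_right.trans (subset_insert _ _)))))

end Paths

end SetPacking

/-! ### Small subgraphs of dense multigraphs -/

namespace SetPacking

open Finset

section Dense

variable {β γ : Type*} [DecidableEq β]

/-- The edges from `E` with all ends in `W`. -/
def inner (d : γ → Finset β) (E : Finset γ) (W : Finset β) : Finset γ := E.filter fun e => d e ⊆ W

/-- The edges from `E` with an end in `W`. -/
def touching (d : γ → Finset β) (E : Finset γ) (W : Finset β) : Finset γ :=
  E.filter fun e => ¬ Disjoint (d e) W

/-- The vertices at distance at most `i` from `v`. -/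
def gball (d : γ → Finset β) (E : Finset γ) (v : β) : ℕ → Finset β
  | 0 => {v}
  | i + 1 => gball d E v i ∪ (touching d E (gball d E v i)).biUnion d

variable {d : γ → Finset β} {E : Finset γ} {V W : Finset β} {v : β}

theorem gball_mono {i j : ℕ} (h : i ≤ j) : gball d E v i ⊆ gball d E v j := by
  induction h with
  | refl => rfl
  | step _ ih => exact ih.trans subset_union_left

theorem touching_subset_inner {i : ℕ} :
    touching d E (gball d E v i) ⊆ inner d E (gball d E v (i + 1)) := by
  intro e he
  exact mem_filter.2 ⟨(mem_filter.1 he).1, (subset_biUnion_of_mem d he).trans subset_union_right⟩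

theorem gball_subset (hv : v ∈ V) (hd : ∀ e ∈ E, d e ⊆ V) (i : ℕ) : gball d E v i ⊆ V := by
  induction i with
  | zero => simpa [gball] using hv
  | succ i ih =>
    exact union_subset ih (biUnion_subset.2 fun e he => hd e (mem_filter.1 he).1)

/-- A subgraph of maximal density: every set of its vertices meets many edges. -/
theorem exists_dense_subgraph {δ : ℝ} (hV : V.Nonempty) (hE : ∀ e ∈ E, d e ⊆ V ∧ (d e).Nonempty)
    (h : (1 + δ) * V.card ≤ E.card) :
    ∃ V' ⊆ V, V'.Nonempty ∧ ∃ E' ⊆ E, (∀ e ∈ E', d e ⊆ V') ∧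
      ∀ W ⊆ V', (1 + δ) * W.card ≤ (touching d E' W).card := by
  classical
  let P : Finset β → Prop := fun W => W.Nonempty ∧ (1 + δ) * W.card ≤ (inner d E W).card
  -- For a smallest vertex set of density at least 1 + δ, deleting any W must lower the density, so
  -- W meets at least (1 + δ)|W| edges.
  obtain ⟨V', hV', hmin⟩ := exists_min_image (V.powerset.filter P) card ⟨V, by
    simp only [mem_filter, mem_powerset, Subset.refl, true_and, P]
    refine ⟨hV, ?_⟩
    rwa [inner, filter_true_of_mem fun e he => (hE e he).1]⟩
  simp only [mem_filter, mem_powerset] at hV' hmin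
  obtain ⟨hV'V, hne, hd⟩ := hV'
  refine ⟨V', hV'V, hne, inner d E V', filter_subset _ _, fun e he => (mem_filter.1 he).2,
    fun W hW => ?_⟩
  by_cases hWe : W = ∅
  · subst hWe
    simp
  have hsplit : (touching d (inner d E V') W).card + (inner d E (V' \ W)).card =
      (inner d E V').card := by
    rw [touching, ← card_filter_add_card_filter_not (s := inner d E V')
      (fun e => ¬ Disjoint (d e) W)]
    congr 2
    ext e
    simp only [inner, mem_filter, not_not, subset_sdiff]
    tauto
  have hcW := card_sdiff_add_card_eq_card hW
  have h1 : ((inner d E (V' \ W)).card : ℝ) ≤ (1 + δ) * (V' \ W).card := by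
    by_cases h0 : (V' \ W).Nonempty
    · by_contra hn
      have := hmin (V' \ W) ⟨sdiff_subset.trans hV'V, h0, (not_le.1 hn).le⟩
      have := card_pos.2 (nonempty_iff_ne_empty.2 hWe)
      omega
    · rw [not_nonempty_iff_eq_empty] at h0
      rw [h0, inner, filter_eq_empty_iff.2 fun e he hs =>
        (hE e he).2.ne_empty (subset_empty.1 hs)]
      simp
  have e1 : ((touching d (inner d E V') W).card : ℝ) + (inner d E (V' \ W)).card =
      (inner d E V').card := by exact_mod_cast hsplit
  have e2 : ((V' \ W).card : ℝ) + W.card = V'.card := by exact_mod_cast hcW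
  rw [← e1, ← e2] at hd
  linarith

/-- Parent edges along the distance from `v`. -/
theorem exists_parent [Nonempty γ] {r : ℕ} (hd : ∀ e ∈ E, (d e).card ≤ 2) :
    ∃ (lev : β → ℕ) (par : β → β) (f : β → γ), ∀ x ∈ gball d E v r, lev x ≤ r ∧ (x ≠ v →
      par x ∈ gball d E v r ∧ lev (par x) < lev x ∧ f x ∈ E ∧ d (f x) = {x, par x}) := by
  classical
  have : Nonempty β := ⟨v⟩
  set lev : β → ℕ := fun x => sInf {i | x ∈ gball d E v i} with hlev
  have hle : ∀ i, ∀ x ∈ gball d E v i, lev x ≤ i := fun i x hx => Nat.sInf_le hx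
  have h : ∀ x ∈ gball d E v r, x ≠ v → ∃ u e, u ∈ gball d E v r ∧ lev u < lev x ∧ e ∈ E ∧
      d e = {x, u} := by
    intro x hx hxv
    have hmem : x ∈ gball d E v (lev x) :=
      Nat.sInf_mem (s := {i | x ∈ gball d E v i}) ⟨r, hx⟩
    cases hl : lev x with
    | zero =>
      rw [hl] at hmem
      exact absurd (mem_singleton.1 hmem) hxv
    | succ j =>
      have hxj : x ∉ gball d E v j := fun h => by
        have := hle j x h
        omega
      rw [hl] at hmem
      obtain ⟨e, he, hxe⟩ := mem_biUnion.1 ((mem_union.1 hmem).resolve_left hxj)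
      obtain ⟨he, hnd⟩ := mem_filter.1 he
      obtain ⟨u, hu, huj⟩ := not_disjoint_iff.1 hnd
      have hxu : x ≠ u := fun h => hxj (h ▸ huj)
      have hrj : j ≤ r := by
        have := hle r x hx
        omega
      refine ⟨u, e, gball_mono hrj huj, Nat.lt_succ_of_le (hle j u huj), he, ?_⟩
      refine (eq_of_subset_of_card_le ?_ ?_).symm
      · exact insert_subset hxe (singleton_subset_iff.2 hu)
      · rw [card_pair hxu]
        exact hd e he
  choose! par f hf using h
  exact ⟨lev, par, f, fun x hx => ⟨hle r x hx, hf x hx⟩⟩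

/-- A ball that contains more edges than vertices contains a small set of edges that span fewer
vertices. -/
theorem exists_small_surplus [DecidableEq γ] {r : ℕ} (hd : ∀ e ∈ E, (d e).card ≤ 2)
    (h : (gball d E v r).card < (inner d E (gball d E v r)).card) :
    ∃ F ⊆ E, (F.biUnion d).card < F.card ∧ F.card ≤ 4 * r + 2 := by
  classical
  obtain ⟨e₀, -⟩ := card_pos.1 (Nat.zero_lt_of_lt h)
  have : Nonempty γ := ⟨e₀⟩
  obtain ⟨lev, par, f, hf⟩ := exists_parent (v := v) (r := r) hd
  set B := gball d E v r with hB
  have hvB : v ∈ B := gball_mono (Nat.zero_le r) (mem_singleton_self v)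
  have hinj : ∀ x ∈ B, x ≠ v → ∀ y ∈ B, y ≠ v → f x = f y → x = y := by
    intro x hx hxv y hy hyv e
    obtain ⟨-, h1, -, h2⟩ := (hf x hx).2 hxv
    obtain ⟨-, h1', -, h2'⟩ := (hf y hy).2 hyv
    by_contra hne
    rw [e, h2'] at h2
    have h3 : y ∈ ({x, par x} : Finset β) := h2 ▸ mem_insert_self _ _
    have h4 : x ∈ ({y, par y} : Finset β) := h2 ▸ mem_insert_self _ _
    simp only [mem_insert, mem_singleton] at h3 h4
    have h5 := h3.resolve_left (Ne.symm hne)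
    have h6 := h4.resolve_left hne
    rw [← h5] at h1
    rw [← h6] at h1'
    omega
  have hanc : ∀ n, ∀ x ∈ B, lev x ≤ n → ∃ Q ⊆ B, x ∈ Q ∧ v ∈ Q ∧ (Q.erase v).card ≤ n ∧
      ∀ u ∈ Q, u ≠ v → par u ∈ Q := by
    intro n
    induction n with
    | zero =>
      intro x hx hn
      have hxv : x = v := by
        by_contra hxv
        have := ((hf x hx).2 hxv).2.1
        omega
      subst hxv
      exact ⟨{x}, by simpa using hx, by simp, by simp, by simp, by simp⟩
    | succ n ih =>
      intro x hx hn
      by_cases hxv : x = v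
      · subst hxv
        exact ⟨{x}, by simpa using hx, by simp, by simp, by simp, by simp⟩
      · obtain ⟨h1, h2, -, -⟩ := (hf x hx).2 hxv
        obtain ⟨Q, q1, q2, q3, q4, q5⟩ := ih (par x) h1 (by omega)
        refine ⟨insert x Q, insert_subset hx q1, mem_insert_self _ _, mem_insert_of_mem q3, ?_, ?_⟩
        · rw [erase_insert_of_ne hxv]
          exact (card_insert_le _ _).trans (by omega)
        · intro u hu huv
          rcases mem_insert.1 hu with rfl | hu
          · exact mem_insert_of_mem q2
          · exact mem_insert_of_mem (q5 u hu huv)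
  have hanc' : ∀ x ∈ B, ∃ Q ⊆ B, x ∈ Q ∧ v ∈ Q ∧ (Q.erase v).card ≤ r ∧
      ∀ u ∈ Q, u ≠ v → par u ∈ Q := fun x hx => hanc r x hx (hf x hx).1
  choose! Q hQB hQx hQv hQc hQp using hanc'
  -- The edges to parents form a spanning tree of the ball with at most |B| - 1 edges, so at least
  -- two inner edges are outside it.
  set T := (B.erase v).image f with hT
  have hTc : T.card ≤ B.card - 1 := card_image_le.trans_eq (card_erase_of_mem hvB)
  have htwo : 1 < (inner d E B \ T).card := by
    have h1 := le_card_sdiff T (inner d E B)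
    have h2 := card_pos.2 ⟨v, hvB⟩
    omega
  obtain ⟨e₁, he₁, e₂, he₂, hne⟩ := one_lt_card.1 htwo
  rw [mem_sdiff] at he₁ he₂
  obtain ⟨hi₁, hT₁⟩ := he₁
  obtain ⟨hi₂, hT₂⟩ := he₂
  obtain ⟨hE₁, hB₁⟩ := mem_filter.1 hi₁
  obtain ⟨hE₂, hB₂⟩ := mem_filter.1 hi₂
  set D := d e₁ ∪ d e₂ with hD
  have hDB : D ⊆ B := union_subset hB₁ hB₂
  -- The two extra edges have at most four ends, each at most r tree edges from the root. The paths
  -- to the root give |R| ≤ 4r tree edges; with the extra edges there are |R| + 2 edges on at most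
  -- |R| + 1 vertices.
  set R := D.biUnion fun x => (Q x).erase v with hR
  have hRB : R ⊆ B.erase v := biUnion_subset.2 fun x hx => erase_subset_erase _ (hQB x (hDB hx))
  have hDR : D ⊆ insert v R := by
    intro x hx
    by_cases hxv : x = v
    · exact hxv ▸ mem_insert_self _ _
    · exact mem_insert_of_mem (mem_biUnion.2 ⟨x, hx, mem_erase.2 ⟨hxv, hQx x (hDB hx)⟩⟩)
  have hRc : R.card ≤ 4 * r := by
    refine (card_biUnion_le_card_mul _ _ r fun x hx => hQc x (hDB hx)).trans ?_
    refine Nat.mul_le_mul_right r ((card_union_le _ _).trans ?_)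
    have := hd e₁ hE₁
    have := hd e₂ hE₂
    omega
  have hfR : (R.image f).card = R.card := by
    refine card_image_of_injOn fun x hx y hy e => ?_
    have hx := mem_erase.1 (hRB hx)
    have hy := mem_erase.1 (hRB hy)
    exact hinj x hx.2 hx.1 y hy.2 hy.1 e
  have hRT : R.image f ⊆ T := image_subset_image hRB
  have h2 : e₂ ∉ R.image f := fun h => hT₂ (hRT h)
  have h1 : e₁ ∉ insert e₂ (R.image f) := by
    rw [mem_insert, not_or]
    exact ⟨hne, fun h => hT₁ (hRT h)⟩
  have hFc : (insert e₁ (insert e₂ (R.image f))).card = R.card + 2 := by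
    rw [card_insert_of_notMem h1, card_insert_of_notMem h2, hfR]
  refine ⟨insert e₁ (insert e₂ (R.image f)), ?_, ?_, ?_⟩
  · refine insert_subset hE₁ (insert_subset hE₂ fun e he => ?_)
    obtain ⟨x, hx, rfl⟩ := mem_image.1 he
    have hx := mem_erase.1 (hRB hx)
    exact ((hf x hx.2).2 hx.1).2.2.1
  · have hsub : (insert e₁ (insert e₂ (R.image f))).biUnion d ⊆ insert v R := by
      rw [biUnion_insert, biUnion_insert]
      refine union_subset (subset_union_left.trans hDR)
        (union_subset (subset_union_right.trans hDR) (biUnion_subset.2 fun e he => ?_))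
      obtain ⟨x, hxR, rfl⟩ := mem_image.1 he
      have hx := mem_erase.1 (hRB hxR)
      rw [((hf x hx.2).2 hx.1).2.2.2]
      refine insert_subset (mem_insert_of_mem hxR) (singleton_subset_iff.2 ?_)
      obtain ⟨y, hy, hxy⟩ := mem_biUnion.1 hxR
      obtain ⟨-, hxy⟩ := mem_erase.1 hxy
      by_cases hpv : par x = v
      · exact hpv ▸ mem_insert_self _ _
      · exact mem_insert_of_mem (mem_biUnion.2 ⟨y, hy, mem_erase.2 ⟨hpv,
          hQp y (hDB hy) x hxy hx.1⟩⟩)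
    have h3 := (card_le_card hsub).trans (card_insert_le _ _)
    omega
  · omega

/-- A multigraph with many more edges than vertices contains a small subgraph of one of the
canonical types with more edges than vertices. -/
theorem exists_small_canonicalShape [DecidableEq γ] {δ : ℝ} (hδ : 0 < δ) (hV : V.Nonempty)
    (hd : ∀ e ∈ E, d e ⊆ V ∧ (d e).Nonempty ∧ (d e).card ≤ 2)
    (h : (1 + δ) * V.card ≤ E.card) :
    ∃ W ⊆ V, ∃ F ⊆ E, IsCanonicalShape (Links d) W F ∧ W.card < F.card ∧
      ∃ r : ℕ, (1 + δ) ^ r ≤ V.card ∧ F.card ≤ 4 * r + 6 := by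
  classical
  obtain ⟨V', hV', ⟨v, hv⟩, E', hE', hdE', hdense⟩ :=
    exists_dense_subgraph hV (fun e he => ⟨(hd e he).1, (hd e he).2.1⟩) h
  have hball := gball_subset hv hdE'
  have hcV : ∀ i, ((gball d E' v i).card : ℝ) ≤ V.card := fun i => by
    exact_mod_cast card_le_card ((hball i).trans hV')
  -- While the balls have no surplus of edges they grow by a factor 1 + δ: edges meeting one ball
  -- lie inside the next, which has at least as many vertices as inner edges.
  have hgrow : ∀ i, (∀ j ≤ i, (inner d E' (gball d E' v j)).card ≤ (gball d E' v j).card) →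
      (1 + δ) ^ i ≤ (gball d E' v i).card := by
    intro i
    induction i with
    | zero => simp [gball]
    | succ i ih =>
      intro hi
      have h1 := ih fun j hj => hi j (by omega)
      have h2 := hdense _ (hball i)
      have h3 : ((touching d E' (gball d E' v i)).card : ℝ) ≤ (gball d E' v (i + 1)).card := by
        exact_mod_cast (card_le_card touching_subset_inner).trans (hi (i + 1) le_rfl)
      rw [pow_succ']
      nlinarith
  have hex : ∃ r, (gball d E' v r).card < (inner d E' (gball d E' v r)).card := by
    by_contra! hn
    obtain ⟨n, hn'⟩ := pow_unbounded_of_one_lt (V.card : ℝ) (show 1 < 1 + δ by linarith)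
    exact absurd ((hgrow n fun j _ => hn j).trans (hcV n)) (not_le.2 hn')
  have hm := Nat.find_spec hex
  obtain ⟨F₀, hF₀, hs, hc⟩ := exists_small_surplus (fun e he => (hd e (hE' he)).2.2) hm
  obtain ⟨W, F, hF, hW, hshape, hlt⟩ :=
    exists_canonicalShape d F₀ (fun e he => (hd e (hE' (hF₀ he))).2) hs
  have hFE := hF.trans (hF₀.trans hE')
  refine ⟨W, hW.trans (biUnion_subset.2 fun e he => (hd e (hFE he)).1), F, hFE, hshape, hlt, ?_⟩
  have hcF := (card_le_card hF).trans hc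
  -- Growth is guaranteed up to the radius before the first surplus. Counting from that radius r,
  -- the bound 4(r + 1) + 2 becomes 4r + 6.
  cases hr : Nat.find hex with
  | zero =>
    refine ⟨0, ?_, by omega⟩
    rw [pow_zero]
    exact_mod_cast card_pos.2 hV
  | succ r =>
    refine ⟨r, (hgrow r fun j hj => ?_).trans (hcV r), by omega⟩
    exact not_lt.1 (Nat.find_min hex (by omega))

end Dense

end SetPacking

/-! ### From the hypergraph back to packings and improvements -/

namespace SetPacking

open Finset

section

variable {β γ : Type*} [DecidableEq β] [DecidableEq γ] {J : γ → β → β → Prop} {d : γ → Finset β}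
  {x y : β} {W : Finset β} {F : Finset γ} {e : γ}

theorem IsPath.exists_joins (h : IsPath J x y W F) (he : e ∈ F) : ∃ u v, J e u v := by
  induction h with
  | nil => simp at he
  | cons hJ _ _ ih =>
    rcases mem_insert.1 he with rfl | he
    · exact ⟨_, _, hJ⟩
    · exact ih he

theorem IsCycle.exists_joins (h : IsCycle J x W F) (he : e ∈ F) : ∃ u v, J e u v := by
  obtain ⟨y, F', e', h1, -, h3, rfl⟩ := h
  rcases mem_insert.1 he with rfl | he
  · exact ⟨_, _, h3⟩
  · exact h1.exists_joins he

theorem IsCanonicalShape.exists_joins (h : IsCanonicalShape J W F) (he : e ∈ F) :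
    ∃ u v, J e u v := by
  cases h with
  | twoCycles h₁ h₂ =>
    rcases mem_union.1 he with he | he
    exacts [h₁.exists_joins he, h₂.exists_joins he]
  | dumbbell h₁ h₂ h₃ =>
    simp only [mem_union] at he
    rcases he with (he | he) | he
    exacts [h₁.exists_joins he, h₂.exists_joins he, h₃.exists_joins he]
  | theta _ h₁ h₂ h₃ =>
    simp only [mem_union] at he
    rcases he with (he | he) | he
    exacts [h₁.exists_joins he, h₂.exists_joins he, h₃.exists_joins he]
  | path h => exact h.exists_joins he
  | lollipop h₁ h₂ =>
    rcases mem_union.1 he with he | he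
    exacts [h₁.exists_joins he, h₂.exists_joins he]
  | cycle h => exact h.exists_joins he

theorem IsCanonicalShape.subset (h : IsCanonicalShape (Links d) W F) (he : e ∈ F) : d e ⊆ W := by
  intro v hv
  cases h with
  | twoCycles h₁ h₂ =>
    rcases mem_union.1 he with he | he
    · simp [h₁.subset he hv]
    · simp [h₂.subset he hv]
  | dumbbell h₁ h₂ h₃ =>
    simp only [mem_union] at he
    rcases he with (he | he) | he
    · simp [h₁.subset he hv]
    · simp [h₂.subset he hv]
    · simp [h₃.subset he hv]
  | theta _ h₁ h₂ h₃ =>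
    simp only [mem_union] at he
    rcases he with (he | he) | he
    · simp [h₁.subset he hv]
    · simp [h₂.subset he hv]
    · simp [h₃.subset he hv]
  | path h => exact h.subset he hv
  | lollipop h₁ h₂ =>
    rcases mem_union.1 he with he | he
    · simp [h₁.subset he hv]
    · simp [h₂.subset he hv]
  | cycle h => exact h.subset he hv

end

section

variable {α : Type*} {S A B : Finset (Finset α)}

theorem IsPacking.subset (h : IsPacking S A) (hB : B ⊆ A) : IsPacking S B :=
  ⟨hB.trans h.1, fun s hs t ht => h.2 s (hB hs) t (hB ht)⟩

variable [DecidableEq α]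

theorem mem_nbrs {u v : Finset α} : u ∈ nbrs A v ↔ u ∈ A ∧ ¬ Disjoint u v := mem_filter

theorem IsPacking.card_nbrs_le (h : IsPacking S A) (v : Finset α) : (nbrs A v).card ≤ v.card := by
  have h1 : ((nbrs A v).biUnion fun u => u ∩ v).card = ∑ u ∈ nbrs A v, (u ∩ v).card := by
    refine card_biUnion fun u hu w hw hne => ?_
    exact (h.2 u (mem_nbrs.1 hu).1 w (mem_nbrs.1 hw).1 hne).mono inter_subset_left inter_subset_left
  have h2 : (nbrs A v).card ≤ ∑ u ∈ nbrs A v, (u ∩ v).card := by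
    rw [card_eq_sum_ones]
    refine sum_le_sum fun u hu => ?_
    exact card_pos.2 (not_disjoint_iff_nonempty_inter.1 (mem_nbrs.1 hu).2)
  rw [← h1] at h2
  exact h2.trans (card_le_card (biUnion_subset.2 fun u _ => inter_subset_right))

/-- Exchanging members of a packing for members of another packing that meet only those. -/
theorem IsPacking.exchange (hA : IsPacking S A) (hB : IsPacking S B) {P Q : Finset (Finset α)}
    (hP : P ⊆ B) (h : ∀ b ∈ P, nbrs A b ⊆ Q) : IsPacking S ((A \ Q) ∪ P) := by
  have key : ∀ s ∈ A \ Q, ∀ t ∈ P, Disjoint s t := by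
    intro s hs t ht
    by_contra hn
    rw [mem_sdiff] at hs
    exact hs.2 (h t ht (mem_nbrs.2 ⟨hs.1, hn⟩))
  refine ⟨union_subset (sdiff_subset.trans hA.1) (hP.trans hB.1), fun s hs t ht hne => ?_⟩
  rcases mem_union.1 hs with hs | hs <;> rcases mem_union.1 ht with ht | ht
  · exact hA.2 s (mem_sdiff.1 hs).1 t (mem_sdiff.1 ht).1 hne
  · exact key s hs t ht
  · exact (key t ht s hs).symm
  · exact hB.2 s (hP hs) t (hP ht) hne

theorem nbrs_subset_sdiff (hB : IsPacking S B) {b : Finset α} (hb : b ∈ B \ A) :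
    nbrs A b ⊆ A \ B := by
  intro u hu
  obtain ⟨hu, hd⟩ := mem_nbrs.1 hu
  rw [mem_sdiff] at hb ⊢
  exact ⟨hu, fun huB => hd (hB.2 u huB b hb.1 fun e => hb.2 (e ▸ hu))⟩

/-- If V had too few neighbours, a subcollection with exactly one member more than V has neighbours
could replace all those neighbours, a local improvement. -/
theorem card_le_card_biUnion_nbrs {p : ℕ} (hA : IsPacking S A) (hB : IsPacking S B)
    (hloc : ∀ A', ¬ LocalImprovement S p A A') {V : Finset (Finset α)} (hV : V ⊆ B \ A)
    (hp : V.card ≤ p) : V.card ≤ (V.biUnion (nbrs A)).card := by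
  by_contra! hn
  obtain ⟨V', hV', hc⟩ := exists_subset_card_eq (Nat.succ_le_of_lt hn)
  have hVB : V' ⊆ B := hV'.trans (hV.trans sdiff_subset)
  refine hloc _ ⟨V', V.biUnion (nbrs A), ?_, biUnion_subset.2 fun _ _ => filter_subset _ _, hc, ?_,
    rfl, hA.exchange hB hVB fun b hb => subset_biUnion_of_mem (nbrs A) (hV' hb)⟩
  · exact (hV'.trans hV).trans (sdiff_subset_sdiff hB.1 le_rfl)
  · exact (card_le_card hV').trans hp

/-- The incidence system between `A \ B` and `B \ A`, for packings `A` and `B` such that `A` admits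
no small local improvement. -/
def packingSystem {k s p : ℕ} (hk : ∀ v ∈ S, v.card ≤ k) (hA : IsPacking S A) (hB : IsPacking S B)
    (hloc : ∀ A', ¬ LocalImprovement S p A A') (hs : 1 + k * s ≤ p) :
    LocalSystem (Finset α) (Finset α) where
  A := A \ B
  B := B \ A
  N := nbrs A
  k := k
  s := s
  p := p
  subset _ hb := nbrs_subset_sdiff hB hb
  card_le b hb := (hA.card_nbrs_le b).trans (hk b (hB.1 (mem_sdiff.1 hb).1))
  expand _ hV hp := card_le_card_biUnion_nbrs hA hB hloc hV hp
  size := hs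

theorem card_filter_mem_nbrs_le {k : ℕ} (hk : ∀ v ∈ S, v.card ≤ k) (hA : IsPacking S A)
    (hB : IsPacking S B) {a : Finset α} (ha : a ∈ A) :
    ((B \ A).filter fun b => a ∈ nbrs A b).card ≤ k := by
  refine (card_le_card ?_).trans ((hB.card_nbrs_le a).trans (hk a (hA.1 ha)))
  intro b hb
  obtain ⟨h1, h2⟩ := mem_filter.1 hb
  exact mem_nbrs.2 ⟨(mem_sdiff.1 h1).1, fun h => (mem_nbrs.1 h2).2 h.symm⟩

theorem LocalSystem.Core.notMem_ins {G : LocalSystem (Finset α) (Finset α)}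
    {X : Finset (Finset α)} {F : Finset α → Finset (Finset α)} {b c a : Finset α}
    (h : G.Core X F b) (hb : b ∈ G.B) (hc : c ∈ X) (ha : a ∈ G.N c \ F c) :
    b ∉ G.ins (X.erase c) (G.comp (X.erase c) a) := by
  intro hm
  obtain ⟨hm, hs⟩ := LocalSystem.mem_ins.1 hm
  obtain ⟨x, hx⟩ := G.nonempty hb
  exact disjoint_left.1 (h c hc (Ne.symm (mem_erase.1 hm).1) a ha) hx (hs hx)

/-- A subgraph of canonical type of the core yields a canonical improvement with tail changes. -/
theorem exists_canonicalImprovement (hA : IsPacking S A) (hB : IsPacking S B)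
    {G : LocalSystem (Finset α) (Finset α)} (hGA : G.A ⊆ A) (hGB : G.B ⊆ B \ A)
    (hGN : ∀ b, G.N b = nbrs A b) (hsp : G.s ≤ G.p) {X I W : Finset (Finset α)}
    {F : Finset α → Finset (Finset α)} (h : G.Ends X F) (hI : I ⊆ X)
    (hcore : ∀ b ∈ I, G.Core X F b) (hWA : W ⊆ A) (hshape : IsCanonicalShape (Links F) W I)
    (hlt : W.card < I.card) {ℓ τ : ℝ} (hℓ : (I.card : ℝ) ≤ ℓ) (hτ : (G.s : ℝ) ≤ τ) :
    ∃ A', CanonicalImprovement S ℓ τ A A' := by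
  classical
  have hXB : X ⊆ B \ A := h.good.1.trans hGB
  have hXG := h.good.1
  have hBS : B \ A ⊆ S \ A := sdiff_subset_sdiff hB.1 le_rfl
  set K : (Σ _ : Finset α, Finset α) → Finset (Finset α) :=
    fun q => G.comp (X.erase q.1) q.2 with hK
  set L : (Σ _ : Finset α, Finset α) → Finset (Finset α) :=
    fun q => G.ins (X.erase q.1) (K q) with hL
  -- All tails of all members of I are swapped, one for each neighbour that is not a chosen end.
  set Q := I.sigma (fun b => G.N b \ F b) with hQ
  have hQ' : ∀ q ∈ Q, q.1 ∈ I ∧ q.2 ∈ G.N q.1 \ F q.1 := fun q hq => mem_sigma.1 hq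
  set sw : (Σ _ : Finset α, Finset α) → Swap α := fun q => ⟨q.1, q.2, K q, L q⟩ with hsw
  have hKA : ∀ q ∈ Q, K q ⊆ A := by
    intro q hq
    obtain ⟨h1, h2⟩ := hQ' q hq
    exact (LocalSystem.comp_subset_A ((erase_subset _ _).trans hXG)
      (G.subset _ (hXG (hI h1)) (mem_sdiff.1 h2).1)).trans hGA
  have hLX : ∀ q, L q ⊆ X := fun q => LocalSystem.ins_subset.trans (erase_subset _ _)
  have hKd : ∀ q ∈ Q, ∀ q' ∈ Q, q ≠ q' → Disjoint (K q) (K q') := by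
    intro q hq q' hq' hne
    obtain ⟨h1, h2⟩ := hQ' q hq
    obtain ⟨h1', h2'⟩ := hQ' q' hq'
    exact h.disjoint_tails (hI h1) (hcore _ h1) h2 (hI h1') (hcore _ h1') h2' fun e e' =>
      hne (Sigma.ext e (heq_of_eq e'))
  have hLd : ∀ q ∈ Q, ∀ q' ∈ Q, q ≠ q' → Disjoint (L q) (L q') := by
    intro q hq q' hq' hne
    rw [disjoint_left]
    intro c hc hc'
    obtain ⟨x, hx⟩ := G.nonempty (hXG (hLX q hc))
    exact disjoint_left.1 (hKd q hq q' hq' hne) ((LocalSystem.mem_ins.1 hc).2 hx)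
      ((LocalSystem.mem_ins.1 hc').2 hx)
  have hLI : ∀ q ∈ Q, ∀ b ∈ I, b ∉ L q := by
    intro q hq b hb
    obtain ⟨h1, h2⟩ := hQ' q hq
    exact (hcore b hb).notMem_ins (hXG (hI hb)) (hI h1) h2
  have hKL : ∀ q ∈ Q, (L q).card = (K q).card := by
    intro q hq
    obtain ⟨h1, h2⟩ := hQ' q hq
    exact (h.stok (hI h1) h2).1.1
  have hKs : ∀ q ∈ Q, (K q).card ≤ G.s := by
    intro q hq
    obtain ⟨h1, h2⟩ := hQ' q hq
    exact (h.stok (hI h1) h2).1.2.1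
  have hFK : ∀ b ∈ I, ∀ x ∈ F b, ∀ q ∈ Q, x ∉ K q := by
    intro b hb x hx q hq
    obtain ⟨h1, h2⟩ := hQ' q hq
    exact h.notMem_tail (hI hb) (hcore b hb) hx (hI h1) h2
  have hF2 : ∀ q ∈ Q, (F q.1).card = 2 := by
    intro q hq
    obtain ⟨h1, h2⟩ := hQ' q hq
    rw [h.card _ (hI h1)]
    have := h.three_le (hI h1) h2
    omega
  set U := Q.biUnion K with hU
  set V := Q.biUnion L with hV
  -- Every other neighbour is the root of a tail and disappears, while core ends lie in no tail. So
  -- the auxiliary multigraph on I is the one given by F.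
  have hends : ∀ b ∈ I, nbrs (A \ U) b = F b := by
    intro b hb
    ext x
    rw [mem_nbrs, mem_sdiff, and_right_comm, ← mem_nbrs, ← hGN]
    constructor
    · rintro ⟨hx, hxU⟩
      by_contra hxF
      exact hxU (mem_biUnion.2 ⟨⟨b, x⟩, mem_sigma.2 ⟨hb, mem_sdiff.2 ⟨hx, hxF⟩⟩,
        LocalSystem.mem_comp_self⟩)
    · intro hx
      refine ⟨h.subset b (hI hb) hx, fun hxU => ?_⟩
      obtain ⟨q, hq, hxq⟩ := mem_biUnion.1 hxU
      exact hFK b hb x hx q hq hxq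
  have htwo : ∀ q ∈ Q, ∀ q₁ ∈ Q, ∀ q₂ ∈ Q, 2 ≤ (nbrs (A \ (K q₁ ∪ K q₂)) q.1).card := by
    intro q hq q₁ hq₁ q₂ hq₂
    rw [← hF2 q hq]
    refine card_le_card fun x hx => ?_
    have hb := (hQ' q hq).1
    have hxN := h.subset _ (hI hb) hx
    rw [hGN, mem_nbrs] at hxN
    refine mem_nbrs.2 ⟨mem_sdiff.2 ⟨hxN.1, fun hxK => ?_⟩, hxN.2⟩
    rcases mem_union.1 hxK with hxK | hxK
    · exact hFK _ hb x hx q₁ hq₁ hxK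
    · exact hFK _ hb x hx q₂ hq₂ hxK
  have hVI : Disjoint V I := by
    rw [disjoint_left]
    intro c hc hcI
    obtain ⟨q, hq, hcq⟩ := mem_biUnion.1 hc
    exact hLI q hq c hcI hcq
  have hUo : (Q.image sw).biUnion Swap.out = U := by
    rw [image_biUnion]
  have hVo : (Q.image sw).biUnion Swap.inn = V := by
    rw [image_biUnion]
  refine ⟨_, I, Q.image sw, U, V, W, I, (hI.trans hXB).trans hBS, hℓ, ?_, ?_, hUo.symm, hVo.symm,
    hVI, ?_, hWA, ?_, ?_, rfl, ?_⟩
  · intro T hT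
    obtain ⟨q, hq, rfl⟩ := mem_image.1 hT
    obtain ⟨h1, h2⟩ := hQ' q hq
    have hst := h.stok (hI h1) h2
    refine ⟨⟨hBS (hXB (hI h1)), ?_, hKA q hq, ?_, (hKL q hq).symm, hLI q hq _ h1, ?_, ?_⟩, h1, ?_⟩
    · rw [← hGN]
      exact h.three_le (hI h1) h2
    · exact ⟨((hLX q).trans hXB).trans hBS,
        (hB.subset (((hLX q).trans hXB).trans sdiff_subset)).2⟩
    · change nbrs (K q) q.1 = {q.2}
      rw [← hst.2]
      ext x
      rw [mem_inter, hGN, mem_nbrs, mem_nbrs]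
      exact ⟨fun hx => ⟨⟨hKA q hq hx.1, hx.2⟩, hx.1⟩, fun hx => ⟨hx.2, hx.1.2⟩⟩
    · change (L q).biUnion (nbrs A) = K q
      rw [← LocalSystem.biUnion_ins_of_card ((erase_subset _ _).trans hXG) (hKL q hq)
        ((hKs q hq).trans hsp)]
      exact biUnion_congr rfl fun b _ => (hGN b).symm
    · refine le_trans ?_ hτ
      have := (hKL q hq).trans_le (hKs q hq)
      exact_mod_cast this
  · intro T hT T' hT' hne
    obtain ⟨q, hq, rfl⟩ := mem_image.1 hT
    obtain ⟨q', hq', rfl⟩ := mem_image.1 hT'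
    have hqq : q ≠ q' := fun e => hne (e ▸ rfl)
    refine ⟨?_, htwo q hq q hq q' hq', htwo q' hq' q hq q' hq'⟩
    by_cases hb : q.1 = q'.1
    · refine Or.inr ⟨hb, fun e => hqq (Sigma.ext hb (heq_of_eq e)), hLd q hq q' hq' hqq⟩
    · refine Or.inl ⟨hb, ?_⟩
      change Disjoint (insert q.1 (L q)) (insert q'.1 (L q'))
      rw [disjoint_insert_left, disjoint_insert_right, mem_insert, not_or]
      exact ⟨⟨hb, hLI q' hq' _ (hQ' q hq).1⟩, hLI q hq _ (hQ' q' hq').1, hLd q hq q' hq' hqq⟩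
  · intro v hv h3
    rw [hends v hv, h.card v (hI hv), hGN]
    omega
  · refine hshape.mono fun e he u v hJ => ⟨he, ?_⟩
    rw [← show F e = {u, v} from hJ, ends]
    split_ifs with h2
    · rw [← hGN]
      refine (eq_of_subset_of_card_le (h.subset e (hI he)) ?_).symm
      rw [h.card e (hI he), hGN]
      omega
    · exact hends e he
  -- The tails exchange equal numbers, so the whole gain is that of the subgraph, I having more
  -- edges than W has vertices.
  · have c1 : V.card = ∑ q ∈ Q, (L q).card := card_biUnion hLd
    have c2 : U.card ≤ ∑ q ∈ Q, (K q).card := card_biUnion_le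
    have c3 : ∑ q ∈ Q, (L q).card = ∑ q ∈ Q, (K q).card := sum_congr rfl hKL
    have c4 := card_union_le U W
    rw [card_union_of_disjoint hVI]
    omega
  · refine hA.exchange hB (union_subset ?_ ((hI.trans hXB).trans sdiff_subset)) fun b hb => ?_
    · exact biUnion_subset.2 fun q _ => ((hLX q).trans hXB).trans sdiff_subset
    · rcases mem_union.1 hb with hb | hb
      · obtain ⟨q, hq, hbq⟩ := mem_biUnion.1 hb
        rw [← hGN]
        exact (LocalSystem.mem_ins.1 hbq).2.trans
          ((subset_biUnion_of_mem K hq).trans subset_union_left)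
      · intro x hx
        by_cases hxU : x ∈ U
        · exact mem_union_left _ hxU
        · refine mem_union_right _ (hshape.subset hb ?_)
          rw [← hends b hb]
          rw [mem_nbrs] at hx
          exact mem_nbrs.2 ⟨mem_sdiff.2 ⟨hx.1, hxU⟩, hx.2⟩

/-- Every step of the algorithm leads to a larger packing. -/
theorem LIStep.card_lt {p : ℕ} {ℓ τ : ℝ} {A' : Finset (Finset α)} (h : LIStep S p ℓ τ A A') :
    A.card < A'.card ∧ IsPacking S A' := by
  have key : ∀ Q P : Finset (Finset α), Q ⊆ A → P ⊆ S \ A → Q.card < P.card →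
      A.card < ((A \ Q) ∪ P).card := by
    intro Q P hQ hP hlt
    rw [card_union_of_disjoint (disjoint_left.2 fun x hx hx' =>
      (mem_sdiff.1 (hP hx')).2 (mem_sdiff.1 hx).1)]
    have := card_sdiff_add_card_eq_card hQ
    omega
  rcases h with ⟨P, Q, hP, hQ, hc, -, rfl, hA'⟩ |
    ⟨-, I, 𝒯, U, V, W, F, hI, -, hT, -, rfl, rfl, -, -, hW, hF, hc, rfl, hA'⟩
  · exact ⟨key Q P hQ hP (by omega), hA'⟩
  · refine ⟨key _ _ (union_subset (biUnion_subset.2 fun T hTm => (hT T hTm).1.2.2.1) hW)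
      (union_subset (biUnion_subset.2 fun T hTm => (hT T hTm).1.2.2.2.1.1) fun e he => ?_) hc, hA'⟩
    obtain ⟨u, v, hJ⟩ := hF.exists_joins he
    exact hI hJ.1

end

end SetPacking

/-! ### Choice of parameters and conclusion -/

namespace SetPacking

open Finset

section

variable {α : Type*} [DecidableEq α] {S A B : Finset (Finset α)} {k p : ℕ}

/-- With p ≥ 1 every member of `B \ A` has a neighbour, and every vertex has at most k of them. This
ratio k settles large ε. -/
theorem card_sdiff_le_mul (hk : ∀ v ∈ S, v.card ≤ k) (hA : IsPacking S A) (hB : IsPacking S B)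
    (hloc : ∀ A', ¬ LocalImprovement S p A A') (hp : 1 ≤ p) :
    (B \ A).card ≤ (A \ B).card * k := by
  set G := packingSystem (s := 0) hk hA hB hloc (by simpa using hp) with hG
  refine le_trans ?_ (LocalSystem.sum_degree_le (G := G) (A' := A \ B) Subset.rfl
    fun a ha => card_filter_mem_nbrs_le hk hA hB (mem_sdiff.1 ha).1)
  rw [card_eq_sum_ones]
  refine sum_le_sum fun b hb => ?_
  have h : G.N b ∩ (A \ B) = G.N b := inter_eq_left.2 (G.subset b hb)
  rw [h]
  exact card_pos.2 (G.nonempty hb)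

/-- The logarithmic bound on the size of the subgraph. -/
theorem four_mul_add_six_le {δ : ℝ} (hδ : 0 < δ) (hδ' : δ ≤ 1 / 2) {r v n : ℕ} (hv : 0 < v)
    (hr : (1 + δ) ^ r ≤ v) (hn : 2 * v ≤ n) : (4 * r + 6 : ℝ) ≤ 4 / δ * Real.logb 2 n := by
  have hv' : (0 : ℝ) < v := by exact_mod_cast hv
  -- Bernoulli's inequality with exponent δ ≤ 1 turns the logarithm to base 1 + δ into one to base 2
  -- at the cost of a factor 1/δ.
  have h2 : (2 : ℝ) ^ δ ≤ 1 + δ := by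
    have := rpow_one_add_le_one_add_mul_self (s := 1) (by norm_num) hδ.le (by linarith)
    norm_num at this
    exact this
  have h3 : δ ≤ Real.logb 2 (1 + δ) := by
    rw [Real.le_logb_iff_rpow_le (by norm_num) (by linarith)]
    exact h2
  have h4 : r * Real.logb 2 (1 + δ) ≤ Real.logb 2 v := by
    rw [← Real.logb_pow]
    exact Real.logb_le_logb_of_le (by norm_num) (by positivity) hr
  have h5 : 1 + Real.logb 2 v ≤ Real.logb 2 n := by
    have : Real.logb 2 (2 * v) = 1 + Real.logb 2 v := by
      rw [Real.logb_mul (by norm_num) hv'.ne', Real.logb_self_eq_one (by norm_num)]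
    rw [← this]
    exact Real.logb_le_logb_of_le (by norm_num) (by positivity) (by exact_mod_cast hn)
  have h6 : r * δ ≤ r * Real.logb 2 (1 + δ) := mul_le_mul_of_nonneg_left h3 (Nat.cast_nonneg r)
  rw [div_mul_eq_mul_div, le_div_iff₀ hδ]
  -- The factor 2 in n ≥ 2v gains 4/δ ≥ 8, which absorbs the additive 6.
  nlinarith

theorem mul_card_le_of_mul_le {n m a : ℕ} {c ε : ℝ} (h : n * m ≤ a) (hm : 1 ≤ c * ε * m)
    (hc : 0 ≤ c * ε) : (n : ℝ) ≤ c * ε * a := by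
  have h1 : ((n * m : ℕ) : ℝ) ≤ a := by exact_mod_cast h
  push_cast at h1
  have h2 : (n : ℝ) * 1 ≤ n * (c * ε * m) := mul_le_mul_of_nonneg_left hm (Nat.cast_nonneg n)
  have h3 := mul_le_mul_of_nonneg_left h1 hc
  linarith

theorem card_sdiff_le {ε ℓ τ : ℝ} (hk2 : 2 ≤ k) (hε : 0 < ε) (hk : ∀ v ∈ S, v.card ≤ k)
    (hp : p = ⌈40 * (k / ε)⌉₊) (hℓ : ℓ = 4 / min ε (1 / 2) * Real.logb 2 S.card)
    (hτ : τ = 2 * ((k : ℝ) - 1) / ε) (hA : IsPacking S A) (hB : IsPacking S B)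
    (hloc : ∀ A', ¬ LocalImprovement S p A A') (hcan : ∀ A', ¬ CanonicalImprovement S ℓ τ A A') :
    ((B \ A).card : ℝ) ≤ (((k : ℝ) + 1) / 3 + ε) * (A \ B).card := by
  have hkR : (2 : ℝ) ≤ k := by exact_mod_cast hk2
  have hpR : 40 * (k / ε) ≤ p := hp ▸ Nat.le_ceil _
  have hkε : 0 < k / ε := by positivity
  have hp1 : 1 ≤ p := by
    have : (0 : ℝ) < p := by linarith
    exact_mod_cast this
  -- Here k ≤ (k + 1)/3 + ε, so the ratio k is enough. Otherwise k/ε ≥ 3/2, and additive constants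
  -- can be absorbed into p.
  by_cases hbig : (2 * k - 1) / 3 ≤ ε
  · have h1 : ((B \ A).card : ℝ) ≤ (A \ B).card * k := by
      exact_mod_cast card_sdiff_le_mul hk hA hB hloc hp1
    have h2 : (k : ℝ) ≤ (k + 1) / 3 + ε := by linarith
    nlinarith [(Nat.cast_nonneg (A \ B).card : (0 : ℝ) ≤ (A \ B).card)]
  by_contra! hn
  have ht : 3 / 2 ≤ k / ε := by
    rw [le_div_iff₀ hε]
    linarith
  set t := k / ε with htdef
  have hkt : (k : ℝ) = t * ε := (div_mul_cancel₀ _ hε.ne').symm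
  have hinv : 1 / ε ≤ t / 2 := by
    rw [div_le_div_iff₀ hε (by norm_num)]
    linarith
  have hinv0 : 0 < 1 / ε := by positivity
  -- Trees with more than s vertices number at most ε|A|/2, and s stays below τ. The pieces of size
  -- w = ⌈10/ε⌉ cost at most ε|A|/10.
  set s := ⌊2 / ε⌋₊ with hs
  set w := ⌈10 / ε⌉₊ with hw
  have hsle : (s : ℝ) ≤ 2 * (1 / ε) := by
    rw [mul_one_div]
    exact Nat.floor_le (by positivity)
  have hslt : 2 * (1 / ε) < s + 1 := by
    rw [mul_one_div]
    exact Nat.lt_floor_add_one _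
  have hwle : 10 * (1 / ε) ≤ w := by
    rw [mul_one_div]
    exact Nat.le_ceil _
  have hwlt : (w : ℝ) < 10 * (1 / ε) + 1 := by
    rw [mul_one_div]
    exact Nat.ceil_lt_add_one (by positivity)
  have hks : (k : ℝ) * s ≤ 2 * t := by
    have := mul_le_mul_of_nonneg_left hsle (show (0 : ℝ) ≤ k by linarith)
    have e : (k : ℝ) * (2 * (1 / ε)) = 2 * t := by rw [htdef]; ring
    linarith
  -- With t = k/ε the left side is at most 18t + 8, and t ≥ 3/2 brings this below 40t.
  have hbound : 2 * w + 2 + 4 * (1 + k * s) ≤ p := by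
    have : (2 * w + 2 + 4 * (1 + k * s) : ℝ) ≤ p := by linarith
    exact_mod_cast this
  have h2s : 2 * s < p := by
    have : (2 * s : ℝ) < p := by linarith
    exact_mod_cast this
  obtain ⟨G, hGA, hGB, hGN, hGk, hGs, hGp⟩ : ∃ G : LocalSystem (Finset α) (Finset α),
      G.A = A \ B ∧ G.B = B \ A ∧ G.N = nbrs A ∧ G.k = k ∧ G.s = s ∧ G.p = p :=
    ⟨packingSystem (s := s) hk hA hB hloc (by omega), rfl, rfl, rfl, rfl, rfl, rfl⟩
  obtain ⟨X, hX, n₁, n₂, n₃, h1, h2, h3, hmain⟩ := LocalSystem.exists_good (G := G) (w := w)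
    (by rwa [hGk]) (fun a ha => by
      rw [hGB, hGN, hGk]
      exact card_filter_mem_nbrs_le hk hA hB (mem_sdiff.1 (hGA ▸ ha)).1) (by rwa [hGk, hGs, hGp])
  obtain ⟨F, hF⟩ := hX.exists_ends
  obtain ⟨E, hEX, V, hVA, hEV, hsur⟩ := hF.exists_surplus (by rwa [hGs, hGp])
  generalize ∑ U ∈ G.pos X, (((G.ins X U).card : ℤ) - U.card) = σ at hmain hsur
  rw [hGA] at h1 h2 h3 hmain hVA
  rw [hGs] at h2
  rw [hGp] at h3
  rw [hGB, hGk] at hmain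
  set a := (A \ B).card with ha
  have hmainR : 3 * ((B \ A).card : ℝ) ≤ (k + 1) * a + 2 * (σ : ℝ) + n₁ + n₂ + n₃ := by
    exact_mod_cast hmain
  have hsurR : (V.card : ℝ) + σ ≤ E.card := by exact_mod_cast hsur
  have hεinv : ε * (1 / ε) = 1 := mul_one_div_cancel hε.ne'
  have hεw := mul_le_mul_of_nonneg_left hwle hε.le
  have hεs := mul_le_mul_of_nonneg_left hslt.le hε.le
  have hεp := mul_le_mul_of_nonneg_left hpR hε.le
  have hn₁ : (n₁ : ℝ) ≤ 1 / 10 * ε * a :=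
    mul_card_le_of_mul_le h1 (by linarith) (by positivity)
  have hn₂ : (n₂ : ℝ) ≤ 1 / 2 * ε * a :=
    mul_card_le_of_mul_le h2 (by rw [Nat.cast_succ]; linarith) (by positivity)
  have hn₃ : (n₃ : ℝ) ≤ 1 / 40 * ε * a :=
    mul_card_le_of_mul_le h3 (by linarith) (by positivity)
  have ha0 : 0 < a := by
    rw [ha, card_pos]
    have hBne : (B \ A).Nonempty := by
      rw [← card_pos]
      have : (0 : ℝ) < (B \ A).card := 
        (mul_nonneg (by linarith) (Nat.cast_nonneg _)).trans_lt hn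
      exact_mod_cast this
    obtain ⟨b, hb⟩ := hBne
    rw [← hGB] at hb
    exact (G.nonempty hb).mono (hGA ▸ G.subset b hb)
  have ha0R : (0 : ℝ) < a := by exact_mod_cast ha0
  have hεa : 0 < ε * a := mul_pos hε ha0R
  -- The errors total 5/8 of εa, while the assumed ratio exceeds the main term of the count by 3εa;
  -- so 2σ exceeds 2εa.
  have hσε : ε * a ≤ σ := by linarith
  have hVa : (V.card : ℝ) ≤ a := by exact_mod_cast card_le_card hVA
  have hEne : E.Nonempty := by
    rw [← card_pos]
    have : (0 : ℝ) < E.card := by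
      have := (Nat.cast_nonneg V.card : (0 : ℝ) ≤ V.card)
      linarith
    exact_mod_cast this
  have hFne : ∀ b ∈ E, (F b).Nonempty := by
    intro b hb
    rw [← card_pos, hF.card b (hEX hb)]
    have := card_pos.2 (G.nonempty (hX.1 (hEX hb)))
    omega
  have hVne : V.Nonempty := by
    obtain ⟨b, hb⟩ := hEne
    exact (hFne b hb).mono (hEV b hb).2
  set δ := min ε (1 / 2) with hδ
  have hδ0 : 0 < δ := lt_min hε (by norm_num)
  have hδε : δ ≤ ε := min_le_left _ _
  have hdense : (1 + δ) * V.card ≤ E.card := by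
    have h0 := (Nat.cast_nonneg V.card : (0 : ℝ) ≤ V.card)
    have h4 : δ * V.card ≤ ε * a := mul_le_mul hδε hVa h0 hε.le
    linarith
  obtain ⟨W, hWV, I, hIE, hshape, hlt, r, hr, hIc⟩ := exists_small_canonicalShape hδ0 hVne
    (fun b hb => ⟨(hEV b hb).2, hFne b hb, by
      rw [hF.card b (hEX hb)]
      exact min_le_left _ _⟩) hdense
  have hVA' : V ⊆ A := hVA.trans sdiff_subset
  have hEB : E ⊆ B \ A := hEX.trans (hGB ▸ hX.1)
  -- V and E are disjoint parts of S and E is at least as large as V; this provides the factor 2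
  -- used in the logarithmic bound.
  have hn2 : 2 * V.card ≤ S.card := by
    have h4 : V.card ≤ E.card := by
      have h0 := (Nat.cast_nonneg V.card : (0 : ℝ) ≤ V.card)
      have : (V.card : ℝ) ≤ E.card := by nlinarith
      exact_mod_cast this
    have h5 : Disjoint V E := disjoint_left.2 fun x hx hx' => (mem_sdiff.1 (hEB hx')).2 (hVA' hx)
    have h6 := card_le_card (union_subset (hVA'.trans hA.1) ((hEB.trans sdiff_subset).trans hB.1))
    rw [card_union_of_disjoint h5] at h6
    omega
  have hIℓ : (I.card : ℝ) ≤ ℓ := by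
    have h4 := four_mul_add_six_le hδ0 (min_le_right _ _) (card_pos.2 hVne) hr hn2
    rw [hℓ]
    refine le_trans ?_ h4
    exact_mod_cast hIc
  have hsτ : (s : ℝ) ≤ τ := by
    rw [hτ, mul_div_assoc]
    refine hsle.trans ?_
    have : 1 / ε ≤ (k - 1) / ε := div_le_div_of_nonneg_right (by linarith) hε.le
    linarith
  obtain ⟨A', hA'⟩ := exists_canonicalImprovement hA hB (G := G)
    (hGA ▸ sdiff_subset) (hGB ▸ Subset.rfl) (fun _ => by rw [hGN]) (by omega) hF (hIE.trans hEX) (fun b hb => (hEV b (hIE hb)).1)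
    (hWV.trans hVA') hshape hlt hIℓ (hGs ▸ hsτ)
  exact hcan A' hA'

/-- The common part of A and B counts equally on both sides, and the ratio is at least 1. -/
theorem card_le_of_no_improvement {ε ℓ τ : ℝ} (hk2 : 2 ≤ k) (hε : 0 < ε)
    (hk : ∀ v ∈ S, v.card ≤ k)
    (hp : p = ⌈40 * (k / ε)⌉₊) (hℓ : ℓ = 4 / min ε (1 / 2) * Real.logb 2 S.card)
    (hτ : τ = 2 * ((k : ℝ) - 1) / ε) (hA : IsPacking S A) (hB : IsPacking S B)
    (hloc : ∀ A', ¬ LocalImprovement S p A A') (hcan : ∀ A', ¬ CanonicalImprovement S ℓ τ A A') :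
    (B.card : ℝ) ≤ (((k : ℝ) + 1) / 3 + ε) * A.card := by
  have h := card_sdiff_le hk2 hε hk hp hℓ hτ hA hB hloc hcan
  have hkR : (2 : ℝ) ≤ k := by exact_mod_cast hk2
  have h1 : ((B \ A).card : ℝ) + (A ∩ B).card = B.card := by
    rw [inter_comm]
    exact_mod_cast card_sdiff_add_card_inter B A
  have h2 : ((A \ B).card : ℝ) + (A ∩ B).card = A.card := by
    exact_mod_cast card_sdiff_add_card_inter A B
  rw [← h1, ← h2]
  nlinarith [(Nat.cast_nonneg (A ∩ B).card : (0 : ℝ) ≤ (A ∩ B).card)]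

theorem isPacking_of_reflTransGen {ℓ τ : ℝ} (hA : IsPacking S A)
    (h : Relation.ReflTransGen (LIStep S p ℓ τ) A B) : IsPacking S B := by
  cases h with
  | refl => exact hA
  | tail _ h => exact h.card_lt.2

theorem not_exists_infinite_run {ℓ τ : ℝ} :
    ¬ ∃ f : ℕ → Finset (Finset α), IsMaximalPacking S (f 0) ∧
      ∀ i, LIStep S p ℓ τ (f i) (f (i + 1)) := by
  rintro ⟨f, -, hf⟩
  have h : ∀ i, i ≤ (f i).card := by
    intro i
    induction i with
    | zero => simp
    | succ i ih => exact Nat.succ_le_of_lt (ih.trans_lt (hf i).card_lt.1)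
  have h1 := card_le_card (hf S.card).card_lt.2.1
  have h2 := h (S.card + 1)
  omega

end

end SetPacking

theorem mainTheorem1 :
    ∃ C ε₀ : ℝ, 0 < C ∧ 0 < ε₀ ∧
      ∀ (k : ℕ), 2 ≤ k → ∀ (ε : ℝ), 0 < ε →
      ∀ (α : Type*) [DecidableEq α] (S : Finset (Finset α)), (∀ s ∈ S, s.card ≤ k) →
      ∀ (p : ℕ) (ℓ τ : ℝ),
        p = ⌈C * (k / ε)⌉₊ →
        ℓ = 4 / min ε ε₀ * Real.logb 2 S.card →
        τ = 2 * ((k : ℝ) - 1) / ε →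
        -- every run of the algorithm stops
        (¬ ∃ f : ℕ → Finset (Finset α), SetPacking.IsMaximalPacking S (f 0) ∧
          ∀ i, SetPacking.LIStep S p ℓ τ (f i) (f (i + 1))) ∧
        -- every output is a packing within the claimed ratio of every packing
        (∀ A, SetPacking.LIOutput S p ℓ τ A → SetPacking.IsPacking S A ∧
          ∀ B, SetPacking.IsPacking S B → (B.card : ℝ) ≤ (((k : ℝ) + 1) / 3 + ε) * A.card) ∧
        -- so is every packing that admits neither kind of improvement
        (∀ A, SetPacking.IsPacking S A → (∀ A', ¬ SetPacking.LocalImprovement S p A A') →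
          (∀ A', ¬ SetPacking.CanonicalImprovement S ℓ τ A A') →
          ∀ B, SetPacking.IsPacking S B → (B.card : ℝ) ≤ (((k : ℝ) + 1) / 3 + ε) * A.card) := by
  refine ⟨40, 1 / 2, by norm_num, by norm_num, ?_⟩
  intro k hk2 ε hε α _ S hk p ℓ τ hp hℓ hτ
  refine ⟨SetPacking.not_exists_infinite_run, ?_, ?_⟩
  · rintro A ⟨⟨A₀, hA₀, hrun⟩, hend⟩
    have hA := SetPacking.isPacking_of_reflTransGen hA₀.1 hrun
    have hloc : ∀ A', ¬ SetPacking.LocalImprovement S p A A' := fun A' h => hend A' (Or.inl h)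
    exact ⟨hA, fun B hB => SetPacking.card_le_of_no_improvement hk2 hε hk hp hℓ hτ hA hB hloc
      fun A' h => hend A' (Or.inr ⟨hloc, h⟩)⟩
  · intro A hA hloc hcan B hB
    exact SetPacking.card_le_of_no_improvement hk2 hε hk hp hℓ hτ hA hB hloc hcan
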